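/- Let $G$ be a compact connected (real) Lie group with Lie algebra $\mathfrak g$, let $K\subset G$ be a compact connected Lie subgroup with Lie algebra $\mathfrak k\subset\mathfrak g$, let $\langle\cdot,\cdot\rangle$ be an $\mathrm{Ad}_G$-invariant scalar product on $\mathfrak g$, let $\mathfrak p$ be the orthogonal complement of $\mathfrak k$ in $\mathfrak g$, and let $\mathrm{pr}_{\mathfrak p}:\mathfrak g\to\mathfrak p$ be the orthogonal projection. Put $$\mathbf b(\mathfrak g,\mathfrak k)=\tfrac12\big(\dim\mathfrak p+\operatorname{rank}\mathfrak g-\operatorname{rank}\mathfrak k\big).$$ For $x\in\mathfrak g$ let $\mathfrak g(x)=\{\xi\in\mathfrak g:[\xi,x]=0\}$ and $\mathfrak k(x)=\mathfrak k\cap\mathfrak g(x)$; call $x$ generic if $\dim\mathfrak g(x)$ and $\dim\mathfrak k(x)$ are both minimal among all elements of $\mathfrak g$. A generic orbit is the adjoint orbit of a generic element. An adjoint orbit $\mathcal O=\mathrm{Ad}_G(x)\subset\mathfrak g$ carries the Poisson structure $\Lambda$ obtained by restricting the Lie–Poisson bracket $\{f,h\}(y)=-\langle y,[\nabla f(y),\nabla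 h(y)]\rangle$. Let $C_K^\infty(\mathcal O)$ be the Poisson algebra of smooth $\mathrm{Ad}_K$-invariant functions on $\mathcal O$, and for $y\in\mathcal O$ let $F_y=\{df(y): f\in C^\infty_K(\mathcal O)\}\subset T_y^*\mathcal O$. The differential dimension $\mathrm{ddim}\,C_K^\infty(\mathcal O)$ and the differential index $\mathrm{dind}\,C_K^\infty(\mathcal O)$ are the values of $\dim F_y$ and $\dim\ker(\Lambda_y|_{F_y})$ that are constant for $y$ in an open dense subset of $\mathcal O$. The complexity $c$ of the $K$-action on $\mathcal O$ is defined by $2c=\mathrm{ddim}\,C_K^\infty(\mathcal O)-\mathrm{dind}\,C_K^\infty(\mathcal O)$. The number $\mathbf c(\mathfrak g,\mathfrak k)$ is the complexity of the $K$-action on generic adjoint orbits. $K$ is a multiplicity free subgroup of $G$ if $C_K^\infty(\mathcal O)$ is Poisson commutative for generic adjoint orbits $\mathcal O$, and an almost multiplicity free subgroup if the $K$-action on generic adjoint orbits has complexity $1$. Then the complexity of the $K$-action is the same non-negative integer $\mathbf c(\mathfrak g,\mathfrak k)$ on all generic adjoint orbits, and for every generic $x\in\mathfrak g$ $$\mathbf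 c(\mathfrak g,\mathfrak k)=\mathbf b(\mathfrak g,\mathfrak k)-\dim\mathrm{pr}_{\mathfrak p}(\mathfrak g(x)).$$ Consequently, for every generic $x\in\mathfrak g$: (i) $K$ is a multiplicity free subgroup of $G$ if and only if $\dim\mathrm{pr}_{\mathfrak p}(\mathfrak g(x))=\mathbf b(\mathfrak g,\mathfrak k)$; (ii) $K$ is an almost multiplicity free subgroup of $G$ if and only if $\dim\mathrm{pr}_{\mathfrak p}(\mathfrak g(x))=\mathbf b(\mathfrak g,\mathfrak k)-1$. -/

import Mathlib

open scoped Manifold ContDiff Topology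
open Module

namespace AdjointComplexity

instance instLEInftyMinSmoothness : ENat.LEInfty (minSmoothness ℝ 3) :=
  ⟨by
    rw [minSmoothness_of_isRCLikeNormedField]
    exact ENat.LEInfty.out⟩

/-- The Lie algebra `𝔤 = T_1 G` of a real Lie group modelled on `E`, with Mathlib's bracket. -/
abbrev Alg (E : Type*) [NormedAddCommGroup E] [NormedSpace ℝ E]
    (G : Type*) [TopologicalSpace G] [ChartedSpace E G] [Group G] : Type _ :=
  GroupLieAlgebra 𝓘(ℝ, E) G

noncomputable section

section OneGroup

variable (E : Type*) [NormedAddCommGroup E] [NormedSpace ℝ E]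
  (G : Type*) [TopologicalSpace G] [ChartedSpace E G] [Group G]

/-- By construction, the vector space underlying `T_1 G` is the model space `E`; this is the
identity map, used to speak of smooth functions on `𝔤`. -/
def coord : Alg E G ≃L[ℝ] E := ContinuousLinearEquiv.refl ℝ E

instance instFiniteDimensionalAlg [FiniteDimensional ℝ E] : FiniteDimensional ℝ (Alg E G) :=
  inferInstanceAs (FiniteDimensional ℝ E)

/-- `Ad_g : 𝔤 → 𝔤`, the differential at `1` of the conjugation `h ↦ g h g⁻¹`. -/
def Ad (g : G) : Alg E G →L[ℝ] Alg E G :=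
  mfderiv 𝓘(ℝ, E) 𝓘(ℝ, E) (fun h : G => g * h * g⁻¹) 1

/-- The adjoint orbit `𝒪 = {Ad_g x : g ∈ G}` of `x`. -/
def adjointOrbit (x : Alg E G) : Set (Alg E G) := Set.range fun g : G => Ad E G g x

/-- An `Ad_G`-invariant scalar product on `𝔤`. -/
structure InvariantScalarProduct where
  form : LinearMap.BilinForm ℝ (Alg E G)
  symm : ∀ u v, form u v = form v u
  pos : ∀ u, u ≠ 0 → 0 < form u u
  invariant : ∀ (g : G) (u v : Alg E G), form (Ad E G g u) (Ad E G g v) = form u v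

end OneGroup

section Orbit

variable {E : Type*} [NormedAddCommGroup E] [NormedSpace ℝ E]
  {G : Type*} [TopologicalSpace G] [ChartedSpace E G] [Group G]

theorem InvariantScalarProduct.isRefl (P : InvariantScalarProduct E G) : P.form.IsRefl :=
  fun u v h => by rw [P.symm]; exact h

theorem InvariantScalarProduct.restrict_nondegenerate (P : InvariantScalarProduct E G)
    (W : Submodule ℝ (Alg E G)) : (P.form.restrict W).Nondegenerate := by
  have key : ∀ u : W, (P.form.restrict W) u u = 0 → u = 0 := by
    intro u hu
    by_contra hne
    have h0 : (u : Alg E G) ≠ 0 := fun h => hne (Subtype.ext h)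
    exact (P.pos u h0).ne' hu
  exact ⟨fun u hu => key u (hu u), fun u hu => key u (hu u)⟩

variable [FiniteDimensional ℝ E]

theorem InvariantScalarProduct.isCompl (P : InvariantScalarProduct E G)
    (W : Submodule ℝ (Alg E G)) : IsCompl (P.form.orthogonal W) W :=
  ((LinearMap.BilinForm.restrict_nondegenerate_iff_isCompl_orthogonal P.isRefl).1
    (P.restrict_nondegenerate W)).symm

variable [LieGroup 𝓘(ℝ, E) ∞ G]

/-- The isotropy algebra `𝔤(x) = {ξ ∈ 𝔤 : [x, ξ] = 0}`. -/
def isotropy (x : Alg E G) : Submodule ℝ (Alg E G) :=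
  LinearMap.ker (LieAlgebra.ad ℝ (Alg E G) x)

/-- The tangent space `T_y 𝒪 = {[y, ξ] : ξ ∈ 𝔤}` at `y` of the adjoint orbit through `y`. -/
def orbitTangent (y : Alg E G) : Submodule ℝ (Alg E G) :=
  LinearMap.range (LieAlgebra.ad ℝ (Alg E G) y)

/-- The cotangent space `T_y^* 𝒪`. -/
abbrev OrbitCotangent (y : Alg E G) : Type _ := Dual ℝ (orbitTangent y)

/-- The vector in `T_y 𝒪` that represents a covector through the scalar product. -/
def grad (P : InvariantScalarProduct E G) (y : Alg E G) :
    OrbitCotangent y ≃ₗ[ℝ] orbitTangent y :=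
  ((P.form.restrict (orbitTangent y)).toDual (P.restrict_nondegenerate _)).symm

/-- The Poisson tensor of the orbit at `y`, the restriction of the Lie–Poisson structure
`{f, h}(y) = - ⟨y, [∇f(y), ∇h(y)]⟩` of `𝔤` to its symplectic leaf `𝒪`. By invariance of the scalar
product the right-hand side only depends on the components of the gradients tangent to `𝒪`. -/
def poisson (P : InvariantScalarProduct E G) (y : Alg E G) :
    OrbitCotangent y →ₗ[ℝ] OrbitCotangent y →ₗ[ℝ] ℝ :=
  LinearMap.mk₂ ℝ
    (fun α β => - P.form y ⁅(grad P y α : Alg E G), (grad P y β : Alg E G)⁆)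
    (fun a b c => by
      rw [map_add, Submodule.coe_add, add_lie, map_add, neg_add])
    (fun r a b => by
      rw [map_smul, Submodule.coe_smul, smul_lie, map_smul, smul_neg])
    (fun a b c => by
      rw [map_add, Submodule.coe_add, lie_add, map_add, neg_add])
    (fun r a b => by
      rw [map_smul, Submodule.coe_smul, lie_smul, map_smul, smul_neg])

variable {x : Alg E G}

/-- `F`, defined on the open set `V` of `𝔤`, is a smooth extension of `f : 𝒪 → ℝ` over `V`. -/
structure IsSmoothExtension (f : adjointOrbit E G x → ℝ) (V : Set E) (F : E → ℝ) : Prop where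
  isOpen : IsOpen V
  smooth : ContDiffOn ℝ ∞ F V
  agrees : ∀ z : adjointOrbit E G x, coord E G z ∈ V → f z = F (coord E G z)

/-- Smooth functions on the orbit, which is a compact embedded submanifold of `𝔤`: those that
extend, locally around each point of the orbit, to a smooth function on an open subset of `𝔤`. -/
def IsSmoothOnOrbit (f : adjointOrbit E G x → ℝ) : Prop :=
  ∀ y : adjointOrbit E G x, ∃ V F, coord E G y ∈ V ∧ IsSmoothExtension f V F

/-- `α = df(y)`: the covector `α ∈ T_y^* 𝒪` is the restriction to `T_y 𝒪` of the differential at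
`y` of a smooth local extension of `f`. -/
def IsDifferentialAt (f : adjointOrbit E G x → ℝ) (y : adjointOrbit E G x)
    (α : OrbitCotangent (y : Alg E G)) : Prop :=
  ∃ V F, coord E G y ∈ V ∧ IsSmoothExtension f V F ∧
    ∀ v : orbitTangent (y : Alg E G), α v = fderiv ℝ F (coord E G y) (coord E G v)

end Orbit

section Pair

variable {E : Type*} [NormedAddCommGroup E] [NormedSpace ℝ E] [FiniteDimensional ℝ E]
  {G : Type*} [TopologicalSpace G] [ChartedSpace E G] [Group G] [LieGroup 𝓘(ℝ, E) ∞ G]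
  {E' : Type*} [NormedAddCommGroup E'] [NormedSpace ℝ E'] [FiniteDimensional ℝ E']
  {K : Type*} [TopologicalSpace K] [ChartedSpace E' K] [Group K] [LieGroup 𝓘(ℝ, E') ∞ K]

/-- `ι : K → G` exhibits `K` as a Lie subgroup of `G`: an injective smooth homomorphism that is
an immersion (for a homomorphism it suffices to ask this at `1`). -/
structure IsLieSubgroup (ι : K →* G) : Prop where
  smooth : ContMDiff 𝓘(ℝ, E') 𝓘(ℝ, E) ∞ ι
  injective : Function.Injective ι
  immersion : Function.Injective (mfderiv 𝓘(ℝ, E') 𝓘(ℝ, E) ι 1)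

/-- The differential `𝔨 → 𝔤` at `1` of a homomorphism `ι : K → G`. -/
def differentialAtOne (ι : K →* G) : Alg E' K →L[ℝ] Alg E G :=
  mfderiv 𝓘(ℝ, E') 𝓘(ℝ, E) ι 1

/-- The Lie algebra `𝔨` of `K`, as a subspace of `𝔤`. -/
def subalg (ι : K →* G) : Submodule ℝ (Alg E G) :=
  LinearMap.range (differentialAtOne (E := E) (E' := E') ι).toLinearMap

/-- The orthogonal complement `𝔭` of `𝔨` in `𝔤`. -/
def complementP (E' : Type*) [NormedAddCommGroup E'] [NormedSpace ℝ E'] [ChartedSpace E' K]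
    (P : InvariantScalarProduct E G) (ι : K →* G) : Submodule ℝ (Alg E G) :=
  P.form.orthogonal (subalg (E' := E') ι)

/-- The orthogonal projection `pr_𝔭 : 𝔤 → 𝔤` onto `𝔭`, with kernel `𝔨`. -/
def prP (E' : Type*) [NormedAddCommGroup E'] [NormedSpace ℝ E'] [ChartedSpace E' K]
    (P : InvariantScalarProduct E G) (ι : K →* G) : Alg E G →ₗ[ℝ] Alg E G :=
  (complementP E' P ι).projection (subalg (E' := E') ι) (P.isCompl _)

/-- `𝐛(𝔤, 𝔨) = (dim 𝔭 + rank 𝔤 - rank 𝔨) / 2`. -/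
def bNumber (E' : Type*) [NormedAddCommGroup E'] [NormedSpace ℝ E'] [FiniteDimensional ℝ E']
    [ChartedSpace E' K] [LieGroup 𝓘(ℝ, E') ∞ K]
    (P : InvariantScalarProduct E G) (ι : K →* G) : ℚ :=
  ((finrank ℝ (complementP E' P ι) : ℚ) + (LieAlgebra.rank ℝ (Alg E G) : ℚ)
    - (LieAlgebra.rank ℝ (Alg E' K) : ℚ)) / 2

/-- `x ∈ 𝔤` is generic for the pair `(𝔤, 𝔨)`: the dimensions of the isotropy algebras `𝔤(x)` and
`𝔨(x) = 𝔨 ∩ 𝔤(x)` are minimal. -/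
def IsGeneric (E' : Type*) [NormedAddCommGroup E'] [NormedSpace ℝ E'] [ChartedSpace E' K]
    (ι : K →* G) (x : Alg E G) : Prop :=
  (∀ z : Alg E G, finrank ℝ (isotropy x) ≤ finrank ℝ (isotropy z)) ∧
  (∀ z : Alg E G, finrank ℝ (subalg (E' := E') ι ⊓ isotropy x : Submodule ℝ (Alg E G)) ≤
    finrank ℝ (subalg (E' := E') ι ⊓ isotropy z : Submodule ℝ (Alg E G)))

end Pair

section Action

/- Functions on orbits that are invariant under the action of `K` only see the homomorphism
`ι : K → G`, not the smooth structure of `K`. -/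
variable {E : Type*} [NormedAddCommGroup E] [NormedSpace ℝ E] [FiniteDimensional ℝ E]
  {G : Type*} [TopologicalSpace G] [ChartedSpace E G] [Group G] [LieGroup 𝓘(ℝ, E) ∞ G]
  {K : Type*} [Group K]

/-- `f ∈ C_K^∞(𝒪)`: a smooth function on the orbit `𝒪` of `x`, invariant under the action
`y ↦ Ad_k y` of `K`. -/
structure IsInvariantSmooth (ι : K →* G) {x : Alg E G} (f : adjointOrbit E G x → ℝ) : Prop where
  smooth : IsSmoothOnOrbit f
  invariant : ∀ (k : K) (y z : adjointOrbit E G x),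
    (z : Alg E G) = Ad E G (ι k) y → f z = f y

/-- `F_y = {df(y) : f ∈ C_K^∞(𝒪)} ⊆ T_y^* 𝒪`. -/
def invariantDifferentials (ι : K →* G) {x : Alg E G} (y : adjointOrbit E G x) :
    Submodule ℝ (OrbitCotangent (y : Alg E G)) where
  carrier := {α | ∃ f, IsInvariantSmooth ι f ∧ IsDifferentialAt f y α}
  zero_mem' := by
    have hext : IsSmoothExtension (fun _ : adjointOrbit E G x => (0 : ℝ)) Set.univ (fun _ => 0) :=
      ⟨isOpen_univ, contDiffOn_const, fun _ _ => rfl⟩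
    exact ⟨fun _ => 0, ⟨fun _ => ⟨Set.univ, _, trivial, hext⟩, fun _ _ _ _ => rfl⟩,
      Set.univ, _, trivial, hext, fun v => by simp⟩
  add_mem' := by
    have hadd : ∀ {f h : adjointOrbit E G x → ℝ} {V W : Set E} {A B : E → ℝ},
        IsSmoothExtension f V A → IsSmoothExtension h W B →
        IsSmoothExtension (fun z => f z + h z) (V ∩ W) (fun v => A v + B v) := by
      intro f h V W A B hA hB
      exact ⟨hA.isOpen.inter hB.isOpen,
        (hA.smooth.mono Set.inter_subset_left).add (hB.smooth.mono Set.inter_subset_right),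
        fun z hz => by rw [hA.agrees z hz.1, hB.agrees z hz.2]⟩
    rintro α β ⟨f, hf, V, A, hyV, hA, hα⟩ ⟨h, hh, W, B, hyW, hB, hβ⟩
    refine ⟨fun z => f z + h z, ⟨fun w => ?_, fun k y z hz => ?_⟩, V ∩ W, _, ⟨hyV, hyW⟩,
      hadd hA hB, fun v => ?_⟩
    · obtain ⟨V', A', hw, hA'⟩ := hf.smooth w
      obtain ⟨W', B', hw', hB'⟩ := hh.smooth w
      exact ⟨V' ∩ W', fun v => A' v + B' v, ⟨hw, hw'⟩, hadd hA' hB'⟩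
    · simp only [hf.invariant k y z hz, hh.invariant k y z hz]
    · have dA : DifferentiableAt ℝ A (coord E G y) :=
        (hA.smooth.contDiffAt (hA.isOpen.mem_nhds hyV)).differentiableAt (by simp)
      have dB : DifferentiableAt ℝ B (coord E G y) :=
        (hB.smooth.contDiffAt (hB.isOpen.mem_nhds hyW)).differentiableAt (by simp)
      rw [fderiv_fun_add dA dB]
      simp [hα, hβ]
  smul_mem' := by
    have hsmul : ∀ (c : ℝ) {f : adjointOrbit E G x → ℝ} {V : Set E} {A : E → ℝ},
        IsSmoothExtension f V A →
        IsSmoothExtension (fun z => c * f z) V (fun v => c * A v) := by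
      intro c f V A hA
      exact ⟨hA.isOpen, contDiffOn_const.mul hA.smooth,
        fun z hz => by rw [hA.agrees z hz]⟩
    rintro c α ⟨f, hf, V, A, hyV, hA, hα⟩
    refine ⟨fun z => c * f z, ⟨fun w => ?_, fun k y z hz => ?_⟩, V, _, hyV, hsmul c hA,
      fun v => ?_⟩
    · obtain ⟨V', A', hw, hA'⟩ := hf.smooth w
      exact ⟨_, _, hw, hsmul c hA'⟩
    · simp only [hf.invariant k y z hz]
    · have dA : DifferentiableAt ℝ A (coord E G y) :=
        (hA.smooth.contDiffAt (hA.isOpen.mem_nhds hyV)).differentiableAt (by simp)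
      rw [fderiv_const_mul dA]
      simp [hα]

/-- The kernel `{α ∈ F_y : Λ_y(α, β) = 0 for all β ∈ F_y}` of the Poisson tensor restricted to
`F_y`. -/
def invariantKernel (P : InvariantScalarProduct E G) (ι : K →* G) {x : Alg E G}
    (y : adjointOrbit E G x) : Submodule ℝ (OrbitCotangent (y : Alg E G)) where
  carrier := {α | α ∈ invariantDifferentials ι y ∧
    ∀ β ∈ invariantDifferentials ι y, poisson P y α β = 0}
  zero_mem' := ⟨Submodule.zero_mem _, fun β _ => by simp⟩
  add_mem' := fun {a b} ha hb =>
    ⟨Submodule.add_mem _ ha.1 hb.1, fun β hβ => by simp [ha.2 β hβ, hb.2 β hβ]⟩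
  smul_mem' := fun c a ha =>
    ⟨Submodule.smul_mem _ c ha.1, fun β hβ => by simp [ha.2 β hβ]⟩

/-- The action of `K` on the orbit `𝒪` of `x` has complexity `c`:
`2 c = ddim C_K^∞(𝒪) - dind C_K^∞(𝒪)`, where the differential dimension and the differential index
are the values of `dim F_y` and of `dim ker Λ_y|_{F_y}` that are constant for `y` in an open dense
subset of `𝒪`. -/
def HasComplexity (P : InvariantScalarProduct E G) (ι : K →* G) (x : Alg E G) (c : ℕ) : Prop :=
  ∃ U : Set (adjointOrbit E G x), IsOpen U ∧ Dense U ∧ ∃ ddim dind : ℕ,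
    (∀ y ∈ U, finrank ℝ (invariantDifferentials ι y) = ddim ∧
      finrank ℝ (invariantKernel P ι y) = dind) ∧
    (2 * c : ℤ) = (ddim : ℤ) - (dind : ℤ)

/-- The action of `K` on the orbit `𝒪` of `x` is multiplicity free: the Poisson algebra
`C_K^∞(𝒪)` is commutative. -/
def IsMultiplicityFreeAction (P : InvariantScalarProduct E G) (ι : K →* G) (x : Alg E G) : Prop :=
  ∀ f h : adjointOrbit E G x → ℝ, IsInvariantSmooth ι f → IsInvariantSmooth ι h →
    ∀ (y : adjointOrbit E G x) (α β : OrbitCotangent (y : Alg E G)),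
      IsDifferentialAt f y α → IsDifferentialAt h y β → poisson P y α β = 0

end Action

section Subgroup

variable {E : Type*} [NormedAddCommGroup E] [NormedSpace ℝ E] [FiniteDimensional ℝ E]
  {G : Type*} [TopologicalSpace G] [ChartedSpace E G] [Group G] [LieGroup 𝓘(ℝ, E) ∞ G]
  (E' : Type*) [NormedAddCommGroup E'] [NormedSpace ℝ E']
  {K : Type*} [TopologicalSpace K] [ChartedSpace E' K] [Group K]

/-- `𝐜(𝔤, 𝔨) = c`: the action of `K` on the adjoint orbit of every generic `x` has
complexity `c`. -/
def HasGenericComplexity (P : InvariantScalarProduct E G) (ι : K →* G) (c : ℕ) : Prop :=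
  ∀ x : Alg E G, IsGeneric E' ι x → HasComplexity P ι x c

/-- `K` is a multiplicity free subgroup of `G`: its action on generic adjoint orbits of `G` is
multiplicity free. -/
def IsMultiplicityFreeSubgroup (P : InvariantScalarProduct E G) (ι : K →* G) : Prop :=
  ∀ x : Alg E G, IsGeneric E' ι x → IsMultiplicityFreeAction P ι x

/-- `K` is an almost multiplicity free subgroup of `G`: its action on generic adjoint orbits of
`G` has complexity one. -/
def IsAlmostMultiplicityFreeSubgroup (P : InvariantScalarProduct E G) (ι : K →* G) : Prop :=
  ∀ x : Alg E G, IsGeneric E' ι x → HasComplexity P ι x 1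

end Subgroup

end

end AdjointComplexity

/-! At a suitable point `y` of the orbit both numbers in the definition of complexity can be
computed by linear algebra. Differentials of `K`-invariant functions kill `[𝔨, y]`. On an open dense
set the converse holds: `F_y` is the whole annihilator of `[𝔨, y]` in `T_y^*𝒪`
(`mem_invariantDifferentials_iff`, `exists_polyAlg_forall_brE_mem_range`). Through the scalar
product `F_y` becomes `[y, 𝔤] ∩ [y, 𝔨]^⊥`, of dimension `dim 𝔤 - dim 𝔤(y) - dim 𝔨 + dim 𝔨(y)`
(`finrank_normalSpace`). Applying `ad y` to the kernel of the Poisson tensor identifies it with `[y,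
𝔞]`, where `𝔞` is the centralizer in `𝔨` of the projection of `y` to `𝔨`, so its dimension is `dim 𝔞
- dim 𝔨(y)` (`finrank_normalKernel`). For generic `x` one has `dim 𝔤(x) = rank 𝔤`, and on a dense
set `dim 𝔨(y) = dim 𝔨(x)` and `dim 𝔞 = rank 𝔨`. The formula follows from `dim pr_𝔭 𝔤(x) = rank 𝔤 -
dim 𝔨(x)`; integrality holds because an alternating form has even rank.

Two points need real work. The first is the converse for `F_y`. Invariant polynomials separate
`K`-orbits (Stone–Weierstrass and Haar averaging). Where the span of their differentials along the
orbit has maximal dimension, a vector killed by all of them is the velocity of a curve on which all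
invariant polynomials are constant. This curve lies in one `K`-orbit, so its velocity is tangent to
that orbit (`velocity_mem_range_of_mem_orbit`).

The second is `dim 𝔞 = rank 𝔨` (`finrank_isotropy_projK_eq_rank`). A family of linear maps of
maximal rank has a derivative sending kernel into range. Applied to `κ ↦ [κ, y]` this makes `𝔨(y)`
abelian; applied to `κ ↦ ⟨y, [κ, ·]⟩` along the orbit it puts `[𝔞, 𝔞]` into `𝔨(y)`. So `𝔞` is
metabelian, hence abelian because of the invariant scalar product, and abelian centralizers have
dimension equal to the rank since any two elements commute after conjugating one of them.

Density rests on polynomial functions: one that vanishes near a point of an orbit of a connected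
group vanishes on the orbit. Finally, Poisson commutativity is complexity `0`, because the bracket
is continuous and so may be tested on a dense set. -/

set_option linter.unusedSectionVars false

namespace AdjointComplexity

/-! ### Coordinates on a Lie group near the identity -/

section LocalCoordinates

variable {E : Type*} [NormedAddCommGroup E]
  {G : Type*} [TopologicalSpace G] [ChartedSpace E G] [Group G]

/-- The parametrization of a neighbourhood of `1` by the chart at `1`, translated so that
`0` goes to `1`. -/
noncomputable def loc (E : Type*) [NormedAddCommGroup E]
    (G : Type*) [TopologicalSpace G] [ChartedSpace E G] [Group G] (u : E) : G :=
  (chartAt E (1 : G)).symm (u + chartAt E (1 : G) 1)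

/-- The coordinates near `1` that are inverse to `loc`. -/
noncomputable def colog (E : Type*) [NormedAddCommGroup E]
    {G : Type*} [TopologicalSpace G] [ChartedSpace E G] [Group G] (g : G) : E :=
  chartAt E (1 : G) g - chartAt E (1 : G) 1

@[simp] theorem loc_zero : loc E G 0 = 1 := by simp [loc]

@[simp] theorem colog_one : colog E (1 : G) = 0 := by simp [colog]

theorem eventually_add_mem_target :
    ∀ᶠ u : E in 𝓝 0, u + chartAt E (1 : G) 1 ∈ (chartAt E (1 : G)).target := by
  have h : ContinuousAt (fun u : E => u + chartAt E (1 : G) 1) 0 := by fun_prop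
  apply h.eventually_mem
  apply (chartAt E (1 : G)).open_target.mem_nhds
  simp

theorem eventually_colog_loc : ∀ᶠ u : E in 𝓝 0, colog E (loc E G u) = u := by
  filter_upwards [eventually_add_mem_target (E := E) (G := G)] with u hu
  simp [colog, loc, (chartAt E (1 : G)).right_inv hu]

theorem eventually_loc_colog : ∀ᶠ g : G in 𝓝 1, loc E G (colog E g) = g := by
  filter_upwards [(chartAt E (1 : G)).open_source.mem_nhds (mem_chart_source E 1)] with g hg
  simp [colog, loc, (chartAt E (1 : G)).left_inv hg]

variable [NormedSpace ℝ E] [LieGroup 𝓘(ℝ, E) ∞ G]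

theorem contMDiffAt_loc : ∀ᶠ u in 𝓝 (0 : E), ContMDiffAt 𝓘(ℝ, E) 𝓘(ℝ, E) ∞ (loc E G) u := by
  filter_upwards [eventually_add_mem_target (E := E) (G := G)] with u hu
  have h1 : ContMDiffAt 𝓘(ℝ, E) 𝓘(ℝ, E) ∞ (chartAt E (1 : G)).symm
      (u + chartAt E (1 : G) 1) :=
    (contMDiffOn_chart_symm (I := 𝓘(ℝ, E)) (n := ∞) (x := (1 : G))).contMDiffAt
      ((chartAt E (1 : G)).open_target.mem_nhds hu)
  have h2 : ContMDiffAt 𝓘(ℝ, E) 𝓘(ℝ, E) ∞ (fun u : E => u + chartAt E (1 : G) 1) u := by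
    rw [contMDiffAt_iff_contDiffAt]; fun_prop
  exact h1.comp u h2

theorem contMDiffAt_colog : ∀ᶠ g in 𝓝 (1 : G), ContMDiffAt 𝓘(ℝ, E) 𝓘(ℝ, E) ∞ (colog E) g := by
  filter_upwards [(chartAt E (1 : G)).open_source.mem_nhds (mem_chart_source E 1)] with g hg
  have h1 : ContMDiffAt 𝓘(ℝ, E) 𝓘(ℝ, E) ∞ (chartAt E (1 : G)) g :=
    (contMDiffOn_chart (I := 𝓘(ℝ, E)) (n := ∞) (x := (1 : G))).contMDiffAt
      ((chartAt E (1 : G)).open_source.mem_nhds hg)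
  have h2 : ContMDiffAt 𝓘(ℝ, E) 𝓘(ℝ, E) ∞ (fun u : E => u - chartAt E (1 : G) 1)
      (chartAt E (1 : G) g) := by
    rw [contMDiffAt_iff_contDiffAt]; fun_prop
  exact h2.comp g h1

theorem map_loc_nhds : Filter.map (loc E G) (𝓝 0) = 𝓝 1 := by
  apply le_antisymm
  · have := (contMDiffAt_loc (E := E) (G := G)).self_of_nhds.continuousAt
    rw [ContinuousAt, loc_zero] at this
    exact this
  · have h := (contMDiffAt_colog (E := E) (G := G)).self_of_nhds.continuousAt
    rw [ContinuousAt, colog_one] at h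
    intro s hs
    filter_upwards [h hs, eventually_loc_colog (E := E) (G := G)] with g h1 h2
    rw [← h2]; exact h1

/-- The point is a variable with an equation `g = 1` because tangent spaces depend on the point: in
a composition the base point is something like `f (loc 0)`, equal to `1` only propositionally. -/
theorem hasMFDerivAt_colog {g : G} (hg : g = 1) :
    HasMFDerivAt 𝓘(ℝ, E) 𝓘(ℝ, E) (colog E) g (ContinuousLinearMap.id ℝ E) := by
  subst hg
  refine ⟨(contMDiffAt_colog (E := E) (G := G)).self_of_nhds.continuousAt, ?_⟩
  simp only [writtenInExtChartAt, mfld_simps]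
  have : (fun u : E => u - chartAt E (1 : G) 1) =ᶠ[𝓝 (chartAt E (1 : G) 1)]
      (colog E ∘ (chartAt E (1 : G)).symm) := by
    filter_upwards [(chartAt E (1 : G)).open_target.mem_nhds (mem_chart_target E 1)] with u hu
    simp [colog, (chartAt E (1 : G)).right_inv hu]
  apply HasFDerivAt.hasFDerivWithinAt
  exact ((hasFDerivAt_id (𝕜 := ℝ) (chartAt E (1 : G) 1)).sub_const _).congr_of_eventuallyEq
    this.symm

theorem hasMFDerivAt_loc :
    HasMFDerivAt 𝓘(ℝ, E) 𝓘(ℝ, E) (loc E G) 0 (ContinuousLinearMap.id ℝ E) := by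
  refine ⟨(contMDiffAt_loc (E := E) (G := G)).self_of_nhds.continuousAt, ?_⟩
  simp only [writtenInExtChartAt, mfld_simps, loc_zero]
  have : (fun u : E => u + chartAt E (1 : G) 1) =ᶠ[𝓝 0] (chartAt E (1 : G) ∘ loc E G) := by
    filter_upwards [eventually_add_mem_target (E := E) (G := G)] with u hu
    simp [loc, (chartAt E (1 : G)).right_inv hu]
  apply HasFDerivAt.hasFDerivWithinAt
  exact ((hasFDerivAt_id (𝕜 := ℝ) (0 : E)).add_const _).congr_of_eventuallyEq this.symm

/-- The differential at `1` of a map of Lie groups, read in the coordinates near `1`. -/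
theorem hasFDerivAt_colog_comp_loc
    {E' : Type*} [NormedAddCommGroup E'] [NormedSpace ℝ E']
    {K : Type*} [TopologicalSpace K] [ChartedSpace E' K] [Group K] [LieGroup 𝓘(ℝ, E') ∞ K]
    {f : K → G} (h1 : f 1 = 1) (hf : MDifferentiableAt 𝓘(ℝ, E') 𝓘(ℝ, E) f 1) :
    HasFDerivAt (fun u : E' => colog E (f (loc E' K u)))
      (show E' →L[ℝ] E from mfderiv 𝓘(ℝ, E') 𝓘(ℝ, E) f 1) 0 := by
  have h := hf.hasMFDerivAt
  have h2 : ∀ k : K, k = 1 → HasMFDerivAt 𝓘(ℝ, E') 𝓘(ℝ, E) f k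
      (show E' →L[ℝ] E from mfderiv 𝓘(ℝ, E') 𝓘(ℝ, E) f 1) := by
    rintro _ rfl
    exact h
  have h3 := (h2 _ (loc_zero (E := E') (G := K))).comp 0 (hasMFDerivAt_loc (E := E') (G := K))
  have h4 := (hasMFDerivAt_colog (E := E) (g := f (loc E' K 0)) (by simp [h1])).comp (0 : E') h3
  exact h4.hasFDerivAt

end LocalCoordinates
end AdjointComplexity

namespace AdjointComplexity

/-- `loc` parametrizes a neighbourhood of `1` in the group `G`, and `m` expresses the
multiplication in these coordinates. -/
structure IsSmoothParam {L : Type*} [NormedAddCommGroup L] [NormedSpace ℝ L]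
    {G : Type*} [TopologicalSpace G] [Group G] (loc : L → G) (m : L × L → L) : Prop where
  zero : loc 0 = 1
  map_nhds : Filter.map loc (𝓝 0) = 𝓝 1
  smooth : ContDiffAt ℝ ∞ m 0
  mul : ∀ᶠ p in 𝓝 (0 : L × L), loc (m p) = loc p.1 * loc p.2
  left : ∀ᶠ u in 𝓝 (0 : L), m (u, 0) = u
  right : ∀ᶠ u in 𝓝 (0 : L), m (0, u) = u

/-! ### Multiplication and the adjoint representation in coordinates -/

section LocalCoordinates

variable {E : Type*} [NormedAddCommGroup E] [NormedSpace ℝ E]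
  {G : Type*} [TopologicalSpace G] [ChartedSpace E G] [Group G] [LieGroup 𝓘(ℝ, E) ∞ G]
  {E' : Type*} [NormedAddCommGroup E'] [NormedSpace ℝ E']
  {K : Type*} [TopologicalSpace K] [ChartedSpace E' K] [Group K] [LieGroup 𝓘(ℝ, E') ∞ K]

theorem eventually_loc_colog_comp {X : Type*} [TopologicalSpace X] {f : X → G} {x : X}
    (hf : ContinuousAt f x) (h1 : f x = 1) : ∀ᶠ y in 𝓝 x, loc E G (colog E (f y)) = f y := by
  have h := eventually_loc_colog (E := E) (G := G)
  rw [← h1] at h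
  exact hf.eventually h

theorem contMDiffAt_loc_comp {X : Type*} [NormedAddCommGroup X] [NormedSpace ℝ X]
    {f : X → E} {x : X} (hf : ContDiffAt ℝ ∞ f x) (h0 : f x = 0) :
    ContMDiffAt 𝓘(ℝ, X) 𝓘(ℝ, E) ∞ (fun y => loc E G (f y)) x := by
  have h := (contMDiffAt_loc (E := E) (G := G)).self_of_nhds
  rw [← h0] at h
  exact h.comp x hf.contMDiffAt

theorem contDiffAt_colog_comp {X : Type*} [NormedAddCommGroup X] [NormedSpace ℝ X]
    {f : X → G} {x : X} (hf : ContMDiffAt 𝓘(ℝ, X) 𝓘(ℝ, E) ∞ f x) (h1 : f x = 1) :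
    ContDiffAt ℝ ∞ (fun y => colog E (f y)) x := by
  have h := (contMDiffAt_colog (E := E) (G := G)).self_of_nhds
  rw [← h1] at h
  exact contMDiffAt_iff_contDiffAt.1 (h.comp x hf)

theorem isSmoothParam_loc :
    IsSmoothParam (loc E G) (fun p : E × E => colog E (loc E G p.1 * loc E G p.2)) := by
  have hs : ContMDiffAt 𝓘(ℝ, E × E) 𝓘(ℝ, E) ∞
      (fun p : E × E => loc E G p.1 * loc E G p.2) 0 :=
    (contMDiffAt_loc_comp contDiffAt_fst rfl).mul (contMDiffAt_loc_comp contDiffAt_snd rfl)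
  refine ⟨loc_zero, map_loc_nhds, contDiffAt_colog_comp hs (by simp), ?_, ?_, ?_⟩
  · exact eventually_loc_colog_comp hs.continuousAt (by simp)
  · filter_upwards [eventually_colog_loc (E := E) (G := G)] with u hu
    simp [hu]
  · filter_upwards [eventually_colog_loc (E := E) (G := G)] with u hu
    simp [hu]

/-- The operator `Ad_g` on the model space. -/
noncomputable def adE (E : Type*) [NormedAddCommGroup E] [NormedSpace ℝ E]
    {G : Type*} [TopologicalSpace G] [ChartedSpace E G] [Group G] (g : G) : E →L[ℝ] E :=
  show E →L[ℝ] E from Ad E G g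

theorem contMDiff_conj (g : G) : ContMDiff 𝓘(ℝ, E) 𝓘(ℝ, E) ∞ (fun h : G => g * h * g⁻¹) :=
  (contMDiff_const.mul contMDiff_id).mul contMDiff_const

theorem hasFDerivAt_conj (g : G) :
    HasFDerivAt (fun u : E => colog E (g * loc E G u * g⁻¹)) (adE E g) 0 :=
  hasFDerivAt_colog_comp_loc (f := fun h : G => g * h * g⁻¹) (by simp)
    ((contMDiff_conj g).mdifferentiable (by simp) 1)

theorem continuousAt_loc : ContinuousAt (loc E G) 0 :=
  (contMDiffAt_loc (E := E) (G := G)).self_of_nhds.continuousAt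

theorem continuousAt_conj (g : G) : ContinuousAt (fun u : E => g * loc E G u * g⁻¹) 0 :=
  ((contMDiff_conj (E := E) g).continuous.continuousAt (x := loc E G 0)).comp continuousAt_loc

theorem adE_one : adE E (1 : G) = ContinuousLinearMap.id ℝ E := by
  have h := hasFDerivAt_conj (E := E) (1 : G)
  have h2 : (fun u : E => u) =ᶠ[𝓝 0] fun u : E => colog E ((1 : G) * loc E G u * 1⁻¹) := by
    filter_upwards [eventually_colog_loc (E := E) (G := G)] with u hu
    simp [hu]
  exact (h.congr_of_eventuallyEq h2).unique (hasFDerivAt_id 0)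

theorem adE_mul (g h : G) : adE E (g * h) = (adE E g).comp (adE E h) := by
  have h1 := hasFDerivAt_conj (E := E) (g * h)
  have hg := hasFDerivAt_conj (E := E) g
  have hh := hasFDerivAt_conj (E := E) h
  have h0 : (fun u : E => colog E (h * loc E G u * h⁻¹)) 0 = 0 := by simp
  rw [← h0] at hg
  refine (h1.congr_of_eventuallyEq ?_).unique (hg.comp 0 hh)
  filter_upwards [eventually_loc_colog_comp (E := E) (continuousAt_conj h) (by simp)] with u hu
  simp only [Function.comp, hu]
  group

/-- The adjoint representation, on the model space. -/
noncomputable def adHom (E : Type*) [NormedAddCommGroup E] [NormedSpace ℝ E]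
    (G : Type*) [TopologicalSpace G] [ChartedSpace E G] [Group G] [LieGroup 𝓘(ℝ, E) ∞ G] :
    G →* (E →L[ℝ] E) where
  toFun := adE E
  map_one' := adE_one
  map_mul' := adE_mul

/-- Conjugation is jointly smooth in both variables near the identity, and `Ad` is its partial
derivative in the second one. -/
theorem contDiffAt_adE_loc : ContDiffAt ℝ ∞ (fun u : E => adE E (loc E G u)) 0 := by
  have hs : ContMDiffAt 𝓘(ℝ, E × E) 𝓘(ℝ, E) ∞
      (fun p : E × E => loc E G p.1 * loc E G p.2 * (loc E G p.1)⁻¹) (0, 0) :=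
    ((contMDiffAt_loc_comp contDiffAt_fst rfl).mul (contMDiffAt_loc_comp contDiffAt_snd rfl)).mul
      (contMDiffAt_loc_comp contDiffAt_fst rfl).inv
  have h := contDiffAt_colog_comp hs (by simp)
  have h2 : ContDiffAt ℝ ∞ (fun a : E => fderiv ℝ
      (fun u : E => colog E (loc E G a * loc E G u * (loc E G a)⁻¹)) 0) 0 :=
    ContDiffAt.fderiv (f := fun a u : E => colog E (loc E G a * loc E G u * (loc E G a)⁻¹))
      (g := fun _ => 0) h contDiffAt_const (by simp)
  have h3 : (fun a : E => fderiv ℝ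
      (fun u : E => colog E (loc E G a * loc E G u * (loc E G a)⁻¹)) 0) =
      fun u : E => adE E (loc E G u) := by
    funext a
    exact (hasFDerivAt_conj (loc E G a)).fderiv
  rwa [h3] at h2

end LocalCoordinates
end AdjointComplexity

namespace AdjointComplexity

/-! ### The Lie bracket as the differential of `Ad` -/

section Bracket

variable {E : Type*} [NormedAddCommGroup E] [NormedSpace ℝ E]
  {G : Type*} [TopologicalSpace G] [ChartedSpace E G] [Group G] [LieGroup 𝓘(ℝ, E) ∞ G]

open VectorField in
/-- A left invariant vector field, read in the coordinates near `1`. -/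
theorem mpullbackWithin_mulInvariantVectorField (v : E) {x : E}
    (hx : x ∈ (chartAt E (1 : G)).target) :
    mpullbackWithin 𝓘(ℝ, E) 𝓘(ℝ, E) (extChartAt 𝓘(ℝ, E) (1 : G)).symm
      (mulInvariantVectorField (I := 𝓘(ℝ, E)) (G := G) v) (Set.range 𝓘(ℝ, E)) x =
    fderiv ℝ (fun u : E => colog E (loc E G (x - chartAt E (1 : G) 1) * loc E G u)) 0 v := by
  have hx' : x ∈ (extChartAt 𝓘(ℝ, E) (1 : G)).target := by simpa [mfld_simps] using hx
  rw [mpullbackWithin_apply]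
  have hinv := ContinuousLinearMap.inverse_eq
    (mfderivWithin_extChartAt_symm_comp_mfderiv_extChartAt (I := 𝓘(ℝ, E)) hx')
    (mfderiv_extChartAt_comp_mfderivWithin_extChartAt_symm (I := 𝓘(ℝ, E)) hx')
  rw [hinv]
  have hg : (extChartAt 𝓘(ℝ, E) (1 : G)).symm x = loc E G (x - chartAt E (1 : G) 1) := by
    simp [loc, mfld_simps]
  rw [hg]
  set g : G := loc E G (x - chartAt E (1 : G) 1) with hgdef
  have hgs : g ∈ (chartAt E (1 : G)).source := by
    rw [← hg]
    simpa [mfld_simps] using (chartAt E (1 : G)).map_target hx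
  have h1 : HasMFDerivAt 𝓘(ℝ, E) 𝓘(ℝ, E) (extChartAt 𝓘(ℝ, E) (1 : G)) g
      (mfderiv 𝓘(ℝ, E) 𝓘(ℝ, E) (extChartAt 𝓘(ℝ, E) (1 : G)) g) :=
    (mdifferentiableAt_extChartAt hgs).hasMFDerivAt
  have h2 : HasMFDerivAt 𝓘(ℝ, E) 𝓘(ℝ, E) (fun h : G => g * h) 1
      (mfderiv 𝓘(ℝ, E) 𝓘(ℝ, E) (fun h : G => g * h) 1) :=
    ((contMDiff_mul_left (I := 𝓘(ℝ, E)) (n := ∞) (a := g)).mdifferentiable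
      (by simp) 1).hasMFDerivAt
  have h1' : ∀ k : G, k = g → HasMFDerivAt 𝓘(ℝ, E) 𝓘(ℝ, E) (extChartAt 𝓘(ℝ, E) (1 : G)) k
      (show E →L[ℝ] E from mfderiv 𝓘(ℝ, E) 𝓘(ℝ, E) (extChartAt 𝓘(ℝ, E) (1 : G)) g) := by
    rintro _ rfl
    exact h1
  have h2' : ∀ k : G, k = 1 → HasMFDerivAt 𝓘(ℝ, E) 𝓘(ℝ, E) (fun h : G => g * h) k
      (show E →L[ℝ] E from mfderiv 𝓘(ℝ, E) 𝓘(ℝ, E) (fun h : G => g * h) 1) := by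
    rintro _ rfl
    exact h2
  have h3 := (h2' _ (loc_zero (E := E) (G := G))).comp 0 (hasMFDerivAt_loc (E := E) (G := G))
  have h4 := ((h1' ((fun h : G => g * h) (loc E G 0)) (by simp)).comp (0 : E) h3).hasFDerivAt
  have h5 := h4.sub_const (chartAt E (1 : G) 1)
  have h6 := h5.fderiv
  exact (congrArg (fun T : E →L[ℝ] E => T v) h6).symm

variable (E G) in
/-- The second derivative at `0` of the multiplication in coordinates near `1`. -/
noncomputable def mulHess : E × E →L[ℝ] E × E →L[ℝ] E :=
  fderiv ℝ (fderiv ℝ fun p : E × E => colog E (loc E G p.1 * loc E G p.2)) 0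

theorem mulHess_symm (p q : E × E) : mulHess E G p q = mulHess E G q p :=
  ((isSmoothParam_loc (E := E) (G := G)).smooth.isSymmSndFDerivAt
    (by simpa using ENat.LEInfty.out)) p q

theorem hasFDerivAt_fderiv_mul : HasFDerivAt
    (fderiv ℝ fun p : E × E => colog E (loc E G p.1 * loc E G p.2)) (mulHess E G) 0 := by
  have h := (isSmoothParam_loc (E := E) (G := G)).smooth
  have h2 : ContDiffAt ℝ 1 (fderiv ℝ fun p : E × E => colog E (loc E G p.1 * loc E G p.2)) 0 :=
    h.fderiv_right (by norm_cast)
  exact (h2.differentiableAt (by simp)).hasFDerivAt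

theorem eventually_differentiableAt_mul : ∀ᶠ p in 𝓝 (0 : E × E),
    DifferentiableAt ℝ (fun p : E × E => colog E (loc E G p.1 * loc E G p.2)) p := by
  have h := ((isSmoothParam_loc (E := E) (G := G)).smooth.of_le (m := 1) (by simp)).eventually
    (by simp)
  filter_upwards [h] with p hp
  exact hp.differentiableAt (by simp)

theorem eventually_fderiv_mul_left (v : E) : ∀ᶠ a in 𝓝 (0 : E),
    fderiv ℝ (fun u : E => colog E (loc E G a * loc E G u)) 0 v =
      fderiv ℝ (fun p : E × E => colog E (loc E G p.1 * loc E G p.2)) (a, 0) (0, v) := by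
  have hc : Filter.Tendsto (fun a : E => (a, (0 : E))) (𝓝 0) (𝓝 (0 : E × E)) :=
    (by fun_prop : Continuous fun a : E => (a, (0 : E))).tendsto 0
  filter_upwards [hc.eventually (eventually_differentiableAt_mul (E := E) (G := G))] with a ha
  have h := ha.hasFDerivAt.comp (0 : E) (hasFDerivAt_prodMk_right a (0 : E))
  have h2 := h.fderiv
  exact congrArg (fun T : E →L[ℝ] E => T v) h2

theorem eventually_fderiv_mul_right (v : E) : ∀ᶠ a in 𝓝 (0 : E),
    fderiv ℝ (fun u : E => colog E (loc E G u * loc E G a)) 0 v =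
      fderiv ℝ (fun p : E × E => colog E (loc E G p.1 * loc E G p.2)) (0, a) (v, 0) := by
  have hc : Filter.Tendsto (fun a : E => ((0 : E), a)) (𝓝 0) (𝓝 (0 : E × E)) :=
    (by fun_prop : Continuous fun a : E => ((0 : E), a)).tendsto 0
  filter_upwards [hc.eventually (eventually_differentiableAt_mul (E := E) (G := G))] with a ha
  have h := HasFDerivAt.comp (0 : E) (f := fun u : E => (u, a)) ha.hasFDerivAt
    (hasFDerivAt_prodMk_left (0 : E) a)
  have h2 := h.fderiv
  exact congrArg (fun T : E →L[ℝ] E => T v) h2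

theorem fderiv_mul_zero_left (v : E) :
    fderiv ℝ (fun p : E × E => colog E (loc E G p.1 * loc E G p.2)) 0 (v, 0) = v := by
  have h := (eventually_fderiv_mul_right (E := E) (G := G) v).self_of_nhds
  rw [show ((0 : E), (0 : E)) = 0 from rfl] at h
  rw [← h]
  have h2 : (fun u : E => colog E (loc E G u * loc E G 0)) =ᶠ[𝓝 0] id := by
    filter_upwards [eventually_colog_loc (E := E) (G := G)] with u hu
    simp [hu]
  rw [h2.fderiv_eq, fderiv_id]
  rfl

theorem fderiv_mul_zero_right (v : E) :
    fderiv ℝ (fun p : E × E => colog E (loc E G p.1 * loc E G p.2)) 0 (0, v) = v := by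
  have h := (eventually_fderiv_mul_left (E := E) (G := G) v).self_of_nhds
  rw [show ((0 : E), (0 : E)) = 0 from rfl] at h
  rw [← h]
  have h2 : (fun u : E => colog E (loc E G 0 * loc E G u)) =ᶠ[𝓝 0] id := by
    filter_upwards [eventually_colog_loc (E := E) (G := G)] with u hu
    simp [hu]
  rw [h2.fderiv_eq, fderiv_id]
  rfl

theorem hasFDerivAt_fderiv_mul_left (w : E) :
    HasFDerivAt (fun a : E => fderiv ℝ (fun u : E => colog E (loc E G a * loc E G u)) 0 w)
      ((mulHess E G).flip (0, w) ∘L ContinuousLinearMap.inl ℝ E E) 0 := by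
  have h1 : HasFDerivAt (fun a : E => (a, (0 : E))) (ContinuousLinearMap.inl ℝ E E) 0 :=
    hasFDerivAt_prodMk_left 0 0
  have h2 := (hasFDerivAt_fderiv_mul (E := E) (G := G)).clm_apply
    (hasFDerivAt_const ((0 : E), w) (0 : E × E))
  have h3 := HasFDerivAt.comp (0 : E) (f := fun a : E => (a, (0 : E))) h2 h1
  refine (h3.congr_of_eventuallyEq (eventually_fderiv_mul_left w)).congr_fderiv ?_
  ext v
  simp

theorem hasFDerivAt_fderiv_mul_right :
    HasFDerivAt (fun a : E => fderiv ℝ (fun p : E × E => colog E (loc E G p.1 * loc E G p.2))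
        (0, a) ∘L ContinuousLinearMap.inl ℝ E E)
      ((ContinuousLinearMap.compL ℝ E (E × E) E).flip (ContinuousLinearMap.inl ℝ E E) ∘L
        mulHess E G ∘L ContinuousLinearMap.inr ℝ E E) 0 := by
  have h1 : HasFDerivAt (fun a : E => ((0 : E), a)) (ContinuousLinearMap.inr ℝ E E) 0 :=
    hasFDerivAt_prodMk_right 0 0
  have h3 := HasFDerivAt.comp (0 : E) (f := fun a : E => ((0 : E), a))
    (hasFDerivAt_fderiv_mul (E := E) (G := G)) h1
  exact ((ContinuousLinearMap.compL ℝ E (E × E) E).flip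
    (ContinuousLinearMap.inl ℝ E E)).hasFDerivAt.comp (0 : E) h3

open VectorField in
-- In the chart at `1` the left invariant field of `w` is `a ↦ ∂₂m(a, 0) w`, where `m` is the
-- multiplication. Its value at the origin is `w` and its derivative there is a mixed second
-- derivative of `m`, so the bracket of two such fields is the antisymmetrized mixed derivative.
theorem lie_eq_mulHess (v w : E) :
    (⁅(show Alg E G from v), (show Alg E G from w)⁆ : Alg E G) =
      mulHess E G (v, 0) (0, w) - mulHess E G (w, 0) (0, v) := by
  have key : ∀ w : E, mpullbackWithin 𝓘(ℝ, E) 𝓘(ℝ, E) (extChartAt 𝓘(ℝ, E) (1 : G)).symm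
      (mulInvariantVectorField (I := 𝓘(ℝ, E)) (G := G) w) (Set.range 𝓘(ℝ, E))
      =ᶠ[𝓝 (chartAt E (1 : G) 1)] fun x => fderiv ℝ (fun u : E =>
        colog E (loc E G (x - chartAt E (1 : G) 1) * loc E G u)) 0 w := by
    intro w
    filter_upwards [(chartAt E (1 : G)).open_target.mem_nhds (mem_chart_target E 1)] with x hx
    exact mpullbackWithin_mulInvariantVectorField w hx
  have hval : ∀ w : E, fderiv ℝ (fun u : E =>
        colog E (loc E G (chartAt E (1 : G) 1 - chartAt E (1 : G) 1) * loc E G u)) 0 w = w := by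
    intro w
    rw [sub_self, (eventually_fderiv_mul_left (E := E) (G := G) w).self_of_nhds]
    exact fderiv_mul_zero_right w
  have hder : ∀ w : E, HasFDerivAt (fun x : E => fderiv ℝ (fun u : E =>
        colog E (loc E G (x - chartAt E (1 : G) 1) * loc E G u)) 0 w)
      ((mulHess E G).flip (0, w) ∘L ContinuousLinearMap.inl ℝ E E) (chartAt E (1 : G) 1) := by
    intro w
    have h0 : HasFDerivAt (fun x : E => x - chartAt E (1 : G) 1) (ContinuousLinearMap.id ℝ E)
        (chartAt E (1 : G) 1) := (hasFDerivAt_id _).sub_const _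
    have h : HasFDerivAt (fun a : E => fderiv ℝ (fun u : E => colog E (loc E G a * loc E G u)) 0 w)
        ((mulHess E G).flip (0, w) ∘L ContinuousLinearMap.inl ℝ E E)
        (chartAt E (1 : G) 1 - chartAt E (1 : G) 1) := by
      rw [sub_self]
      exact hasFDerivAt_fderiv_mul_left w
    exact HasFDerivAt.comp (chartAt E (1 : G) 1) (f := fun x : E => x - chartAt E (1 : G) 1) h h0
  have hid : mfderiv 𝓘(ℝ, E) 𝓘(ℝ, E) (extChartAt 𝓘(ℝ, E) (1 : G)) 1 =
      ContinuousLinearMap.id ℝ E := by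
    apply HasMFDerivAt.mfderiv
    refine ⟨continuousAt_extChartAt _, ?_⟩
    simp only [writtenInExtChartAt, mfld_simps]
    apply HasFDerivAt.hasFDerivWithinAt
    refine (hasFDerivAt_id (𝕜 := ℝ) (chartAt E (1 : G) 1)).congr_of_eventuallyEq ?_
    filter_upwards [(chartAt E (1 : G)).open_target.mem_nhds (mem_chart_target E 1)] with u hu
    simp only [Function.comp_apply, (chartAt E (1 : G)).right_inv hu]
    rfl
  rw [GroupLieAlgebra.bracket_def, ← mlieBracketWithin_univ, mlieBracketWithin_apply]
  have hinv : (mfderiv 𝓘(ℝ, E) 𝓘(ℝ, E) (extChartAt 𝓘(ℝ, E) (1 : G)) 1).inverse =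
      ContinuousLinearMap.id ℝ E := by
    rw [hid]
    exact ContinuousLinearMap.inverse_id
  let F : E → E → E := fun w => mpullbackWithin 𝓘(ℝ, E) 𝓘(ℝ, E)
    (extChartAt 𝓘(ℝ, E) (1 : G)).symm
    (mulInvariantVectorField (I := 𝓘(ℝ, E)) (G := G) w) (Set.range 𝓘(ℝ, E))
  refine (congrArg (fun T : E →L[ℝ] E => T _) hinv).trans ?_
  change lieBracketWithin ℝ (F v) (F w) ((extChartAt 𝓘(ℝ, E) (1 : G)).symm ⁻¹' Set.univ ∩
    Set.range 𝓘(ℝ, E)) (chartAt E (1 : G) 1) = _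
  have hset : (extChartAt 𝓘(ℝ, E) (1 : G)).symm ⁻¹' Set.univ ∩ Set.range 𝓘(ℝ, E) = Set.univ := by
    simp
  have hF : ∀ w, F w (chartAt E (1 : G) 1) = w := fun w => (key w).self_of_nhds.trans (hval w)
  have hF' : ∀ w, fderiv ℝ (F w) (chartAt E (1 : G) 1) =
      (mulHess E G).flip (0, w) ∘L ContinuousLinearMap.inl ℝ E E :=
    fun w => (key w).fderiv_eq.trans (hder w).fderiv
  rw [hset, lieBracketWithin_univ, lieBracket_eq]
  simp only [hF, hF']
  simp

variable (E G) in
/-- The differential at `1` of the adjoint representation, on the model space. -/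
noncomputable def brE : E →L[ℝ] E →L[ℝ] E := fderiv ℝ (fun u : E => adE E (loc E G u)) 0

/-- The differential of the adjoint representation is the bracket. -/
theorem brE_eq (v w : E) :
    brE E G v w =
      (⁅(show Alg E G from v), (show Alg E G from w)⁆ : Alg E G) := by
  have hA : HasFDerivAt (fun u : E => adE E (loc E G u))
      (brE E G) 0 :=
    (contDiffAt_adE_loc.differentiableAt (by simp)).hasFDerivAt
  have h1 := hasFDerivAt_fderiv_mul_left (E := E) (G := G) w
  have h2 := (hasFDerivAt_fderiv_mul_right (E := E) (G := G)).clm_apply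
    (hA.clm_apply (hasFDerivAt_const w (0 : E)))
  -- The identity `a u = (a u a⁻¹) a`, differentiated in `u` at `1`. Differentiating once more in
  -- `a` expresses the derivative of `Ad` as a difference of two mixed second derivatives, which
  -- symmetry of the Hessian turns into the bracket.
  have heq : (fun a : E => fderiv ℝ (fun u : E => colog E (loc E G a * loc E G u)) 0 w)
      =ᶠ[𝓝 0] fun a : E => (fderiv ℝ (fun p : E × E => colog E (loc E G p.1 * loc E G p.2))
        (0, a) ∘L ContinuousLinearMap.inl ℝ E E) (adE E (loc E G a) w) := by
    have hc : Filter.Tendsto (fun a : E => ((0 : E), a)) (𝓝 0) (𝓝 (0 : E × E)) :=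
      (by fun_prop : Continuous fun a : E => ((0 : E), a)).tendsto 0
    filter_upwards [hc.eventually (eventually_differentiableAt_mul (E := E) (G := G))] with a ha
    have hconj := hasFDerivAt_conj (E := E) (loc E G a)
    have h0 : (fun u : E => colog E (loc E G a * loc E G u * (loc E G a)⁻¹)) 0 = 0 := by simp
    have h3 := HasFDerivAt.comp (0 : E) (f := fun u : E => (u, a)) ha.hasFDerivAt
      (hasFDerivAt_prodMk_left (0 : E) a)
    rw [← h0] at h3
    have h4 := h3.comp (0 : E) hconj
    have h5 : (fun u : E => colog E (loc E G a * loc E G u)) =ᶠ[𝓝 0]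
        ((fun p : E × E => colog E (loc E G p.1 * loc E G p.2)) ∘ fun u : E => (u, a)) ∘
          fun u : E => colog E (loc E G a * loc E G u * (loc E G a)⁻¹) := by
      filter_upwards [eventually_loc_colog_comp (E := E) (continuousAt_conj (E := E) (loc E G a))
        (by simp)] with u hu
      simp [hu]
    rw [h5.fderiv_eq, h4.fderiv]
    simp
  have h6 := (h1.congr_of_eventuallyEq heq.symm).unique h2
  have h7 := congrArg (fun T : E →L[ℝ] E => T v) h6
  rw [lie_eq_mulHess]
  simp only [ContinuousLinearMap.coe_comp, Function.comp_apply, ContinuousLinearMap.inl_apply,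
    ContinuousLinearMap.flip_apply, _root_.add_apply,
    ContinuousLinearMap.inr_apply, ContinuousLinearMap.compL_apply, loc_zero, adE_one] at h7
  rw [show ((0 : E), (0 : E)) = 0 from rfl, fderiv_mul_zero_left] at h7
  rw [h7, mulHess_symm (w, 0)]
  simp

end Bracket
end AdjointComplexity

namespace AdjointComplexity

/-! ### Compatibility of `Ad`, the bracket and homomorphisms -/

section Homomorphisms

variable {E : Type*} [NormedAddCommGroup E] [NormedSpace ℝ E]
  {G : Type*} [TopologicalSpace G] [ChartedSpace E G] [Group G] [LieGroup 𝓘(ℝ, E) ∞ G]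
  {E' : Type*} [NormedAddCommGroup E'] [NormedSpace ℝ E']
  {K : Type*} [TopologicalSpace K] [ChartedSpace E' K] [Group K] [LieGroup 𝓘(ℝ, E') ∞ K]

theorem Ad_mul_apply (g h : G) (v : Alg E G) : Ad E G (g * h) v = Ad E G g (Ad E G h v) :=
  congrArg (fun T : E →L[ℝ] E => T v) (adE_mul (E := E) g h)

theorem Ad_one_apply (v : Alg E G) : Ad E G 1 v = v :=
  congrArg (fun T : E →L[ℝ] E => T v) (adE_one (E := E) (G := G))

theorem hasFDerivAt_adE_loc : HasFDerivAt (fun u : E => adE E (loc E G u))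
    (brE E G) 0 :=
  (contDiffAt_adE_loc.differentiableAt (by simp)).hasFDerivAt

theorem hasFDerivAt_adE_loc_apply (y : E) : HasFDerivAt (fun u : E => adE E (loc E G u) y)
    ((brE E G).flip y) 0 := by
  refine (hasFDerivAt_adE_loc.clm_apply (hasFDerivAt_const y (0 : E))).congr_fderiv ?_
  ext v
  simp

/-- Differentiate `Ad_{g u g⁻¹} (Ad_g w) = Ad_g (Ad_u w)` in `u` at `1`. -/
theorem adE_brE (g : G) (v w : E) :
    adE E g (brE E G v w) = brE E G (adE E g v) (adE E g w) := by
  have h1 : HasFDerivAt (fun u : E => adE E (loc E G u) (adE E g w))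
      ((brE E G).flip (adE E g w))
      (colog E (g * loc E G 0 * g⁻¹)) := by
    simpa using hasFDerivAt_adE_loc_apply (E := E) (G := G) (adE E g w)
  have h2 := h1.comp (0 : E) (hasFDerivAt_conj g)
  have h3 := (adE E g).hasFDerivAt.comp (0 : E) (hasFDerivAt_adE_loc_apply (E := E) (G := G) w)
  have h4 : (fun u : E => adE E (loc E G u) (adE E g w)) ∘
      (fun u : E => colog E (g * loc E G u * g⁻¹)) =ᶠ[𝓝 0]
      (adE E g) ∘ fun u : E => adE E (loc E G u) w := by
    filter_upwards [eventually_loc_colog_comp (E := E) (continuousAt_conj (E := E) g)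
      (by simp)] with u hu
    simp only [Function.comp_apply, hu]
    rw [← ContinuousLinearMap.comp_apply, ← adE_mul, ← ContinuousLinearMap.comp_apply, ← adE_mul]
    simp
  have h5 := congrArg (fun T : E →L[ℝ] E => T v) ((h3.congr_of_eventuallyEq h4).unique h2)
  exact h5

/-- `Ad_g` is an automorphism of the Lie algebra. -/
theorem Ad_lie (g : G) (v w : Alg E G) : Ad E G g ⁅v, w⁆ = ⁅Ad E G g v, Ad E G g w⁆ :=
  (congrArg (adE E g) (brE_eq (E := E) v w)).symm.trans
    ((adE_brE (E := E) g v w).trans (brE_eq (E := E) _ _))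

variable {ι : K →* G}

theorem hasFDerivAt_hom (hι : IsLieSubgroup (E := E) (E' := E') ι) :
    HasFDerivAt (fun u : E' => colog E (ι (loc E' K u)))
      (show E' →L[ℝ] E from differentialAtOne (E := E) (E' := E') ι) 0 :=
  hasFDerivAt_colog_comp_loc (map_one ι) (hι.smooth.mdifferentiable (by simp) 1)

theorem contDiffAt_hom (hι : IsLieSubgroup (E := E) (E' := E') ι) :
    ContDiffAt ℝ ∞ (fun u : E' => colog E (ι (loc E' K u))) 0 :=
  contDiffAt_colog_comp (hι.smooth.contMDiffAt.comp (0 : E')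
    (contMDiffAt_loc (E := E') (G := K)).self_of_nhds) (by simp)

theorem continuousAt_hom_loc (hι : IsLieSubgroup (E := E) (E' := E') ι) :
    ContinuousAt (fun u : E' => ι (loc E' K u)) 0 :=
  (hι.smooth.continuous.continuousAt (x := loc E' K 0)).comp continuousAt_loc

theorem eventually_loc_hom (hι : IsLieSubgroup (E := E) (E' := E') ι) :
    ∀ᶠ u in 𝓝 (0 : E'), loc E G (colog E (ι (loc E' K u))) = ι (loc E' K u) :=
  eventually_loc_colog_comp (continuousAt_hom_loc hι) (by simp)

theorem contDiffAt_adE_hom_loc (hι : IsLieSubgroup (E := E) (E' := E') ι) :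
    ContDiffAt ℝ ∞ (fun u : E' => adE E (ι (loc E' K u))) 0 := by
  have h : ContDiffAt ℝ ∞ (fun u : E => adE E (loc E G u)) (colog E (ι (loc E' K 0))) := by
    simpa using contDiffAt_adE_loc (E := E) (G := G)
  refine (h.comp (0 : E') (contDiffAt_hom hι)).congr_of_eventuallyEq ?_
  filter_upwards [eventually_loc_hom hι] with u hu
  simp [hu]

theorem hasFDerivAt_adE_hom_loc (hι : IsLieSubgroup (E := E) (E' := E') ι) :
    HasFDerivAt (fun u : E' => adE E (ι (loc E' K u)))
      (brE E G ∘L (show E' →L[ℝ] E from differentialAtOne (E := E) (E' := E') ι)) 0 := by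
  have h : HasFDerivAt (fun u : E => adE E (loc E G u))
      (brE E G) (colog E (ι (loc E' K 0))) := by
    simpa using hasFDerivAt_adE_loc (E := E) (G := G)
  exact (h.comp (0 : E') (hasFDerivAt_hom hι)).congr_of_eventuallyEq (by
      filter_upwards [eventually_loc_hom hι] with u hu
      simp [hu])

/-- Differentiate `ι(k u k⁻¹) = ι(k) ι(u) ι(k)⁻¹` in `u` at `1`; differentiating the result in `k`
at `1` then gives `differentialAtOne_lie`. -/
theorem differentialAtOne_Ad (hι : IsLieSubgroup (E := E) (E' := E') ι) (k : K) (v : Alg E' K) :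
    differentialAtOne (E := E) (E' := E') ι (Ad E' K k v) =
      Ad E G (ι k) (differentialAtOne (E := E) (E' := E') ι v) := by
  have h1 : HasFDerivAt (fun u : E' => colog E (ι (loc E' K u)))
      (show E' →L[ℝ] E from differentialAtOne (E := E) (E' := E') ι)
      (colog E' (k * loc E' K 0 * k⁻¹)) := by
    simpa using hasFDerivAt_hom hι
  have h2 : HasFDerivAt (fun u : E => colog E (ι k * loc E G u * (ι k)⁻¹)) (adE E (ι k))
      (colog E (ι (loc E' K 0))) := by
    simpa using hasFDerivAt_conj (ι k)
  have h3 := h1.comp (0 : E') (hasFDerivAt_conj (E := E') k)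
  have h4 := h2.comp (0 : E') (hasFDerivAt_hom hι)
  have h5 := congrArg (fun T : E' →L[ℝ] E => T v) ((h3.congr_of_eventuallyEq (by
    filter_upwards [eventually_loc_hom hι, eventually_loc_colog_comp (E := E')
      (continuousAt_conj (E := E') k) (by simp)] with u hu hu'
    simp [hu, hu'])).unique h4)
  exact h5

theorem differentialAtOne_lie (hι : IsLieSubgroup (E := E) (E' := E') ι) (v w : Alg E' K) :
    differentialAtOne (E := E) (E' := E') ι ⁅v, w⁆ =
      ⁅differentialAtOne (E := E) (E' := E') ι v, differentialAtOne (E := E) (E' := E') ι w⁆ := by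
  let D : E' →L[ℝ] E := differentialAtOne (E := E) (E' := E') ι
  suffices h : ∀ v w : E', D (brE E' K v w) = brE E G (D v) (D w) from
    (congrArg D (brE_eq (E := E') v w)).symm.trans ((h v w).trans (brE_eq (E := E) _ _))
  intro v w
  have h1 := D.hasFDerivAt.comp (0 : E') (hasFDerivAt_adE_loc_apply (E := E') (G := K) w)
  have h3 := (hasFDerivAt_adE_hom_loc hι).clm_apply (hasFDerivAt_const (D w) (0 : E'))
  have h4 : D ∘ (fun u : E' => adE E' (loc E' K u) w) =
      fun u : E' => adE E (ι (loc E' K u)) (D w) := by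
    funext u
    exact differentialAtOne_Ad hι (loc E' K u) w
  rw [h4] at h1
  have h5 := congrArg (fun T : E' →L[ℝ] E => T v) (h1.unique h3)
  change D (brE E' K v w) = adE E (ι (loc E' K 0)) 0 + brE E G (D v) (D w) at h5
  simpa using h5

end Homomorphisms
end AdjointComplexity

namespace AdjointComplexity

/-! ### Lie algebras with an invariant scalar product -/

section InvariantForms

variable {L : Type*} [LieRing L] [LieAlgebra ℝ L]

/-- A positive definite symmetric bilinear form for which all `ad x` are skew. -/
structure IsInvariantInner (B : LinearMap.BilinForm ℝ L) : Prop where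
  symm : ∀ u v, B u v = B v u
  pos : ∀ u, u ≠ 0 → 0 < B u u
  inv : ∀ u v w, B ⁅u, v⁆ w = B u ⁅v, w⁆

variable {B : LinearMap.BilinForm ℝ L} (hB : IsInvariantInner B)
include hB

theorem IsInvariantInner.eq_zero {u : L} (h : B u u = 0) : u = 0 := by
  by_contra hne
  exact (hB.pos u hne).ne' h

theorem IsInvariantInner.skew (x u v : L) : B ⁅x, u⁆ v = - B u ⁅x, v⁆ := by
  rw [← lie_skew, map_neg, LinearMap.neg_apply, hB.inv]

theorem IsInvariantInner.isRefl : B.IsRefl := fun u v h => by rw [hB.symm]; exact h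

theorem IsInvariantInner.nondegenerate : B.Nondegenerate :=
  ⟨fun u hu => hB.eq_zero (hu u), fun u hu => hB.eq_zero (hu u)⟩

/-- `ad x` is skew, so `B([x, u], [x, u]) = -B(u, [x, [x, u]])`. -/
theorem IsInvariantInner.lie_eq_zero_of_lie_lie {x u : L} (h : ⁅x, ⁅x, u⁆⁆ = 0) : ⁅x, u⁆ = 0 := by
  apply hB.eq_zero
  rw [hB.skew, h]
  simp

/-- A skew map has no generalized kernel beyond its kernel. This is the link between
`LieAlgebra.rank`, governed by Engel subalgebras, and dimensions of centralizers. -/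
theorem IsInvariantInner.engel_eq_ker (x : L) :
    (LieSubalgebra.engel ℝ x).toSubmodule = LinearMap.ker (LieAlgebra.ad ℝ L x) := by
  ext u
  simp only [LieSubalgebra.mem_toSubmodule, LieSubalgebra.mem_engel_iff, LinearMap.mem_ker,
    LieAlgebra.ad_apply]
  constructor
  · rintro ⟨n, hn⟩
    induction n with
    | zero =>
      have : u = 0 := by simpa using hn
      simp [this]
    | succ n ih =>
      rcases Nat.eq_zero_or_pos n with rfl | hpos
      · simpa using hn
      · apply ih
        obtain ⟨m, rfl⟩ : ∃ m, n = m + 1 := ⟨n - 1, by omega⟩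
        rw [pow_succ', pow_succ'] at hn
        rw [pow_succ']
        simp only [Module.End.mul_apply, LieAlgebra.ad_apply] at hn ⊢
        exact hB.lie_eq_zero_of_lie_lie hn
  · intro h
    exact ⟨1, by simpa using h⟩

theorem IsInvariantInner.rank_le [FiniteDimensional ℝ L] (x : L) :
    LieAlgebra.rank ℝ L ≤ finrank ℝ (LinearMap.ker (LieAlgebra.ad ℝ L x)) := by
  rw [← hB.engel_eq_ker x]
  exact LieAlgebra.rank_le_finrank_engel ℝ x

theorem IsInvariantInner.exists_rank_eq [FiniteDimensional ℝ L] :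
    ∃ x : L, finrank ℝ (LinearMap.ker (LieAlgebra.ad ℝ L x)) = LieAlgebra.rank ℝ L := by
  obtain ⟨x, hx⟩ := LieAlgebra.exists_isRegular ℝ L
  refine ⟨x, ?_⟩
  rw [← hB.engel_eq_ker x]
  exact (LieAlgebra.isRegular_iff_finrank_engel_eq_rank ℝ x).1 hx

/-- A centralizer whose derived algebra is abelian is abelian. -/
theorem IsInvariantInner.lie_eq_zero_of_metabelian {x : L}
    (h : ∀ a b c d : L, ⁅x, a⁆ = 0 → ⁅x, b⁆ = 0 → ⁅x, c⁆ = 0 → ⁅x, d⁆ = 0 →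
      ⁅⁅a, b⁆, ⁅c, d⁆⁆ = 0) {a b : L} (ha : ⁅x, a⁆ = 0) (hb : ⁅x, b⁆ = 0) : ⁅a, b⁆ = 0 := by
  have hab : ⁅x, ⁅a, b⁆⁆ = 0 := by rw [leibniz_lie, ha, hb]; simp
  -- `[a, b]` commutes with `[[a, b], b]`, both being brackets in the centralizer; hence `[[a, b],
  -- b] = 0`, and `B([a, b], [a, b]) = B(a, [b, [a, b]]) = 0`.
  have h1 : ⁅⁅a, b⁆, b⁆ = 0 := hB.lie_eq_zero_of_lie_lie (h a b _ _ ha hb hab hb)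
  apply hB.eq_zero
  rw [hB.inv, ← lie_skew, h1]
  simp

theorem IsInvariantInner.orthogonal_range_ad (y : L) :
    B.orthogonal (LinearMap.range (LieAlgebra.ad ℝ L y)) = LinearMap.ker (LieAlgebra.ad ℝ L y) := by
  ext v
  simp only [LinearMap.BilinForm.mem_orthogonal_iff, LinearMap.mem_range, LinearMap.mem_ker,
    LieAlgebra.ad_apply]
  constructor
  · intro h
    apply hB.eq_zero
    have := h _ ⟨⁅y, v⁆, rfl⟩
    rw [hB.skew] at this
    simpa using this
  · rintro h _ ⟨u, rfl⟩
    rw [hB.skew, h]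
    simp

end InvariantForms

/-! ### Scalar products coming from the group -/

section Groups

variable {E : Type*} [NormedAddCommGroup E] [NormedSpace ℝ E] [FiniteDimensional ℝ E]
  {G : Type*} [TopologicalSpace G] [ChartedSpace E G] [Group G] [LieGroup 𝓘(ℝ, E) ∞ G]
  {E' : Type*} [NormedAddCommGroup E'] [NormedSpace ℝ E'] [FiniteDimensional ℝ E']
  {K : Type*} [TopologicalSpace K] [ChartedSpace E' K] [Group K] [LieGroup 𝓘(ℝ, E') ∞ K]

/-- The scalar product as a continuous bilinear form on the model space. -/
noncomputable def InvariantScalarProduct.formE (P : InvariantScalarProduct E G) :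
    E →L[ℝ] E →L[ℝ] ℝ :=
  LinearMap.toContinuousBilinearMap (show E →ₗ[ℝ] E →ₗ[ℝ] ℝ from P.form)

theorem InvariantScalarProduct.formE_adE (P : InvariantScalarProduct E G) (g : G) (u v : E) :
    P.formE (adE E g u) (adE E g v) = P.formE u v :=
  P.invariant g u v

/-- The infinitesimal form of `Ad`-invariance: the derivative at `1` of the constant function `a ↦
⟨Ad_a v, Ad_a w⟩`. -/
theorem InvariantScalarProduct.formE_brE (P : InvariantScalarProduct E G) (u v w : E) :
    P.formE (brE E G u v) w + P.formE v (brE E G u w) = 0 := by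
  have h1 := hasFDerivAt_adE_loc_apply (E := E) (G := G) v
  have h2 := hasFDerivAt_adE_loc_apply (E := E) (G := G) w
  have h3 := (P.formE.hasFDerivAt.comp (0 : E) h1).clm_apply h2
  have h4 : (fun a : E => (P.formE ∘ fun u : E => adE E (loc E G u) v) a (adE E (loc E G a) w)) =
      fun _ => P.formE v w := by
    funext a
    exact P.formE_adE _ _ _
  rw [h4] at h3
  have h5 := congrArg (fun T : E →L[ℝ] ℝ => T u) (h3.unique (hasFDerivAt_const _ _))
  simp only [Function.comp_apply, loc_zero, adE_one, ContinuousLinearMap.coe_id', id_eq,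
    ContinuousLinearMap.comp_apply, ContinuousLinearMap.flip_apply, _root_.add_apply,
    _root_.zero_apply] at h5
  linarith

theorem InvariantScalarProduct.isInvariantInner (P : InvariantScalarProduct E G) :
    IsInvariantInner P.form where
  symm := P.symm
  pos := P.pos
  inv u v w := by
    have h : P.form (brE E G v u) w + P.form u (brE E G v w) = 0 :=
      P.formE_brE (E := E) v u w
    have h1 : P.form ⁅v, u⁆ w = P.form (brE E G v u) w :=
      congrArg (fun z => P.form z w) (brE_eq (E := E) (G := G) v u).symm
    have h2 : P.form u ⁅v, w⁆ = P.form u (brE E G v w) :=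
      congrArg (fun z => P.form u z) (brE_eq (E := E) (G := G) v w).symm
    rw [← lie_skew, map_neg, LinearMap.neg_apply, h1, h2]
    linarith

/-- The scalar product induced on the Lie algebra of a Lie subgroup. -/
noncomputable def InvariantScalarProduct.pullback (P : InvariantScalarProduct E G) {ι : K →* G}
    (hι : IsLieSubgroup (E := E) (E' := E') ι) : InvariantScalarProduct E' K where
  form := P.form.comp (differentialAtOne (E := E) (E' := E') ι).toLinearMap
    (differentialAtOne (E := E) (E' := E') ι).toLinearMap
  symm u v := P.symm _ _
  pos u hu := P.pos _ fun h => hu (hι.immersion (h.trans (map_zero _).symm))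
  invariant k u v := by
    change P.form (differentialAtOne ι _) (differentialAtOne ι _) = _
    rw [differentialAtOne_Ad hι, differentialAtOne_Ad hι]
    exact P.invariant _ _ _

end Groups
end AdjointComplexity

namespace AdjointComplexity

/-! ### Dimension counts for the conormal space and the Poisson kernel -/

section Counting

variable {L : Type*} [LieRing L] [LieAlgebra ℝ L] [FiniteDimensional ℝ L]
  {B : LinearMap.BilinForm ℝ L}

theorem finrank_map_add_finrank_inf_ker {V W : Type*} [AddCommGroup V] [Module ℝ V]
    [FiniteDimensional ℝ V] [AddCommGroup W] [Module ℝ W] (f : V →ₗ[ℝ] W) (S : Submodule ℝ V) :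
    finrank ℝ (S.map f) + finrank ℝ (S ⊓ LinearMap.ker f : Submodule ℝ V) = finrank ℝ S := by
  have h := LinearMap.finrank_range_add_finrank_ker (f.domRestrict S)
  rw [LinearMap.range_domRestrict] at h
  rw [← h, LinearMap.ker_domRestrict]
  congr 1
  have e : (LinearMap.ker f).submoduleOf S ≃ₗ[ℝ] (S ⊓ LinearMap.ker f : Submodule ℝ V) :=
    (Submodule.equivSubtypeMap S _).trans
      (LinearEquiv.ofEq _ _ (by rw [Submodule.submoduleOf, Submodule.map_comap_subtype]))
  exact e.finrank_eq.symm

/-- The elements of `W` orthogonal to `V`, for a subspace `V` of `W`. -/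
theorem IsInvariantInner.finrank_inf_orthogonal (hB : IsInvariantInner B) {V W : Submodule ℝ L}
    (hVW : V ≤ W) :
    finrank ℝ (W ⊓ B.orthogonal V : Submodule ℝ L) + finrank ℝ V = finrank ℝ W := by
  have h1 : W ⊓ B.orthogonal V = B.orthogonal (B.orthogonal W ⊔ V) := by
    rw [← LinearMap.BilinForm.orthogonal_orthogonal hB.nondegenerate hB.isRefl W]
    ext v
    simp only [Submodule.mem_inf, LinearMap.BilinForm.mem_orthogonal_iff]
    rw [LinearMap.BilinForm.orthogonal_orthogonal hB.nondegenerate hB.isRefl W]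
    constructor
    · rintro ⟨h1, h2⟩ n hn
      obtain ⟨a, ha, b, hb, rfl⟩ := Submodule.mem_sup.1 hn
      have e1 := h1 a ha
      have e2 := h2 b hb
      change B (a + b) v = 0
      change B a v = 0 at e1
      change B b v = 0 at e2
      rw [map_add, LinearMap.add_apply, e1, e2, add_zero]
    · intro h
      exact ⟨fun n hn => h n (Submodule.mem_sup_left hn),
        fun n hn => h n (Submodule.mem_sup_right hn)⟩
  have h2 : Disjoint (B.orthogonal W) V := by
    rw [Submodule.disjoint_def]
    intro x hx hxV
    exact hB.eq_zero (hx x (hVW hxV))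
  have h3 := Submodule.finrank_sup_add_finrank_inf_eq (B.orthogonal W) V
  rw [disjoint_iff.1 h2, finrank_bot, LinearMap.BilinForm.finrank_orthogonal hB.nondegenerate] at h3
  rw [h1, LinearMap.BilinForm.finrank_orthogonal hB.nondegenerate]
  have h4 := Submodule.finrank_le W
  have h5 := Submodule.finrank_le (B.orthogonal W ⊔ V)
  omega

/-- The double orthogonal complement taken inside `W`: a vector orthogonal to `V` splits along `W^⊥
⊕ W`, and its `W`-component is still orthogonal to `V ≤ W`. -/
theorem IsInvariantInner.mem_of_orthogonal (hB : IsInvariantInner B) {V W : Submodule ℝ L}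
    (hVW : V ≤ W) {v : L} (hv : v ∈ W) (h : ∀ w ∈ W ⊓ B.orthogonal V, B v w = 0) : v ∈ V := by
  rw [← LinearMap.BilinForm.orthogonal_orthogonal hB.nondegenerate hB.isRefl V]
  intro z hz
  have hc : IsCompl (B.orthogonal W) W := by
    refine ((LinearMap.BilinForm.restrict_nondegenerate_iff_isCompl_orthogonal hB.isRefl).1 ?_).symm
    have key : ∀ u : W, (B.restrict W) u u = 0 → u = 0 := fun u hu => Subtype.ext (hB.eq_zero hu)
    exact ⟨fun u hu => key u (hu u), fun u hu => key u (hu u)⟩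
  obtain ⟨a, ha, b, hb, rfl⟩ := Submodule.mem_sup.1
    (show z ∈ B.orthogonal W ⊔ W by rw [hc.sup_eq_top]; trivial)
  have hb' : b ∈ B.orthogonal V := by
    intro n hn
    have e1 : B n (a + b) = 0 := hz n hn
    have e2 : B n a = 0 := ha n (hVW hn)
    rw [map_add, e2, zero_add] at e1
    exact e1
  change B (a + b) v = 0
  rw [map_add, LinearMap.add_apply, hB.symm b, h b ⟨hb, hb'⟩, hB.symm a]
  have e2 : B v a = 0 := ha v hv
  rw [e2, add_zero]

variable (B) in
/-- The elements of the tangent space of the orbit at `y` that are orthogonal to the orbit of the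
subspace `k`. -/
def normalSpace (k : Submodule ℝ L) (y : L) : Submodule ℝ L :=
  LinearMap.range (LieAlgebra.ad ℝ L y) ⊓ B.orthogonal (k.map (LieAlgebra.ad ℝ L y : L →ₗ[ℝ] L))

variable (B) in
/-- The kernel of the Poisson tensor restricted to `normalSpace`. -/
def normalKernel (k : Submodule ℝ L) (y : L) : Submodule ℝ L where
  carrier := {v | v ∈ normalSpace B k y ∧ ∀ w ∈ normalSpace B k y, B y ⁅v, w⁆ = 0}
  zero_mem' := ⟨Submodule.zero_mem _, fun w _ => by simp⟩
  add_mem' ha hb := ⟨Submodule.add_mem _ ha.1 hb.1, fun w hw => by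
    rw [add_lie, map_add, ha.2 w hw, hb.2 w hw, add_zero]⟩
  smul_mem' c a ha := ⟨Submodule.smul_mem _ _ ha.1, fun w hw => by
    rw [smul_lie, map_smul, ha.2 w hw, smul_zero]⟩

variable (B) in
/-- The elements `κ` of `k` such that `⟨y, [κ, k]⟩ = 0`: the centralizer in `k` of the
projection of `y`. -/
def projCentralizer (k : Submodule ℝ L) (y : L) : Submodule ℝ L where
  carrier := {v | v ∈ k ∧ ∀ w ∈ k, B y ⁅v, w⁆ = 0}
  zero_mem' := ⟨Submodule.zero_mem _, fun w _ => by simp⟩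
  add_mem' ha hb := ⟨Submodule.add_mem _ ha.1 hb.1, fun w hw => by
    rw [add_lie, map_add, ha.2 w hw, hb.2 w hw, add_zero]⟩
  smul_mem' c a ha := ⟨Submodule.smul_mem _ _ ha.1, fun w hw => by
    rw [smul_lie, map_smul, ha.2 w hw, smul_zero]⟩

theorem IsInvariantInner.finrank_normalSpace (hB : IsInvariantInner B) (k : Submodule ℝ L)
    (y : L) :
    finrank ℝ (normalSpace B k y) + finrank ℝ k +
        finrank ℝ (LinearMap.ker (LieAlgebra.ad ℝ L y)) =
      finrank ℝ L + finrank ℝ (k ⊓ LinearMap.ker (LieAlgebra.ad ℝ L y) : Submodule ℝ L) := by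
  have h1 := hB.finrank_inf_orthogonal
    (V := k.map (LieAlgebra.ad ℝ L y : L →ₗ[ℝ] L)) (W := LinearMap.range (LieAlgebra.ad ℝ L y))
    LinearMap.map_le_range
  have h2 := finrank_map_add_finrank_inf_ker (LieAlgebra.ad ℝ L y) k
  have h3 := LinearMap.finrank_range_add_finrank_ker (LieAlgebra.ad ℝ L y)
  unfold normalSpace
  omega

/-- The algebra is the orthogonal sum of the range and the kernel of `ad y`; drop the kernel
component of `u`. -/
theorem IsInvariantInner.exists_range_of_lie (hB : IsInvariantInner B) (y u : L) :
    ∃ v ∈ LinearMap.range (LieAlgebra.ad ℝ L y), ⁅y, v⁆ = ⁅y, u⁆ := by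
  have hc : IsCompl (B.orthogonal (LinearMap.range (LieAlgebra.ad ℝ L y)))
      (LinearMap.range (LieAlgebra.ad ℝ L y)) := by
    refine ((LinearMap.BilinForm.restrict_nondegenerate_iff_isCompl_orthogonal hB.isRefl).1 ?_).symm
    have key : ∀ u : LinearMap.range (LieAlgebra.ad ℝ L y),
      (B.restrict _) u u = 0 → u = 0 := fun u hu => Subtype.ext (hB.eq_zero hu)
    exact ⟨fun u hu => key u (hu u), fun u hu => key u (hu u)⟩
  obtain ⟨a, ha, b, hb, rfl⟩ := Submodule.mem_sup.1
    (show u ∈ _ ⊔ _ by rw [hc.sup_eq_top]; trivial)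
  rw [hB.orthogonal_range_ad] at ha
  refine ⟨b, hb, ?_⟩
  have : ⁅y, a⁆ = 0 := ha
  rw [lie_add, this, zero_add]

/-- Both spaces have the same image under `ad y`. If `v` is in the kernel of the form, `[y, v]` is
orthogonal to the normal space, so `[y, v] = [y, κ]` with `κ ∈ k`; that `v` is orthogonal to `[y,
k]` says exactly that `κ` centralizes the projection of `y`. On the normal kernel `ad y` is
injective, and on the centralizer its kernel is `k ∩ ker (ad y)`. -/
theorem IsInvariantInner.finrank_normalKernel (hB : IsInvariantInner B) (k : Submodule ℝ L)
    (y : L) :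
    finrank ℝ (normalKernel B k y) +
        finrank ℝ (k ⊓ LinearMap.ker (LieAlgebra.ad ℝ L y) : Submodule ℝ L) =
      finrank ℝ (projCentralizer B k y) := by
  have h1 := finrank_map_add_finrank_inf_ker (LieAlgebra.ad ℝ L y) (normalKernel B k y)
  have h2 := finrank_map_add_finrank_inf_ker (LieAlgebra.ad ℝ L y) (projCentralizer B k y)
  have h3 : normalKernel B k y ⊓ LinearMap.ker (LieAlgebra.ad ℝ L y) = ⊥ := by
    rw [eq_bot_iff]
    rintro v ⟨⟨⟨hv, -⟩, -⟩, hv'⟩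
    rw [← hB.orthogonal_range_ad] at hv'
    exact hB.eq_zero (hv' v hv)
  have h4 : projCentralizer B k y ⊓ LinearMap.ker (LieAlgebra.ad ℝ L y) =
      k ⊓ LinearMap.ker (LieAlgebra.ad ℝ L y) := by
    ext v
    constructor
    · rintro ⟨⟨h1, -⟩, h2⟩
      exact ⟨h1, h2⟩
    · rintro ⟨h1, h2⟩
      refine ⟨⟨h1, fun w _ => ?_⟩, h2⟩
      have : ⁅y, v⁆ = 0 := h2
      rw [← hB.inv, this]
      simp
  have h5 : (normalKernel B k y).map (LieAlgebra.ad ℝ L y : L →ₗ[ℝ] L) =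
      (projCentralizer B k y).map (LieAlgebra.ad ℝ L y : L →ₗ[ℝ] L) := by
    ext z
    constructor
    · rintro ⟨v, ⟨hv, hv'⟩, rfl⟩
      obtain ⟨κ, hκ, hκ'⟩ : ⁅y, v⁆ ∈ k.map (LieAlgebra.ad ℝ L y : L →ₗ[ℝ] L) :=
        hB.mem_of_orthogonal (W := LinearMap.range (LieAlgebra.ad ℝ L y))
          LinearMap.map_le_range ⟨v, rfl⟩ fun w hw => by
            rw [hB.inv]
            exact hv' w hw
      have hκ2 : ⁅y, κ⁆ = ⁅y, v⁆ := hκ'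
      refine ⟨κ, ⟨hκ, fun w hw => ?_⟩, hκ'⟩
      have h6 : B ⁅y, w⁆ v = 0 := hv.2 _ ⟨w, hw, rfl⟩
      rw [← hB.inv, hκ2, hB.skew, hB.symm, h6, neg_zero]
    · rintro ⟨κ, ⟨hκ, hκ'⟩, rfl⟩
      obtain ⟨v, hv, hvκ⟩ := hB.exists_range_of_lie y κ
      refine ⟨v, ⟨⟨hv, ?_⟩, fun w hw => ?_⟩, hvκ⟩
      · rintro _ ⟨w, hw, rfl⟩
        change B ⁅y, w⁆ v = 0
        rw [hB.skew, hvκ, hB.symm, hB.inv, hκ' w hw, neg_zero]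
      · rw [← hB.inv, hvκ]
        exact hw.2 _ ⟨κ, hκ, rfl⟩
  rw [h3, finrank_bot] at h1
  rw [h4, ← h5] at h2
  omega

/-- The Gram matrix `A` is skew, so `det A = (-1)ⁿ det A` with `det A ≠ 0`. -/
theorem even_finrank_of_isAlt {V : Type*} [AddCommGroup V] [Module ℝ V] [FiniteDimensional ℝ V]
    {Ω : LinearMap.BilinForm ℝ V} (h : Ω.IsAlt) (hn : Ω.Nondegenerate) : Even (finrank ℝ V) := by
  classical
  let b := finBasis ℝ V
  have h1 := (LinearMap.BilinForm.nondegenerate_iff_det_ne_zero b).1 hn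
  set A := LinearMap.BilinForm.toMatrix b Ω
  have h2 : A.transpose = -A := by
    ext i j
    simp only [A, Matrix.transpose_apply, Matrix.neg_apply, LinearMap.BilinForm.toMatrix_apply]
    exact (h.neg_eq (b i) (b j)).symm
  have h3 : A.det = (-1) ^ finrank ℝ V * A.det := by
    conv_lhs => rw [← Matrix.det_transpose, h2, Matrix.det_neg, Fintype.card_fin]
  by_contra hodd
  rw [(Nat.not_even_iff_odd.1 hodd).neg_one_pow] at h3
  apply h1
  linarith

/-- The form is nondegenerate on any complement of its radical, which therefore has even dimension.
-/
theorem exists_finrank_eq_two_mul_add {V : Type*} [AddCommGroup V] [Module ℝ V]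
    [FiniteDimensional ℝ V] {Ω : LinearMap.BilinForm ℝ V} (h : Ω.IsAlt) :
    ∃ c : ℕ, finrank ℝ V = 2 * c + finrank ℝ (LinearMap.ker Ω) := by
  obtain ⟨C, hC⟩ := (LinearMap.ker Ω).exists_isCompl
  have key : ∀ u : C, (∀ v : C, Ω u v = 0) → u = 0 := by
    intro u hu
    apply Subtype.ext
    apply (Submodule.disjoint_def.1 hC.disjoint) _ _ u.2
    ext v
    obtain ⟨a, ha, b, hb, rfl⟩ := Submodule.mem_sup.1
      (show v ∈ LinearMap.ker Ω ⊔ C by rw [hC.sup_eq_top]; trivial)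
    have e1 : Ω u a = 0 := by
      rw [← h.neg_eq, (show Ω a = 0 from ha)]; simp
    rw [map_add, e1, hu ⟨b, hb⟩]
    simp
  have hn : (Ω.restrict C).Nondegenerate :=
    ⟨fun u hu => key u hu, fun u hu => key u fun v => by
      have := hu v
      rw [← h.neg_eq, neg_eq_zero]; exact this⟩
  obtain ⟨c, hc⟩ := even_finrank_of_isAlt (Ω := Ω.restrict C) (fun v => h v) hn
  exact ⟨c, by have := Submodule.finrank_add_eq_of_isCompl hC; omega⟩

variable (B) in
/-- The difference of the differential dimension and the differential index is even. -/
theorem exists_finrank_normalSpace_eq (k : Submodule ℝ L) (y : L) :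
    ∃ c : ℕ, finrank ℝ (normalSpace B k y) = 2 * c + finrank ℝ (normalKernel B k y) := by
  let Ω : LinearMap.BilinForm ℝ (normalSpace B k y) := LinearMap.mk₂ ℝ
    (fun u v => B y ⁅(u : L), (v : L)⁆)
    (fun a b c => by rw [Submodule.coe_add, add_lie, map_add])
    (fun r a b => by rw [Submodule.coe_smul, smul_lie, map_smul])
    (fun a b c => by rw [Submodule.coe_add, lie_add, map_add])
    (fun r a b => by rw [Submodule.coe_smul, lie_smul, map_smul])
  have hw0 : Ω.IsAlt := fun v => by
    change B y ⁅(v : L), (v : L)⁆ = 0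
    rw [lie_self, map_zero]
  obtain ⟨c, hc⟩ := exists_finrank_eq_two_mul_add hw0
  refine ⟨c, ?_⟩
  rw [hc]
  congr 1
  have h : (LinearMap.ker Ω).map (normalSpace B k y).subtype = normalKernel B k y := by
    ext v
    constructor
    · rintro ⟨u, hu, rfl⟩
      exact ⟨u.2, fun w hw => congrArg (fun T : _ →ₗ[ℝ] ℝ => T ⟨w, hw⟩) hu⟩
    · rintro ⟨hv, hv'⟩
      refine ⟨⟨v, hv⟩, ?_, rfl⟩
      ext w
      exact hv' w w.2
  rw [← h]
  exact (Submodule.equivMapOfInjective _ (Submodule.injective_subtype _) _).finrank_eq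

end Counting
end AdjointComplexity

namespace AdjointComplexity

/-- The derivative of a curve of linear maps whose rank does not increase maps the kernel into the
range. -/
theorem deriv_mem_range_of_rank_le {V W : Type*} [NormedAddCommGroup V] [NormedSpace ℝ V]
    [NormedAddCommGroup W] [NormedSpace ℝ W] [FiniteDimensional ℝ W] {T : ℝ → V →L[ℝ] W}
    {T' : V →L[ℝ] W} (hT : HasDerivAt T T' 0)
    (hr : ∀ᶠ t in 𝓝 0, finrank ℝ (LinearMap.range (T t).toLinearMap) ≤
      finrank ℝ (LinearMap.range (T 0).toLinearMap))
    {κ : V} (hκ : T 0 κ = 0) : T' κ ∈ LinearMap.range (T 0).toLinearMap := by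
  by_contra hnot
  let b := finBasis ℝ (LinearMap.range (T 0).toLinearMap)
  have hv : ∀ i, ∃ v, T 0 v = b i := fun i => (b i).2
  choose v hv using hv
  let n := finrank ℝ (LinearMap.range (T 0).toLinearMap)
  -- If `T' κ` were outside the range of `T 0`, it would complete a basis of this range to `n + 1`
  -- independent vectors `F0`. Since `T 0 κ = 0`, the vectors `F t`, all in the range of `T t`,
  -- converge to `F0`, so they are independent for small `t ≠ 0` and the rank jumps.
  let F : ℝ → Fin (n + 1) → W := fun t => Fin.cons (t⁻¹ • T t κ) fun i => T t (v i)
  let F0 : Fin (n + 1) → W := Fin.cons (T' κ) fun i => (b i : W)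
  have hF0 : LinearIndependent ℝ F0 := by
    rw [linearIndependent_finCons]
    constructor
    · exact b.linearIndependent.map' _ (Submodule.ker_subtype _)
    · intro h
      apply hnot
      have : Submodule.span ℝ (Set.range fun i => (b i : W)) ≤
          LinearMap.range (T 0).toLinearMap := by
        rw [Submodule.span_le]
        rintro _ ⟨i, rfl⟩
        exact (b i).2
      exact this h
  have hev : ∀ x : V, HasDerivAt (fun t => T t x) (T' x) 0 := fun x => by
    simpa using hT.clm_apply (hasDerivAt_const (0 : ℝ) x)
  have hlim : Filter.Tendsto F (𝓝[≠] 0) (𝓝 F0) := by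
    rw [tendsto_pi_nhds]
    intro i
    refine Fin.cases ?_ (fun i => ?_) i
    · have h := (hasDerivAt_iff_tendsto_slope.1 (hev κ))
      refine h.congr fun t => ?_
      simp [slope, F, hκ]
    · have h := (hev (v i)).continuousAt.tendsto
      simp only [hv] at h
      exact (h.mono_left nhdsWithin_le_nhds).congr fun t => by simp [F]
  have h1 : ∀ᶠ t in 𝓝[≠] (0 : ℝ), LinearIndependent ℝ (F t) :=
    hlim.eventually (isOpen_setOfPred_linearIndependent.mem_nhds hF0)
  obtain ⟨t, ht, ht'⟩ := (h1.and (hr.filter_mono nhdsWithin_le_nhds)).exists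
  have hmem : ∀ i, F t i ∈ LinearMap.range (T t).toLinearMap := by
    intro i
    refine Fin.cases ?_ (fun i => ?_) i
    · exact Submodule.smul_mem _ _ ⟨κ, rfl⟩
    · exact ⟨v i, rfl⟩
  have h2 : LinearIndependent ℝ
      (fun i => (⟨F t i, hmem i⟩ : LinearMap.range (T t).toLinearMap)) :=
    LinearIndependent.of_comp (LinearMap.range (T t).toLinearMap).subtype ht
  have h3 := h2.fintype_card_le_finrank
  simp only [Fintype.card_fin] at h3
  omega

/-! ### Conjugation into a centralizer, and the rank -/

section Groups

variable {E : Type*} [NormedAddCommGroup E] [NormedSpace ℝ E] [FiniteDimensional ℝ E]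
  {G : Type*} [TopologicalSpace G] [ChartedSpace E G] [Group G] [LieGroup 𝓘(ℝ, E) ∞ G]
  {E' : Type*} [NormedAddCommGroup E'] [NormedSpace ℝ E'] [FiniteDimensional ℝ E']
  {K : Type*} [TopologicalSpace K] [ChartedSpace E' K] [Group K] [LieGroup 𝓘(ℝ, E') ∞ K]

theorem continuous_adE : Continuous (adE E : G → E →L[ℝ] E) := by
  have h1 : ContinuousAt (adE E : G → E →L[ℝ] E) 1 := by
    have h := (contDiffAt_adE_loc (E := E) (G := G)).continuousAt
    rw [ContinuousAt, loc_zero] at h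
    rw [ContinuousAt, ← map_loc_nhds (E := E), Filter.tendsto_map'_iff]
    exact h
  rw [continuous_iff_continuousAt]
  intro g
  have h2 : ContinuousAt (fun h : G => adE E (g⁻¹ * h)) g := by
    have h3 : ContinuousAt (fun h : G => g⁻¹ * h) g :=
      (contMDiff_mul_left (I := 𝓘(ℝ, E)) (n := ∞) (a := g⁻¹)).continuous.continuousAt
    refine ContinuousAt.comp (g := (adE E : G → E →L[ℝ] E)) ?_ h3
    simpa using h1
  have h4 : (adE E : G → E →L[ℝ] E) = fun h => (adE E g).comp (adE E (g⁻¹ * h)) := by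
    funext h
    rw [← adE_mul]
    simp
  rw [h4]
  exact continuousAt_const.clm_comp h2

theorem map_Ad_isotropy (g : G) (x : Alg E G) :
    (isotropy x).map (Ad E G g : Alg E G →ₗ[ℝ] Alg E G) = isotropy (Ad E G g x) := by
  ext v
  constructor
  · rintro ⟨u, hu, rfl⟩
    have h : ⁅x, u⁆ = 0 := hu
    change ⁅Ad E G g x, Ad E G g u⁆ = 0
    rw [← Ad_lie, h, map_zero]
  · intro hv
    have h : ⁅Ad E G g x, v⁆ = 0 := hv
    refine ⟨Ad E G g⁻¹ v, ?_, ?_⟩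
    · change ⁅x, Ad E G g⁻¹ v⁆ = 0
      have h2 := congrArg (Ad E G g⁻¹) h
      rwa [Ad_lie, ← Ad_mul_apply, inv_mul_cancel, Ad_one_apply, map_zero] at h2
    · change Ad E G g (Ad E G g⁻¹ v) = v
      rw [← Ad_mul_apply, mul_inv_cancel, Ad_one_apply]

theorem finrank_isotropy_Ad (g : G) (x : Alg E G) :
    finrank ℝ (isotropy (Ad E G g x)) = finrank ℝ (isotropy x) := by
  rw [← map_Ad_isotropy]
  refine (Submodule.equivMapOfInjective _ (fun u v h => ?_) _).finrank_eq.symm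
  have h2 := congrArg (Ad E G g⁻¹) h
  change Ad E G g⁻¹ (Ad E G g u) = Ad E G g⁻¹ (Ad E G g v) at h2
  rwa [← Ad_mul_apply, ← Ad_mul_apply, inv_mul_cancel, Ad_one_apply, Ad_one_apply] at h2

/-- By compactness `g ↦ ⟨Ad_g z, x⟩` attains its maximum; the assertion is the vanishing of its
derivative there. -/
theorem exists_forall_formE_brE_adE_eq_zero [CompactSpace G] (P : InvariantScalarProduct E G)
    (x z : E) : ∃ g : G, ∀ ξ, P.formE (brE E G ξ (adE E g z)) x = 0 := by
  have hc : Continuous fun g : G => P.formE (adE E g z) x := by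
    have := continuous_adE (E := E) (G := G)
    fun_prop
  obtain ⟨g, -, hg⟩ := isCompact_univ.exists_isMaxOn (Set.univ_nonempty (α := G)) hc.continuousOn
  refine ⟨g, fun ξ => ?_⟩
  have h1 := (P.formE.hasFDerivAt.comp (0 : E)
    (hasFDerivAt_adE_loc_apply (E := E) (G := G) (adE E g z))).clm_apply
      (hasFDerivAt_const x (0 : E))
  have h2 : IsLocalMax (fun a : E => (P.formE ∘ fun u : E => adE E (loc E G u) (adE E g z)) a x)
      0 := by
    refine Filter.Eventually.of_forall fun u => ?_
    have h3 : P.formE (adE E (loc E G u * g) z) x ≤ P.formE (adE E g z) x := hg trivial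
    simpa [adE_mul, adE_one] using h3
  have h4 := congrArg (fun T : E →L[ℝ] ℝ => T ξ) (h2.hasFDerivAt_eq_zero h1)
  simpa using h4

/-- Some conjugate of `z` commutes with `x`. -/
theorem exists_Ad_lie_eq_zero [CompactSpace G] (P : InvariantScalarProduct E G) (x z : Alg E G) :
    ∃ g : G, ⁅x, Ad E G g z⁆ = 0 := by
  obtain ⟨g, hg⟩ := exists_forall_formE_brE_adE_eq_zero (E := E) P x z
  have h6 : ∀ ξ : Alg E G, P.form ⁅ξ, Ad E G g z⁆ x = 0 := fun ξ =>
    (congrArg (fun w => P.form w x) (brE_eq (E := E) (G := G) ξ (Ad E G g z))).symm.trans (hg ξ)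
  refine ⟨g, P.isInvariantInner.eq_zero ?_⟩
  -- With this choice of `ξ` the critical point equation says that `[x, Ad_g z]` has length zero.
  have h7 := h6 ⁅x, Ad E G g z⁆
  rw [P.isInvariantInner.inv, ← lie_skew (Ad E G g z) x, map_neg, neg_eq_zero] at h7
  exact h7

/-- A conjugate of `z` lies in the abelian centralizer of `x`, so it commutes with all of it: the
centralizer of the conjugate contains that of `x`. -/
theorem finrank_isotropy_le_of_abelian [CompactSpace G] (P : InvariantScalarProduct E G)
    {x : Alg E G} (h : ∀ a ∈ isotropy x, ∀ b ∈ isotropy x, ⁅a, b⁆ = 0) (z : Alg E G) :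
    finrank ℝ (isotropy x) ≤ finrank ℝ (isotropy z) := by
  obtain ⟨g, hg⟩ := exists_Ad_lie_eq_zero P x z
  rw [← finrank_isotropy_Ad g z]
  exact Submodule.finrank_mono fun b hb => h _ hg b hb

theorem finrank_isotropy_eq_rank_of_abelian [CompactSpace G] (P : InvariantScalarProduct E G)
    {x : Alg E G} (h : ∀ a ∈ isotropy x, ∀ b ∈ isotropy x, ⁅a, b⁆ = 0) :
    finrank ℝ (isotropy x) = LieAlgebra.rank ℝ (Alg E G) := by
  obtain ⟨z, hz⟩ := P.isInvariantInner.exists_rank_eq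
  exact le_antisymm ((finrank_isotropy_le_of_abelian P h z).trans hz.le)
    (P.isInvariantInner.rank_le x)

end Groups
end AdjointComplexity

namespace AdjointComplexity

/-! ### Generic elements and their projection to `𝔨` -/

section Pair

variable {E : Type*} [NormedAddCommGroup E] [NormedSpace ℝ E] [FiniteDimensional ℝ E]
  {G : Type*} [TopologicalSpace G] [ChartedSpace E G] [Group G] [LieGroup 𝓘(ℝ, E) ∞ G]
  {E' : Type*} [NormedAddCommGroup E'] [NormedSpace ℝ E'] [FiniteDimensional ℝ E']
  {K : Type*} [TopologicalSpace K] [ChartedSpace E' K] [Group K] [LieGroup 𝓘(ℝ, E') ∞ K]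
  {ι : K →* G}

theorem finrank_range_add_finrank_ker_clm {W : Type*} [NormedAddCommGroup W] [NormedSpace ℝ W]
    (T : E' →L[ℝ] W) : finrank ℝ (LinearMap.range T.toLinearMap) +
      finrank ℝ (LinearMap.ker T.toLinearMap) = finrank ℝ E' :=
  LinearMap.finrank_range_add_finrank_ker T.toLinearMap

/-- The differential `𝔨 → 𝔤`, on the model spaces. -/
noncomputable def diffE (E E' : Type*) [NormedAddCommGroup E] [NormedSpace ℝ E]
    [NormedAddCommGroup E'] [NormedSpace ℝ E']
    {G : Type*} [TopologicalSpace G] [ChartedSpace E G] [Group G]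
    {K : Type*} [TopologicalSpace K] [ChartedSpace E' K] [Group K] (ι : K →* G) : E' →L[ℝ] E :=
  differentialAtOne (E := E) (E' := E') ι

theorem diffE_injective (hι : IsLieSubgroup (E := E) (E' := E') ι) :
    Function.Injective (diffE E E' ι) := hι.immersion

theorem diffE_brE (hι : IsLieSubgroup (E := E) (E' := E') ι) (v w : E') :
    diffE E E' ι (brE E' K v w) = brE E G (diffE E E' ι v) (diffE E E' ι w) :=
  (congrArg (diffE E E' ι) (brE_eq (E := E') v w)).trans
    ((differentialAtOne_lie hι v w).trans (brE_eq (E := E) _ _).symm)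

theorem brE_skew (v w : E) : brE E G v w = - brE E G w v :=
  (brE_eq (E := E) v w).trans ((lie_skew (L := Alg E G) _ _).symm.trans
    (congrArg (fun z : E => -z) (brE_eq (E := E) (G := G) w v).symm))

theorem formE_symm (P : InvariantScalarProduct E G) (u v : E) :
    P.formE u v = P.formE v u := P.symm u v

theorem formE_brE_skew (P : InvariantScalarProduct E G) (u v w : E) :
    P.formE (brE E G u v) w = - P.formE v (brE E G u w) :=
  eq_neg_of_add_eq_zero_left (P.formE_brE u v w)

theorem formE_eq_zero (P : InvariantScalarProduct E G) {u : E} (h : ∀ v, P.formE v u = 0) :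
    u = 0 :=
  P.isInvariantInner.eq_zero (h u)

/-- The kernel of `κ ↦ [κ, y]` corresponds to `𝔨 ∩ 𝔤(y)`. -/
theorem finrank_subalg_inf_isotropy (hι : IsLieSubgroup (E := E) (E' := E') ι) (y : E) :
    finrank ℝ (subalg (E' := E') ι ⊓ isotropy (G := G) y : Submodule ℝ (Alg E G)) =
      finrank ℝ (LinearMap.ker (((brE E G).flip y).comp (diffE E E' ι)).toLinearMap) := by
  have h : (LinearMap.ker (((brE E G).flip y).comp (diffE E E' ι)).toLinearMap).map
      (diffE E E' ι).toLinearMap =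
      (show Submodule ℝ E from subalg (E' := E') ι ⊓ isotropy (G := G) y) := by
    ext v
    have key : ∀ κ : E', brE E G (diffE E E' ι κ) y = 0 ↔
        (diffE E E' ι κ : Alg E G) ∈ isotropy (G := G) y := by
      intro κ
      have e := brE_eq (E := E) (G := G) y (diffE E E' ι κ)
      rw [brE_skew, neg_eq_zero, e]
      rfl
    constructor
    · rintro ⟨κ, hκ, rfl⟩
      exact ⟨⟨κ, rfl⟩, (key κ).1 hκ⟩
    · rintro ⟨⟨κ, rfl⟩, hκ⟩
      exact ⟨κ, (key κ).2 hκ, rfl⟩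
  have h2 := (Submodule.equivMapOfInjective (diffE E E' ι).toLinearMap (diffE_injective hι)
    (LinearMap.ker (((brE E G).flip y).comp (diffE E E' ι)).toLinearMap)).finrank_eq
  rw [h2, h]
  rfl

/-- The isotropy subalgebra in `𝔨` of a generic element is abelian. -/
theorem brE_eq_zero_of_generic (hι : IsLieSubgroup (E := E) (E' := E') ι)
    (P : InvariantScalarProduct E G) {y : E}
    (hy : ∀ z : Alg E G, finrank ℝ (subalg (E' := E') ι ⊓ isotropy (G := G) y :
        Submodule ℝ (Alg E G)) ≤
      finrank ℝ (subalg (E' := E') ι ⊓ isotropy z : Submodule ℝ (Alg E G)))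
    {κ κ' : E'} (hκ : brE E G (diffE E E' ι κ) y = 0) (hκ' : brE E G (diffE E E' ι κ') y = 0) :
    brE E G (diffE E E' ι κ) (diffE E E' ι κ') = 0 := by
  apply formE_eq_zero P
  intro η
  let T : ℝ → E' →L[ℝ] E := fun t => ((brE E G).flip (y + t • η)).comp (diffE E E' ι)
  have hT : HasDerivAt T (((brE E G).flip η).comp (diffE E E' ι)) 0 := by
    have h1 : HasDerivAt (fun t : ℝ => y + t • η) η 0 := by
      simpa using ((hasDerivAt_id (0 : ℝ)).smul_const η).const_add y
    have h2 : HasDerivAt (fun t : ℝ => (brE E G).flip (y + t • η)) ((brE E G).flip η) 0 :=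
      (brE E G).flip.hasFDerivAt.comp_hasDerivAt (0 : ℝ) h1
    refine (h2.clm_comp (hasDerivAt_const (0 : ℝ) (diffE E E' ι))).congr_deriv ?_
    ext v
    simp
  -- Genericity of `y` means that `κ ↦ [κ, y + tη]` has maximal rank at `t = 0`. Hence `[κ, η] =
  -- [κ₂, y]` for some `κ₂`, and by invariance `⟨[κ₂, y], κ'⟩ = 0` because `[κ', y] = 0`.
  obtain ⟨κ₂, h2⟩ := deriv_mem_range_of_rank_le hT (κ := κ) (Filter.Eventually.of_forall fun t => by
    have h1 := hy (y + t • η)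
    rw [finrank_subalg_inf_isotropy hι, finrank_subalg_inf_isotropy hι] at h1
    have h3 := finrank_range_add_finrank_ker_clm (T t)
    have h4 := finrank_range_add_finrank_ker_clm (T 0)
    have h5 : T 0 = ((brE E G).flip y).comp (diffE E E' ι) := by simp [T]
    rw [h5] at h4 ⊢
    change finrank ℝ (LinearMap.ker (((brE E G).flip y).comp (diffE E E' ι)).toLinearMap) ≤
      finrank ℝ (LinearMap.ker (T t).toLinearMap) at h1
    omega) (by simpa [T] using hκ)
  have h3 : brE E G (diffE E E' ι κ₂) y = brE E G (diffE E E' ι κ) η := by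
    simpa [T] using h2
  have h4 : P.formE η (brE E G (diffE E E' ι κ) (diffE E E' ι κ')) =
      - P.formE (brE E G (diffE E E' ι κ) η) (diffE E E' ι κ') := by
    rw [formE_brE_skew]; simp
  rw [h4, ← h3, formE_brE_skew, neg_neg, brE_skew, map_neg, formE_symm P, formE_brE_skew, neg_neg,
    hκ', map_zero]

/-- The element of `𝔨` that represents `y` through the scalar product: the projection of `y`. -/
noncomputable def projK (hι : IsLieSubgroup (E := E) (E' := E') ι)
    (P : InvariantScalarProduct E G) (y : Alg E G) : Alg E' K :=
  ((P.pullback hι).form.toDual (P.pullback hι).isInvariantInner.nondegenerate).symm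
    ((P.form y).comp (differentialAtOne (E := E) (E' := E') ι).toLinearMap)

theorem form_projK (hι : IsLieSubgroup (E := E) (E' := E') ι)
    (P : InvariantScalarProduct E G) (y : Alg E G) (κ : Alg E' K) :
    (P.pullback hι).form (projK hι P y) κ =
      P.form y (differentialAtOne (E := E) (E' := E') ι κ) := by
  exact LinearMap.BilinForm.apply_toDual_symm_apply
    (hB := (P.pullback hι).isInvariantInner.nondegenerate) _ _

/-- Since the projection represents `⟨y, ·⟩` on `𝔨`, its centralizer is the radical of the
alternating form `⟨y, [κ, κ']⟩`. This form is linear in `y`, which makes rank arguments available.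
-/
theorem mem_isotropy_projK_iff (hι : IsLieSubgroup (E := E) (E' := E') ι)
    (P : InvariantScalarProduct E G) (y : Alg E G) (κ : Alg E' K) :
    κ ∈ isotropy (projK hι P y) ↔
      ∀ κ' : Alg E' K, P.form y (differentialAtOne (E := E) (E' := E') ι ⁅κ, κ'⁆) = 0 := by
  have h : ∀ κ', P.form y (differentialAtOne (E := E) (E' := E') ι ⁅κ, κ'⁆) =
      (P.pullback hι).form ⁅projK hι P y, κ⁆ κ' := fun κ' => by
    rw [← form_projK hι, (P.pullback hι).isInvariantInner.inv]
  simp only [h]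
  constructor
  · intro h1 κ'
    have h2 : ⁅projK hι P y, κ⁆ = 0 := h1
    simp [h2]
  · intro h1
    exact (P.pullback hι).isInvariantInner.eq_zero (h1 _)

theorem finrank_isotropy_projK (hι : IsLieSubgroup (E := E) (E' := E') ι)
    (P : InvariantScalarProduct E G) (y : Alg E G) :
    finrank ℝ (isotropy (projK hι P y)) =
      finrank ℝ (projCentralizer P.form (subalg (E' := E') ι) y) := by
  have h : (isotropy (projK hι P y)).map (differentialAtOne (E := E) (E' := E') ι).toLinearMap =
      projCentralizer P.form (subalg (E' := E') ι) y := by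
    ext v
    constructor
    · rintro ⟨κ, hκ, rfl⟩
      refine ⟨⟨κ, rfl⟩, ?_⟩
      rintro _ ⟨κ', rfl⟩
      have h1 := (mem_isotropy_projK_iff hι P y κ).1 hκ κ'
      rwa [differentialAtOne_lie hι] at h1
    · rintro ⟨⟨κ, rfl⟩, h1⟩
      refine ⟨κ, (mem_isotropy_projK_iff hι P y κ).2 fun κ' => ?_, rfl⟩
      rw [differentialAtOne_lie hι]
      exact h1 _ ⟨κ', rfl⟩
  rw [← h]
  exact (Submodule.equivMapOfInjective _ hι.immersion _).finrank_eq

theorem finrank_isotropy_projK_eq_ker (hι : IsLieSubgroup (E := E) (E' := E') ι)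
    (P : InvariantScalarProduct E G) (y : E) :
    finrank ℝ (isotropy (projK hι P y)) =
      finrank ℝ (LinearMap.ker ((ContinuousLinearMap.compL ℝ E' E' ℝ
        ((P.formE y).comp (diffE E E' ι))).comp (brE E' K)).toLinearMap) := by
  have h : isotropy (projK hι P y) =
      (show Submodule ℝ (Alg E' K) from (LinearMap.ker ((ContinuousLinearMap.compL ℝ E' E' ℝ
        ((P.formE y).comp (diffE E E' ι))).comp (brE E' K)).toLinearMap)) := by
    ext κ
    have e : ∀ κ κ' : E', P.formE y (diffE E E' ι (brE E' K κ κ')) =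
        P.form y (differentialAtOne (E := E) (E' := E') ι
          ⁅(show Alg E' K from κ), (show Alg E' K from κ')⁆) := fun κ κ' =>
      congrArg (fun z => P.formE y (diffE E E' ι z)) (brE_eq (E := E') κ κ')
    refine (mem_isotropy_projK_iff hι P y κ).trans ?_
    constructor
    · intro h1
      refine LinearMap.mem_ker.2 (ContinuousLinearMap.ext fun κ' => ?_)
      exact (e κ κ').trans (h1 κ')
    · intro h1 κ'
      exact (e κ κ').symm.trans (congrArg (fun T : E' →L[ℝ] ℝ => T κ') (LinearMap.mem_ker.1 h1))
  rw [h]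
  rfl

/-- If the projection to `𝔨` of `y` is as regular as possible on the orbit of `y`, then the derived
algebra of its centralizer in `𝔨` centralizes `y`. -/
theorem brE_brE_eq_zero_of_minimal (hι : IsLieSubgroup (E := E) (E' := E') ι)
    (P : InvariantScalarProduct E G) {y : E}
    (hy : ∀ g : G, finrank ℝ (isotropy (projK hι P y)) ≤
      finrank ℝ (isotropy (projK hι P (adE E g y))))
    {κ κ' : E'} (hκ : κ ∈ isotropy (projK hι P y)) (hκ' : κ' ∈ isotropy (projK hι P y)) :
    brE E G (diffE E E' ι (brE E' K κ κ')) y = 0 := by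
  apply formE_eq_zero P
  intro ξ
  let S : E →L[ℝ] E' →L[ℝ] E' →L[ℝ] ℝ :=
    ((ContinuousLinearMap.compL ℝ E' (E' →L[ℝ] E') (E' →L[ℝ] ℝ)).flip (brE E' K)) ∘L
      (ContinuousLinearMap.compL ℝ E' E' ℝ) ∘L
        ((ContinuousLinearMap.compL ℝ E' E ℝ).flip (diffE E E' ι)) ∘L P.formE
  have hS : ∀ z κ κ', S z κ κ' = P.formE z (diffE E E' ι (brE E' K κ κ')) := fun z κ κ' => rfl
  have hSk : ∀ z, finrank ℝ (isotropy (projK hι P z)) =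
      finrank ℝ (LinearMap.ker (S z).toLinearMap) := finrank_isotropy_projK_eq_ker hι P
  have hker : ∀ {κ : E'}, κ ∈ isotropy (projK hι P y) → ∀ κ' : E', S y κ κ' = 0 := by
    intro κ hκ κ'
    have h1 := (mem_isotropy_projK_iff hι P y κ).1 hκ κ'
    rw [hS]
    refine Eq.trans ?_ h1
    exact congrArg (fun z => P.formE y (diffE E E' ι z)) (brE_eq (E := E') κ κ')
  have hT : HasDerivAt (fun t : ℝ => S (adE E (loc E G (t • ξ)) y)) (S (brE E G ξ y)) 0 := by
    have h1 : HasDerivAt (fun t : ℝ => t • ξ) ξ 0 := by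
      simpa using (hasDerivAt_id (0 : ℝ)).smul_const ξ
    have h2 := hasFDerivAt_adE_loc_apply (E := E) (G := G) y
    rw [← zero_smul ℝ ξ] at h2
    have h3 : HasFDerivAt (fun z => S z) S (adE E (loc E G ((0 : ℝ) • ξ)) y) :=
      ContinuousLinearMap.hasFDerivAt (𝕜 := ℝ) (E := E) (F := E' →L[ℝ] E' →L[ℝ] ℝ) S
    have h4 : HasDerivAt (fun t : ℝ => adE E (loc E G (t • ξ)) y) ((brE E G).flip y ξ) 0 :=
      HasFDerivAt.comp_hasDerivAt (f := fun t : ℝ => t • ξ)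
        (l := fun u : E => adE E (loc E G u) y) (0 : ℝ) h2 h1
    exact HasFDerivAt.comp_hasDerivAt (E := E' →L[ℝ] E' →L[ℝ] ℝ) (l := fun z => S z)
      (f := fun t : ℝ => adE E (loc E G (t • ξ)) y) (0 : ℝ) h3 h4
  have h0 : adE E (loc E G ((0 : ℝ) • ξ)) y = y := by simp [adE_one]
  -- The rank of the form `S` at `Ad_{loc (tξ)} y` is maximal at `t = 0`, so `⟨[ξ, y], [κ, ·]⟩ = ⟨y,
  -- [κ₂, ·]⟩`. Evaluated at `κ'` in the radical the right side vanishes, and moving `ξ` across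
  -- gives `⟨ξ, [[κ, κ'], y]⟩ = 0`.
  obtain ⟨κ₂, h2⟩ := deriv_mem_range_of_rank_le hT (κ := κ) (Filter.Eventually.of_forall fun t => by
    have h1 := (hSk y).symm.le.trans ((hy (loc E G (t • ξ))).trans (hSk _).le)
    have h3 := finrank_range_add_finrank_ker_clm (S (adE E (loc E G (t • ξ)) y))
    have h4 := finrank_range_add_finrank_ker_clm (S y)
    rw [h0]
    omega) (by rw [h0]; exact ContinuousLinearMap.ext (hker hκ))
  have h3 := congrArg (fun T : E' →L[ℝ] ℝ => T κ') h2
  have h4 : S y κ₂ κ' = S (brE E G ξ y) κ κ' := by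
    rw [← h3, h0]
    rfl
  have h5 : S y κ₂ κ' = 0 := by
    have h6 := hker hκ' κ₂
    rw [hS] at h6 ⊢
    rw [brE_skew, map_neg, map_neg, h6, neg_zero]
  rw [h5, hS, brE_skew, map_neg, _root_.neg_apply, formE_brE_skew, neg_neg, brE_skew, map_neg] at h4
  linarith

/-- For a generic `y` whose projection to `𝔨` is as regular as possible on its orbit, this
projection is regular in `𝔨`. -/
theorem finrank_isotropy_projK_eq_rank [CompactSpace K]
    (hι : IsLieSubgroup (E := E) (E' := E') ι) (P : InvariantScalarProduct E G) {y : Alg E G}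
    (hgen : ∀ z : Alg E G, finrank ℝ (subalg (E' := E') ι ⊓ isotropy y :
        Submodule ℝ (Alg E G)) ≤
      finrank ℝ (subalg (E' := E') ι ⊓ isotropy z : Submodule ℝ (Alg E G)))
    (hy : ∀ g : G, finrank ℝ (isotropy (projK hι P y)) ≤
      finrank ℝ (isotropy (projK hι P (Ad E G g y)))) :
    finrank ℝ (isotropy (projK hι P y)) = LieAlgebra.rank ℝ (Alg E' K) := by
  apply finrank_isotropy_eq_rank_of_abelian (P.pullback hι)
  intro a ha b hb
  refine (P.pullback hι).isInvariantInner.lie_eq_zero_of_metabelian (x := projK hι P y)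
    (fun a b c d ha hb hc hd => ?_) ha hb
  -- Brackets of elements of the centralizer land in `𝔨(y)`, which is abelian because `y` is
  -- generic; so the centralizer is metabelian.
  have h1 := brE_brE_eq_zero_of_minimal (E := E) hι P hy ha hb
  have h2 := brE_brE_eq_zero_of_minimal (E := E) hι P hy hc hd
  have h3 := brE_eq_zero_of_generic (E := E) hι P hgen h1 h2
  apply hι.immersion
  rw [← diffE_brE hι] at h3
  have h4 : brE E' K (brE E' K a b) (brE E' K c d) = ⁅⁅a, b⁆, ⁅c, d⁆⁆ :=
    (brE_eq (E := E') _ _).trans (congrArg₂ (fun u v : Alg E' K => ⁅u, v⁆)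
      (brE_eq (E := E') a b) (brE_eq (E := E') c d))
  refine (congrArg (diffE E E' ι) h4.symm).trans (h3.trans (map_zero _).symm)

end Pair
end AdjointComplexity

namespace AdjointComplexity

/-! ### Polynomial functions and their zeros on orbits -/

section PolynomialFunctions

variable {E : Type*} [NormedAddCommGroup E] [NormedSpace ℝ E]

variable (E) in
/-- The polynomial functions on `E`. -/
def polyAlg : Subalgebra ℝ (E → ℝ) :=
  Algebra.adjoin ℝ (Set.range fun l : E →L[ℝ] ℝ => (l : E → ℝ))

theorem polyAlg_induction {p : (E → ℝ) → Prop} (linear : ∀ l : E →L[ℝ] ℝ, p l)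
    (const : ∀ c : ℝ, p fun _ => c)
    (add : ∀ f g : E → ℝ, f ∈ polyAlg E → g ∈ polyAlg E → p f → p g → p (f + g))
    (mul : ∀ f g : E → ℝ, f ∈ polyAlg E → g ∈ polyAlg E → p f → p g → p (f * g))
    {f : E → ℝ} (hf : f ∈ polyAlg E) : p f := by
  induction hf using Algebra.adjoin_induction with
  | mem f hf =>
    obtain ⟨l, rfl⟩ := hf
    exact linear l
  | algebraMap c => exact const c
  | add f g hf hg h1 h2 => exact add f g hf hg h1 h2
  | mul f g hf hg h1 h2 => exact mul f g hf hg h1 h2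

theorem linear_mem_polyAlg (l : E →L[ℝ] ℝ) : (l : E → ℝ) ∈ polyAlg E :=
  Algebra.subset_adjoin ⟨l, rfl⟩

theorem const_mem_polyAlg (c : ℝ) : (fun _ => c) ∈ polyAlg E :=
  (polyAlg E).algebraMap_mem c

theorem contDiff_of_mem_polyAlg {f : E → ℝ} (hf : f ∈ polyAlg E) : ContDiff ℝ ω f :=
  polyAlg_induction (fun l => l.contDiff) (fun _ => contDiff_const)
    (fun _ _ _ _ h1 h2 => h1.add h2) (fun _ _ _ _ h1 h2 => h1.mul h2) hf

theorem differentiable_of_mem_polyAlg {f : E → ℝ} (hf : f ∈ polyAlg E) : Differentiable ℝ f :=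
  (contDiff_of_mem_polyAlg hf).differentiable (by simp)

theorem comp_mem_polyAlg {f : E → ℝ} (hf : f ∈ polyAlg E) (T : E →L[ℝ] E) :
    (fun z => f (T z)) ∈ polyAlg E :=
  polyAlg_induction (p := fun f => (fun z => f (T z)) ∈ polyAlg E)
    (fun l => linear_mem_polyAlg (l.comp T)) (fun c => const_mem_polyAlg c)
    (fun _ _ _ _ h1 h2 => (polyAlg E).add_mem h1 h2)
    (fun _ _ _ _ h1 h2 => (polyAlg E).mul_mem h1 h2) hf

theorem fderiv_mem_polyAlg {f : E → ℝ} (hf : f ∈ polyAlg E) (T : E →L[ℝ] E) :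
    (fun z => fderiv ℝ f z (T z)) ∈ polyAlg E := by
  refine polyAlg_induction (p := fun f => (fun z => fderiv ℝ f z (T z)) ∈ polyAlg E)
    (fun l => ?_) (fun c => ?_) (fun f g hf hg h1 h2 => ?_) (fun f g hf hg h1 h2 => ?_) hf
  · simp only [ContinuousLinearMap.fderiv]
    exact linear_mem_polyAlg (l.comp T)
  · simpa using const_mem_polyAlg (E := E) 0
  · have h : (fun z => fderiv ℝ (f + g) z (T z)) =
        (fun z => fderiv ℝ f z (T z)) + fun z => fderiv ℝ g z (T z) := by
      funext z
      rw [fderiv_add (differentiable_of_mem_polyAlg hf z) (differentiable_of_mem_polyAlg hg z)]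
      rfl
    rw [h]
    exact (polyAlg E).add_mem h1 h2
  · have h : (fun z => fderiv ℝ (f * g) z (T z)) =
        f * (fun z => fderiv ℝ g z (T z)) + g * fun z => fderiv ℝ f z (T z) := by
      funext z
      rw [fderiv_mul (differentiable_of_mem_polyAlg hf z) (differentiable_of_mem_polyAlg hg z)]
      rfl
    rw [h]
    exact (polyAlg E).add_mem ((polyAlg E).mul_mem hf h2) ((polyAlg E).mul_mem hg h1)

theorem det_mem_polyAlg {n : ℕ} {M : Matrix (Fin n) (Fin n) (E → ℝ)}
    (hM : ∀ i j, M i j ∈ polyAlg E) :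
    (fun z => (Matrix.of fun i j => M i j z).det) ∈ polyAlg E := by
  have h : (fun z => (Matrix.of fun i j => M i j z).det) = M.det := by
    funext z
    simp only [Matrix.det_apply, Finset.sum_apply, Pi.smul_apply, Finset.prod_apply,
      Matrix.of_apply]
  rw [h, Matrix.det_apply]
  refine Subalgebra.sum_mem _ fun σ _ => ?_
  rw [Units.smul_def]
  exact zsmul_mem (Subalgebra.prod_mem _ fun i _ => hM _ _) _

/-- Separation of the variables `T` and `z`: integrating over a family of `T` only changes finitely
many coefficients, so averages of polynomial functions remain polynomial. -/
theorem exists_expansion_of_mem_polyAlg [FiniteDimensional ℝ E] {f : E → ℝ}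
    (hf : f ∈ polyAlg E) :
    ∃ (n : ℕ) (c : Fin n → (E →L[ℝ] E) → ℝ) (r : Fin n → E → ℝ), (∀ i, Continuous (c i)) ∧
      (∀ i, r i ∈ polyAlg E) ∧ ∀ T z, f (T z) = ∑ i, c i T * r i z := by
  suffices h : ∃ (ι : Type) (_ : Fintype ι) (c : ι → (E →L[ℝ] E) → ℝ) (r : ι → E → ℝ),
      (∀ i, Continuous (c i)) ∧ (∀ i, r i ∈ polyAlg E) ∧
      ∀ T z, f (T z) = ∑ i, c i T * r i z by
    obtain ⟨ι, _, c, r, hc, hr, h⟩ := h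
    let e := (Fintype.equivFin ι).symm
    exact ⟨_, fun i => c (e i), fun i => r (e i), fun i => hc _, fun i => hr _, fun T z => by
      rw [h T z]
      exact (Equiv.sum_comp e fun i => c i T * r i z).symm⟩
  refine polyAlg_induction (p := fun f => ∃ (ι : Type) (_ : Fintype ι)
      (c : ι → (E →L[ℝ] E) → ℝ) (r : ι → E → ℝ),
      (∀ i, Continuous (c i)) ∧ (∀ i, r i ∈ polyAlg E) ∧ ∀ T z, f (T z) = ∑ i, c i T * r i z)
    (fun l => ?_) (fun c => ?_) ?_ ?_ hf
  · let b := finBasis ℝ E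
    refine ⟨Fin (finrank ℝ E), inferInstance, fun i T => l (T (b i)),
      fun i => (LinearMap.toContinuousLinearMap (b.coord i)), fun i => by fun_prop,
      fun i => linear_mem_polyAlg _, fun T z => ?_⟩
    conv_lhs => rw [← b.sum_repr z]
    simp only [map_sum, map_smul, smul_eq_mul]
    exact Finset.sum_congr rfl fun i _ => mul_comm _ _
  · exact ⟨Unit, inferInstance, fun _ _ => c, fun _ _ => 1, fun _ => continuous_const,
      fun _ => const_mem_polyAlg 1, fun T z => by simp⟩
  · rintro f g - - ⟨ι₁, _, c₁, r₁, hc₁, hr₁, h₁⟩ ⟨ι₂, _, c₂, r₂, hc₂, hr₂, h₂⟩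
    refine ⟨ι₁ ⊕ ι₂, inferInstance, Sum.elim c₁ c₂, Sum.elim r₁ r₂, ?_, ?_, fun T z => ?_⟩
    · rintro (i | i)
      exacts [hc₁ i, hc₂ i]
    · rintro (i | i)
      exacts [hr₁ i, hr₂ i]
    · simp [h₁, h₂]
  · rintro f g - - ⟨ι₁, _, c₁, r₁, hc₁, hr₁, h₁⟩ ⟨ι₂, _, c₂, r₂, hc₂, hr₂, h₂⟩
    refine ⟨ι₁ × ι₂, inferInstance, fun p T => c₁ p.1 T * c₂ p.2 T, fun p => r₁ p.1 * r₂ p.2,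
      fun p => (hc₁ _).mul (hc₂ _), fun p => (polyAlg E).mul_mem (hr₁ _) (hr₂ _), fun T z => ?_⟩
    rw [Pi.mul_apply, h₁, h₂, Fintype.sum_prod_type, Finset.sum_mul_sum]
    refine Finset.sum_congr rfl fun i _ => Finset.sum_congr rfl fun j _ => ?_
    simp only [Pi.mul_apply]
    ring

theorem isNoetherianRing_polyAlg [FiniteDimensional ℝ E] : IsNoetherianRing (polyAlg E) := by
  classical
  let b := finBasis ℝ E
  let s : Finset (E → ℝ) := Finset.univ.image fun i =>
    ((LinearMap.toContinuousLinearMap (b.coord i) : E →L[ℝ] ℝ) : E → ℝ)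
  have h : polyAlg E = Algebra.adjoin ℝ (s : Set (E → ℝ)) := by
    apply le_antisymm
    · refine Algebra.adjoin_le ?_
      rintro _ ⟨l, rfl⟩
      have hl : (l : E → ℝ) = ∑ i, l (b i) •
          ((LinearMap.toContinuousLinearMap (b.coord i) : E →L[ℝ] ℝ) : E → ℝ) := by
        funext z
        conv_lhs => rw [← b.sum_repr z]
        simp only [map_sum, map_smul, smul_eq_mul, Finset.sum_apply, Pi.smul_apply]
        exact Finset.sum_congr rfl fun i _ => mul_comm _ _
      change (l : E → ℝ) ∈ Algebra.adjoin ℝ (s : Set (E → ℝ))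
      rw [hl]
      refine Subalgebra.sum_mem _ fun i _ => Subalgebra.smul_mem _ (Algebra.subset_adjoin ?_) _
      simp [s]
    · refine Algebra.adjoin_mono ?_
      intro f hf
      simp only [s, Finset.coe_image, Finset.coe_univ, Set.image_univ, Set.mem_range] at hf
      obtain ⟨i, rfl⟩ := hf
      exact ⟨_, rfl⟩
  have hfg : (polyAlg E).FG := h ▸ Subalgebra.fg_adjoin_finset s
  have := (Subalgebra.fg_iff_finiteType _).1 hfg
  exact Algebra.FiniteType.isNoetherianRing ℝ (polyAlg E)

/-- A polynomial function that vanishes on a neighbourhood of a point in the orbit under a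
connected group vanishes on the orbit. -/
theorem eq_zero_of_eventually_eq_zero [FiniteDimensional ℝ E] {G : Type*} [Group G]
    [TopologicalSpace G] [IsTopologicalGroup G] [ConnectedSpace G] (ρ : G →* (E →L[ℝ] E))
    {f : E → ℝ} (hf : f ∈ polyAlg E) {x : E} (h : ∀ᶠ g in 𝓝 (1 : G), f (ρ g x) = 0) (g : G) :
    f (ρ g x) = 0 := by
  have := isNoetherianRing_polyAlg (E := E)
  -- `I N` is the ideal of polynomials vanishing on `N·x`, and grows as `N` shrinks. By
  -- noetherianity it is eventually constant, equal to some `I M`: the polynomials whose germ along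
  -- the orbit at `x` vanishes. No analytic structure on `G` is involved.
  let I : Set G → Ideal (polyAlg E) := fun N =>
    { carrier := {q | ∀ u ∈ N, q.1 (ρ u x) = 0}
      zero_mem' := fun u _ => rfl
      add_mem' := fun {a b} ha hb u hu => by
        change a.1 (ρ u x) + b.1 (ρ u x) = 0
        rw [ha u hu, hb u hu, add_zero]
      smul_mem' := fun c a ha u hu => by
        change c.1 (ρ u x) * a.1 (ρ u x) = 0
        rw [ha u hu, mul_zero] }
  have hmono : ∀ {M N : Set G}, M ⊆ N → I N ≤ I M := fun hMN q hq u hu => hq u (hMN hu)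
  obtain ⟨J, ⟨M, hM, rfl⟩, hmax⟩ := set_has_maximal_iff_noetherian.2
    (inferInstanceAs (IsNoetherian (polyAlg E) (polyAlg E)))
    {J | ∃ N ∈ 𝓝 (1 : G), I N = J} ⟨_, Set.univ, Filter.univ_mem, rfl⟩
  have hle : ∀ N ∈ 𝓝 (1 : G), I N ≤ I M := by
    intro N hN
    have h1 : I M ≤ I (N ∩ M) := hmono Set.inter_subset_right
    have h2 := hmax _ ⟨N ∩ M, Filter.inter_mem hN hM, rfl⟩
    have h3 : I (N ∩ M) = I M := by
      by_contra hne
      exact h2 (lt_of_le_of_ne h1 (Ne.symm hne))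
    exact (hmono Set.inter_subset_left).trans h3.le
  let tr : G → polyAlg E → polyAlg E := fun h q => ⟨fun z => q.1 (ρ h z), comp_mem_polyAlg q.2 _⟩
  have htr : ∀ a b q, tr (a * b) q = tr b (tr a q) := by
    intro a b q
    apply Subtype.ext
    funext z
    simp [tr]
  let S : Subgroup G :=
    { carrier := {h | (∀ q ∈ I M, tr h q ∈ I M) ∧ ∀ q ∈ I M, tr h⁻¹ q ∈ I M}
      one_mem' := by
        have : ∀ q, tr 1 q = q := fun q => Subtype.ext (by funext z; simp [tr])
        simp only [Set.mem_ofPred_eq, inv_one, this]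
        exact ⟨fun _ h => h, fun _ h => h⟩
      mul_mem' := by
        rintro a b ⟨ha, ha'⟩ ⟨hb, hb'⟩
        refine ⟨fun q hq => ?_, fun q hq => ?_⟩
        · rw [htr]
          exact hb _ (ha q hq)
        · rw [mul_inv_rev, htr]
          exact ha' _ (hb' q hq)
      inv_mem' := by
        rintro a ⟨ha, ha'⟩
        exact ⟨ha', by simpa using ha⟩ }
  have hmul : Filter.Tendsto (fun p : G × G => p.1 * p.2) (𝓝 1 ×ˢ 𝓝 1) (𝓝 1) := by
    have h1 : Filter.Tendsto (fun p : G × G => p.1 * p.2) (𝓝 (1, 1)) (𝓝 (1 * 1)) :=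
      continuous_mul.tendsto _
    rwa [nhds_prod_eq, one_mul] at h1
  -- If `V·V ⊆ M`, translation by `h ∈ V` carries `I M` into `I V ≤ I M`. So the subgroup preserving
  -- `I M` is open, hence all of `G` by connectedness; evaluating a translate of `f` at `1` finishes
  -- the proof.
  obtain ⟨V, hV, hVM⟩ := Filter.eventually_prod_self_iff'.1 (hmul.eventually hM)
  have hkey : ∀ h ∈ V, ∀ q ∈ I M, tr h q ∈ I M := by
    intro h hh q hq
    apply hle V hV
    intro u hu
    have h1 := hq (h * u) (hVM h hh u hu)
    simpa [tr] using h1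
  have hS : S = ⊤ := by
    have hopen : IsOpen (S : Set G) := by
      apply Subgroup.isOpen_of_mem_nhds S (g := 1)
      have hV' : ∀ᶠ h in 𝓝 (1 : G), h⁻¹ ∈ V := by
        have h1 : Filter.Tendsto (fun h : G => h⁻¹) (𝓝 1) (𝓝 1) := by
          simpa using (continuous_inv (G := G)).tendsto 1
        exact h1.eventually hV
      filter_upwards [hV, hV'] with h h1 h2
      exact ⟨hkey h h1, hkey _ h2⟩
    have hclopen : IsClopen (S : Set G) := ⟨S.isClosed_of_isOpen hopen, hopen⟩
    exact SetLike.coe_injective (hclopen.eq_univ ⟨1, S.one_mem⟩)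
  have hfM : (⟨f, hf⟩ : polyAlg E) ∈ I M := hle _ h (fun u hu => hu)
  have hg : g ∈ S := hS ▸ Subgroup.mem_top g
  have h2 := hg.1 _ hfM 1 (mem_of_mem_nhds hM)
  simpa [tr] using h2

theorem dense_ne_zero_of_mem_polyAlg [FiniteDimensional ℝ E] {G : Type*} [Group G]
    [TopologicalSpace G] [IsTopologicalGroup G] [ConnectedSpace G] (ρ : G →* (E →L[ℝ] E))
    {f : E → ℝ} (hf : f ∈ polyAlg E) {x : E} {g₀ : G} (h : f (ρ g₀ x) ≠ 0) :
    Dense {g : G | f (ρ g x) ≠ 0} := by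
  rw [dense_iff_inter_open]
  intro U hU ⟨u, hu⟩
  by_contra hne
  apply h
  have h1 : ∀ g ∈ U, f (ρ g x) = 0 := by
    intro g hg
    by_contra h2
    exact hne ⟨g, hg, h2⟩
  have h3 : ∀ᶠ g in 𝓝 (1 : G), f (ρ g (ρ u x)) = 0 := by
    have h4 : Filter.Tendsto (fun g : G => g * u) (𝓝 1) (𝓝 u) := by
      simpa using (continuous_mul_const u).tendsto (1 : G)
    filter_upwards [h4.eventually (hU.mem_nhds hu)] with g hg
    have := h1 _ hg
    simpa using this
  have h5 := eq_zero_of_eventually_eq_zero ρ hf h3 (g₀ * u⁻¹)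
  have h6 : ρ (g₀ * u⁻¹) (ρ u x) = ρ g₀ x := by
    rw [← mul_apply_eq_comp, ← map_mul]
    simp
  rwa [h6] at h5

end PolynomialFunctions
end AdjointComplexity

namespace AdjointComplexity

/-! ### Invariant polynomials of a compact group separate orbits -/

section Averaging

variable {E : Type*} [NormedAddCommGroup E] [NormedSpace ℝ E] [FiniteDimensional ℝ E]
  {K : Type*} [Group K]

/-- The polynomial functions that are invariant under a representation. -/
def invPolyAlg (ρ : K →* (E →L[ℝ] E)) : Subalgebra ℝ (E → ℝ) where
  carrier := {q | q ∈ polyAlg E ∧ ∀ k z, q (ρ k z) = q z}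
  mul_mem' := fun {a b} ha hb => ⟨(polyAlg E).mul_mem ha.1 hb.1, fun k z => by
    simp [ha.2, hb.2]⟩
  add_mem' := fun {a b} ha hb => ⟨(polyAlg E).add_mem ha.1 hb.1, fun k z => by
    simp [ha.2, hb.2]⟩
  algebraMap_mem' := fun c => ⟨(polyAlg E).algebraMap_mem c, fun _ _ => rfl⟩

variable [TopologicalSpace K] [IsTopologicalGroup K] [CompactSpace K]

/-- Averaging a polynomial function over a compact group. -/
theorem exists_average (ρ : K →* (E →L[ℝ] E)) (hρ : Continuous ρ)
    {q : E → ℝ} (hq : q ∈ polyAlg E) :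
    ∃ r ∈ invPolyAlg ρ, ∀ z a b, (∀ k, a ≤ q (ρ k z) ∧ q (ρ k z) ≤ b) → a ≤ r z ∧ r z ≤ b := by
  let _ : MeasurableSpace K := borel K
  have : BorelSpace K := ⟨rfl⟩
  let μ : MeasureTheory.Measure K := MeasureTheory.Measure.haarMeasure ⊤
  have : MeasureTheory.IsProbabilityMeasure μ :=
    ⟨MeasureTheory.Measure.haarMeasure_self (K₀ := (⊤ : TopologicalSpace.PositiveCompacts K))⟩
  obtain ⟨n, c, r, hc, hr, h⟩ := exists_expansion_of_mem_polyAlg hq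
  have hcont : ∀ i, Continuous fun k : K => c i (ρ k⁻¹) := fun i =>
    (hc i).comp (hρ.comp continuous_inv)
  have hint : ∀ {f : K → ℝ}, Continuous f → MeasureTheory.Integrable f μ := fun hf =>
    hf.integrable_of_hasCompactSupport (HasCompactSupport.of_compactSpace _)
  have hqc : ∀ z, Continuous fun k : K => q (ρ k⁻¹ z) := fun z => by
    simp only [h]
    exact continuous_finsetSum _ fun i _ => (hcont i).mul continuous_const
  have hI : (fun z => ∫ k, q (ρ k⁻¹ z) ∂μ) = ∑ i, (∫ k, c i (ρ k⁻¹) ∂μ) • r i := by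
    funext z
    simp only [h, Finset.sum_apply, Pi.smul_apply, smul_eq_mul]
    rw [MeasureTheory.integral_finsetSum (f := fun i k => c i (ρ k⁻¹) * r i z) _ fun i _ =>
      hint ((hcont i).mul continuous_const)]
    exact Finset.sum_congr rfl fun i _ => MeasureTheory.integral_mul_const _ _
  -- With `k⁻¹` in place of `k`, left invariance of Haar measure under `k ↦ g k` gives invariance of
  -- the average.
  refine ⟨fun z => ∫ k, q (ρ k⁻¹ z) ∂μ, ⟨?_, fun g z => ?_⟩, fun z a b hab => ⟨?_, ?_⟩⟩
  · rw [hI]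
    exact Subalgebra.sum_mem _ fun i _ => (polyAlg E).smul_mem (hr i) _
  · change ∫ k, q (ρ k⁻¹ (ρ g z)) ∂μ = ∫ k, q (ρ k⁻¹ z) ∂μ
    rw [← MeasureTheory.integral_mul_left_eq_self (μ := μ) (fun k => q (ρ k⁻¹ (ρ g z))) g]
    refine congrArg _ (funext fun k => ?_)
    rw [← mul_apply_eq_comp, ← map_mul]
    simp
  · have := MeasureTheory.integral_mono (μ := μ) (f := fun _ => a) (g := fun k => q (ρ k⁻¹ z))
      (MeasureTheory.integrable_const a) (hint (hqc z)) fun k => (hab k⁻¹).1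
    simpa using this
  · have := MeasureTheory.integral_mono (μ := μ) (g := fun _ => b) (f := fun k => q (ρ k⁻¹ z))
      (hint (hqc z)) (MeasureTheory.integrable_const b) fun k => (hab k⁻¹).2
    simpa using this

/-- Stone–Weierstrass: linear functionals already separate points. -/
theorem exists_polyAlg_near {S : Set E} (hS : IsCompact S) (f : C(E, ℝ)) {ε : ℝ} (hε : 0 < ε) :
    ∃ q ∈ polyAlg E, ∀ z ∈ S, |q z - f z| < ε := by
  let A : Subalgebra ℝ C(E, ℝ) :=
    Algebra.adjoin ℝ (Set.range fun l : E →L[ℝ] ℝ => (⟨l, l.continuous⟩ : C(E, ℝ)))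
  have hsep : A.SeparatesPoints := by
    intro y w hyw
    obtain ⟨l, hl⟩ := SeparatingDual.exists_separating_of_ne (R := ℝ) hyw
    exact ⟨l, ⟨⟨l, l.continuous⟩, Algebra.subset_adjoin ⟨l, rfl⟩, rfl⟩, hl⟩
  obtain ⟨g, hgA, hg⟩ :=
    ContinuousMap.exists_mem_subalgebra_near_continuous_of_isCompact_of_separatesPoints hsep f hS hε
  have hle : A ≤ (polyAlg E).comap (ContinuousMap.coeFnAlgHom ℝ) := by
    refine Algebra.adjoin_le ?_
    rintro _ ⟨l, rfl⟩
    exact linear_mem_polyAlg l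
  refine ⟨g, hle hgA, fun z hz => ?_⟩
  simpa using hg z hz

/-- Invariant polynomial functions separate the orbits of a compact group. -/
theorem exists_eq_of_invPolyAlg (ρ : K →* (E →L[ℝ] E)) (hρ : Continuous ρ) {y w : E}
    (h : ∀ q ∈ invPolyAlg ρ, q y = q w) : ∃ k, w = ρ k y := by
  by_contra hne
  push Not at hne
  have hc : ∀ z, IsCompact (Set.range fun k => ρ k z) := fun z =>
    isCompact_range (hρ.clm_apply continuous_const)
  have hd : Disjoint (Set.range fun k => ρ k y) (Set.range fun k => ρ k w) := by
    rw [Set.disjoint_left]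
    rintro _ ⟨a, rfl⟩ ⟨b, hb⟩
    refine hne (b⁻¹ * a) ?_
    simp only at hb
    rw [map_mul, mul_apply_eq_comp, ← hb, ← mul_apply_eq_comp, ← map_mul]
    simp
  obtain ⟨f, hf0, hf1, -⟩ := exists_continuous_zero_one_of_isClosed (hc y).isClosed
    (hc w).isClosed hd
  -- `f` is `0` on one orbit and `1` on the other. With error `1/4` the bounds survive averaging:
  -- the invariant polynomial is at most `1/4` at `y` and at least `3/4` at `w`.
  obtain ⟨q, hq, hqf⟩ := exists_polyAlg_near ((hc y).union (hc w)) f (ε := 1 / 4) (by norm_num)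
  obtain ⟨r, hr, hb⟩ := exists_average ρ hρ hq
  have h1 := hb y (-1 / 4) (1 / 4) fun k => by
    have h2 := hqf (ρ k y) (Or.inl ⟨k, rfl⟩)
    have h3 : f (ρ k y) = 0 := hf0 ⟨k, rfl⟩
    rw [h3, abs_lt] at h2
    constructor <;> linarith
  have h4 := hb w (3 / 4) (5 / 4) fun k => by
    have h2 := hqf (ρ k w) (Or.inr ⟨k, rfl⟩)
    have h3 : f (ρ k w) = 1 := hf1 ⟨k, rfl⟩
    rw [h3, abs_lt] at h2
    constructor <;> linarith
  have := h r hr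
  linarith [h1.2, h4.1]

end Averaging
end AdjointComplexity

namespace AdjointComplexity

/-! ### Curves inside an orbit of a compact group are tangent to it -/

section TangentCone

variable {L : Type*} [NormedAddCommGroup L] [NormedSpace ℝ L]
  {W : Type*} [NormedAddCommGroup W] [NormedSpace ℝ W]

/-- An integral curve of a vector field stays in the level sets of the functions that are
annihilated by the field. -/
theorem exists_integralCurve [CompleteSpace L] {X : L → L} (hX : ContDiffAt ℝ 1 X 0) :
    ∃ c : ℝ → L, c 0 = 0 ∧ HasDerivAt c (X 0) 0 ∧ ∀ N ∈ 𝓝 (0 : L), ∀ᶠ t in 𝓝 (0 : ℝ),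
      ∀ f : L → W, (∀ u ∈ N, DifferentiableAt ℝ f u ∧ fderiv ℝ f u (X u) = 0) → f (c t) = f 0 := by
  obtain ⟨c, hc0, ε, hε, hc⟩ :=
    hX.exists_forall_mem_closedBall_exists_eq_forall_mem_Ioo_hasDerivAt₀ 0
  simp only [zero_sub, zero_add] at hc
  have h0 : HasDerivAt c (X 0) 0 := by
    have := hc 0 ⟨by linarith, hε⟩
    rwa [hc0] at this
  refine ⟨c, hc0, h0, fun N hN => ?_⟩
  have h1 : ∀ᶠ t in 𝓝 (0 : ℝ), c t ∈ N ∧ t ∈ Set.Ioo (-ε) ε := by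
    refine (h0.continuousAt.eventually ?_).and (Ioo_mem_nhds (by linarith) hε)
    rw [hc0]
    exact hN
  obtain ⟨δ, hδ, h2⟩ := Metric.eventually_nhds_iff_ball.1 h1
  -- The interval is fixed before `f`, so it serves all functions at once; later `f` runs through
  -- every invariant polynomial.
  filter_upwards [Metric.ball_mem_nhds 0 hδ] with t ht f hf
  have h3 : ∀ s ∈ Metric.ball (0 : ℝ) δ, HasDerivAt (fun s => f (c s)) 0 s := by
    intro s hs
    obtain ⟨h4, h5⟩ := h2 s hs
    have h6 := (hf _ h4).1.hasFDerivAt.comp_hasDerivAt s (hc s h5)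
    rwa [(hf _ h4).2] at h6
  have h7 := (convex_ball (0 : ℝ) δ).is_const_of_fderivWithin_eq_zero
    (f := fun s => f (c s)) (𝕜 := ℝ)
    (fun s hs => (h3 s hs).differentiableAt.differentiableWithinAt)
    (fun s hs => by
      rw [fderivWithin_of_isOpen Metric.isOpen_ball hs]
      have h8 := (h3 s hs).hasFDerivAt.fderiv
      rw [h8]
      ext
      simp) ht (Metric.mem_ball_self hδ)
  rw [h7, hc0]

/-- The derivative at `0` of right translation `b ↦ m (u, b)` in local coordinates. -/
noncomputable def rightTranslation (m : L × L → L) (u : L) : L →L[ℝ] L :=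
  (fderiv ℝ m (u, 0)).comp (ContinuousLinearMap.inr ℝ L L)

variable {G : Type*} [TopologicalSpace G] [Group G] {loc : L → G} {m : L × L → L}

theorem contDiffAt_rightTranslation (h : IsSmoothParam loc m) :
    ContDiffAt ℝ ∞ (rightTranslation m) 0 := by
  have h1 : ContDiffAt ℝ ∞ (fun u : L => fderiv ℝ m (u, 0)) 0 :=
    ContDiffAt.comp (0 : L) (g := fderiv ℝ m) (f := fun u : L => (u, (0 : L)))
      (h.smooth.fderiv_right (by simp)) (contDiffAt_id.prodMk contDiffAt_const)
  exact h1.clm_comp contDiffAt_const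

theorem eventually_hasFDerivAt_rightTranslation (h : IsSmoothParam loc m) :
    ∀ᶠ u in 𝓝 (0 : L), HasFDerivAt (fun b => m (u, b)) (rightTranslation m u) 0 := by
  have h1 : ∀ᶠ p in 𝓝 (0 : L × L), DifferentiableAt ℝ m p := by
    have h2 : ContDiffAt ℝ 1 m 0 := h.smooth.of_le (by simp)
    exact (h2.eventually (by simp)).mono fun p hp => hp.differentiableAt (by simp)
  have h3 : Filter.Tendsto (fun u : L => (u, (0 : L))) (𝓝 0) (𝓝 (0, 0)) :=
    (continuous_id.prodMk continuous_const).tendsto 0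
  filter_upwards [h3.eventually h1] with u hu
  exact hu.hasFDerivAt.comp (0 : L) (f := fun b : L => (u, b)) (hasFDerivAt_prodMk_right u 0)

theorem rightTranslation_zero (h : IsSmoothParam loc m) :
    rightTranslation m 0 = ContinuousLinearMap.id ℝ L := by
  have h1 := (eventually_hasFDerivAt_rightTranslation h).self_of_nhds
  have h2 : (fun b => m (0, b)) =ᶠ[𝓝 0] fun b => b := h.right
  exact h1.unique ((hasFDerivAt_id (0 : L)).congr_of_eventuallyEq h2)

theorem hasFDerivAt_mul_zero (h : IsSmoothParam loc m) :
    HasFDerivAt m (ContinuousLinearMap.fst ℝ L L + ContinuousLinearMap.snd ℝ L L) 0 := by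
  have h0 : HasFDerivAt m (fderiv ℝ m 0) (0, 0) := (h.smooth.differentiableAt (by simp)).hasFDerivAt
  have h1 : (fderiv ℝ m 0).comp (ContinuousLinearMap.inl ℝ L L) = ContinuousLinearMap.id ℝ L := by
    have h2 := h0.comp (0 : L) (f := fun u : L => (u, (0 : L))) (hasFDerivAt_prodMk_left 0 0)
    have h3 : (fun u => m (u, 0)) =ᶠ[𝓝 0] fun b => b := h.left
    exact h2.unique ((hasFDerivAt_id (0 : L)).congr_of_eventuallyEq h3)
  have h2 : (fderiv ℝ m 0).comp (ContinuousLinearMap.inr ℝ L L) = ContinuousLinearMap.id ℝ L :=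
    rightTranslation_zero h
  have h3 : fderiv ℝ m 0 = ContinuousLinearMap.fst ℝ L L + ContinuousLinearMap.snd ℝ L L := by
    ext x
    · simpa using congrArg (fun T => T x) h1
    · simpa using congrArg (fun T => T x) h2
  rw [← h3]
  exact h0

variable {φ : L → W} {R : L → W →L[ℝ] W}

/-- Differentiate the equivariance `φ(u b) = R_u φ(b)` in `b` at the identity. -/
theorem eventually_fderiv_comp_rightTranslation (h : IsSmoothParam loc m)
    (hφ : ContDiffAt ℝ ∞ φ 0) (hR : ∀ᶠ p in 𝓝 (0 : L × L), φ (m p) = R p.1 (φ p.2)) :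
    ∀ᶠ u in 𝓝 (0 : L), DifferentiableAt ℝ φ u ∧
      (fderiv ℝ φ u).comp (rightTranslation m u) = (R u).comp (fderiv ℝ φ 0) := by
  have h1 : ∀ᶠ u in 𝓝 (0 : L), DifferentiableAt ℝ φ u := by
    have h2 : ContDiffAt ℝ 1 φ 0 := hφ.of_le (by simp)
    exact (h2.eventually (by simp)).mono fun p hp => hp.differentiableAt (by simp)
  have h3 := Filter.Eventually.curry_nhds (x := (0 : L)) (y := (0 : L)) hR
  filter_upwards [h1, h3, h.left, eventually_hasFDerivAt_rightTranslation h] with u hu h4 h5 h6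
  refine ⟨hu, ?_⟩
  have h7 : HasFDerivAt φ (fderiv ℝ φ u) (m (u, 0)) := by
    rw [h5]
    exact hu.hasFDerivAt
  have h8 := h7.comp (0 : L) (f := fun b => m (u, b)) h6
  have h9 := (R u).hasFDerivAt.comp (0 : L) (f := φ) h1.self_of_nhds.hasFDerivAt
  exact h8.unique (h9.congr_of_eventuallyEq h4)

/-- The left invariant field of `v` is annihilated by `φ`, so its integral curve `c` stays in the
fibre of `φ` over `φ 0`. If `u` points nearly along `v`, the product of `u` and `c(-‖u‖)` is about
`u - ‖u‖ v`: it has the same image as `u` and is shorter. -/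
theorem exists_shorter_of_tendsto [CompleteSpace L] (h : IsSmoothParam loc m)
    (hφ : ContDiffAt ℝ ∞ φ 0)
    (hR : ∀ᶠ p in 𝓝 (0 : L × L), φ (m p) = R p.1 (φ p.2)) {v : L} (hv : fderiv ℝ φ 0 v = 0) :
    ∀ᶠ u in 𝓝 (0 : L), u ≠ 0 → ‖u - ‖u‖ • v‖ ≤ ‖u‖ / 4 → ∃ u', ‖u'‖ < ‖u‖ ∧ φ u' = φ u := by
  have hX : ContDiffAt ℝ 1 (fun u => rightTranslation m u v) 0 :=
    ((contDiffAt_rightTranslation h).of_le (by simp)).clm_apply contDiffAt_const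
  obtain ⟨c, hc0, hc, hlev⟩ := exists_integralCurve (W := W) hX
  simp only [rightTranslation_zero h, ContinuousLinearMap.id_apply] at hc
  have h1 : ∀ᶠ t in 𝓝 (0 : ℝ), φ (c t) = φ 0 := by
    have h2 := hlev _ (eventually_fderiv_comp_rightTranslation h hφ hR)
    filter_upwards [h2] with t ht
    refine ht φ fun u hu => ⟨hu.1, ?_⟩
    have h3 := congrArg (fun T => T v) hu.2
    simpa [hv] using h3
  have hn : Filter.Tendsto (fun u : L => -‖u‖) (𝓝 0) (𝓝 0) := by
    have : Continuous fun u : L => -‖u‖ := by fun_prop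
    simpa using this.tendsto 0
  have hct : Filter.Tendsto (fun u : L => c (-‖u‖)) (𝓝 0) (𝓝 0) := by
    have h3 := hc.continuousAt.tendsto.comp hn
    rwa [hc0] at h3
  have hp : Filter.Tendsto (fun u : L => (u, c (-‖u‖))) (𝓝 0) (𝓝 0) :=
    Filter.tendsto_id.prodMk_nhds hct
  have hco : (fun u : L => c (-‖u‖) + ‖u‖ • v) =o[𝓝 0] fun u : L => u := by
    have h3 : (fun u : L => c (-‖u‖) + ‖u‖ • v) =o[𝓝 0] fun u : L => -‖u‖ :=
      ((hasDerivAt_iff_isLittleO.1 hc).comp_tendsto hn).congr (fun u => by simp [hc0])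
        fun u => by simp
    have h4 : (fun u : L => -‖u‖) =O[𝓝 0] fun u : L => u :=
      Asymptotics.IsBigO.of_bound 1 (Filter.Eventually.of_forall fun u => by simp)
    exact h3.trans_isBigO h4
  have hcO : (fun u : L => (u, c (-‖u‖))) =O[𝓝 0] fun u : L => u := by
    refine Asymptotics.IsBigO.prod_left (Asymptotics.isBigO_refl _ _) ?_
    have h4 : (fun u : L => c (-‖u‖)) = fun u => (c (-‖u‖) + ‖u‖ • v) - ‖u‖ • v := by
      funext u
      simp
    rw [h4]
    refine hco.isBigO.sub ?_
    refine Asymptotics.IsBigO.of_bound ‖v‖ (Filter.Eventually.of_forall fun u => ?_)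
    rw [norm_smul, norm_norm, mul_comm]
  have hm0 : m 0 = 0 := h.left.self_of_nhds
  have hmo : (fun u : L => m (u, c (-‖u‖)) - (u + c (-‖u‖))) =o[𝓝 0] fun u : L => u := by
    have h3 : (fun u : L => m (u, c (-‖u‖)) - (u + c (-‖u‖))) =o[𝓝 0]
        fun u : L => (u, c (-‖u‖)) :=
      ((hasFDerivAt_mul_zero h).isLittleO.comp_tendsto hp).congr (fun u => by simp [hm0])
        fun u => by simp
    exact h3.trans_isBigO hcO
  have htot : (fun u : L => m (u, c (-‖u‖)) - (u - ‖u‖ • v)) =o[𝓝 0] fun u : L => u := by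
    refine (hmo.add hco).congr_left fun u => ?_
    abel
  have hR1 : ∀ᶠ u in 𝓝 (0 : L), φ (m (u, 0)) = R u (φ 0) := by
    have : Filter.Tendsto (fun u : L => (u, (0 : L))) (𝓝 0) (𝓝 0) :=
      (continuous_id.prodMk continuous_const).tendsto 0
    exact this.eventually hR
  -- A quarter of `‖u‖` for the first order error plus a quarter for the distance to `‖u‖ v` stays
  -- below `‖u‖`.
  filter_upwards [htot.bound (c := 1 / 4) (by norm_num), hp.eventually hR, hR1, h.left,
    hn.eventually h1] with u h3 h4 h5 h6 h7 hu h8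
  refine ⟨m (u, c (-‖u‖)), ?_, ?_⟩
  · have hpos : 0 < ‖u‖ := norm_pos_iff.2 hu
    have h9 := norm_add_le (m (u, c (-‖u‖)) - (u - ‖u‖ • v)) (u - ‖u‖ • v)
    rw [sub_add_cancel] at h9
    linarith
  · rw [h4, h7, ← h5, h6]

/-- Compactness of the unit sphere makes the previous lemma uniform: near a direction in the kernel
of the differential `D` shortening is possible, and near any other direction `‖D u‖ ≤ ε ‖u‖` fails
for small `ε`. -/
theorem exists_shorter [FiniteDimensional ℝ L] (h : IsSmoothParam loc m)
    (hφ : ContDiffAt ℝ ∞ φ 0) (hR : ∀ᶠ p in 𝓝 (0 : L × L), φ (m p) = R p.1 (φ p.2)) :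
    ∃ ε > (0 : ℝ), ∀ᶠ u in 𝓝 (0 : L), u ≠ 0 → ‖fderiv ℝ φ 0 u‖ ≤ ε * ‖u‖ →
      ∃ u', ‖u'‖ < ‖u‖ ∧ φ u' = φ u := by
  have : CompleteSpace L := FiniteDimensional.complete ℝ L
  have : ProperSpace L := FiniteDimensional.proper ℝ L
  set D := fderiv ℝ φ 0
  have key : ∃ ε > (0 : ℝ), ∀ᶠ u in 𝓝 (0 : L), u ≠ 0 → ‖u‖⁻¹ • u ∈ Metric.sphere (0 : L) 1 →
      ‖D u‖ ≤ ε * ‖u‖ → ∃ u', ‖u'‖ < ‖u‖ ∧ φ u' = φ u := by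
    refine (isCompact_sphere (0 : L) 1).induction_on (p := fun A => ∃ ε > (0 : ℝ), ∀ᶠ u in 𝓝 (0 : L),
      u ≠ 0 → ‖u‖⁻¹ • u ∈ A → ‖D u‖ ≤ ε * ‖u‖ → ∃ u', ‖u'‖ < ‖u‖ ∧ φ u' = φ u) ?_ ?_ ?_ ?_
    · exact ⟨1, one_pos, Filter.Eventually.of_forall fun u _ h => h.elim⟩
    · rintro A B hAB ⟨ε, hε, hB⟩
      exact ⟨ε, hε, hB.mono fun u hu h1 h2 => hu h1 (hAB h2)⟩
    · rintro A B ⟨ε, hε, hA⟩ ⟨δ, hδ, hB⟩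
      refine ⟨min ε δ, lt_min hε hδ, ?_⟩
      filter_upwards [hA, hB] with u h1 h2 h3 h4 h5
      rcases h4 with h4 | h4
      · exact h1 h3 h4 (h5.trans (by gcongr; exact min_le_left _ _))
      · exact h2 h3 h4 (h5.trans (by gcongr; exact min_le_right _ _))
    · intro v _
      by_cases hv : D v = 0
      · refine ⟨Metric.ball v (1 / 4), mem_nhdsWithin_of_mem_nhds
          (Metric.ball_mem_nhds _ (by norm_num)), 1, one_pos, ?_⟩
        filter_upwards [exists_shorter_of_tendsto h hφ hR hv] with u h1 h2 h3 _
        refine h1 h2 ?_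
        have h4 : u - ‖u‖ • v = ‖u‖ • (‖u‖⁻¹ • u - v) := by
          rw [smul_sub, smul_smul, mul_inv_cancel₀ (norm_ne_zero_iff.2 h2), one_smul]
        rw [Metric.mem_ball, dist_eq_norm] at h3
        rw [h4, norm_smul, norm_norm]
        nlinarith [norm_nonneg u]
      · have hpos : 0 < ‖D v‖ := norm_pos_iff.2 hv
        refine ⟨{w | ‖D v‖ / 2 < ‖D w‖}, mem_nhdsWithin_of_mem_nhds ?_, ‖D v‖ / 2,
          by positivity, ?_⟩
        · have : Continuous fun w => ‖D w‖ := by fun_prop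
          exact this.continuousAt.eventually (lt_mem_nhds (by linarith))
        · refine Filter.Eventually.of_forall fun u h1 h2 h3 => ?_
          exfalso
          have h4 : ‖D v‖ / 2 < ‖D (‖u‖⁻¹ • u)‖ := h2
          have h5 : 0 < ‖u‖ := norm_pos_iff.2 h1
          rw [map_smul, norm_smul, norm_inv, norm_norm, lt_inv_mul_iff₀ h5] at h4
          linarith
  obtain ⟨ε, hε, h1⟩ := key
  refine ⟨ε, hε, h1.mono fun u hu h2 => hu h2 ?_⟩
  simp [norm_smul, norm_ne_zero_iff.2 h2]

/-- Orbit points close to `y` come from group elements close to `1`. For an open `V` around `1`, the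
complement `C` of `V·Stab(y)` is compact, and its image in the orbit is a closed set missing `y`. -/
theorem eventually_exists_loc_mem [IsTopologicalGroup G] [CompactSpace G]
    (h : IsSmoothParam loc m) (ρ : G →* (W →L[ℝ] W)) (hρ : Continuous ρ) (y : W)
    {N : Set L} (hN : N ∈ 𝓝 (0 : L)) :
    ∀ᶠ w in 𝓝 y, (∃ k, w = ρ k y) → ∃ u ∈ N, ρ (loc u) y = w := by
  have hN1 : loc '' N ∈ 𝓝 (1 : G) := by
    rw [← h.map_nhds]
    exact Filter.image_mem_map hN
  obtain ⟨V, hVN, hVo, hV1⟩ := mem_nhds_iff.1 hN1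
  let C : Set G := {k | ∀ n ∈ V, ρ k y ≠ ρ n y}
  have hC : IsClosed C := by
    rw [← isOpen_compl_iff, isOpen_iff_mem_nhds]
    intro k hk
    have hk' : ∃ n ∈ V, ρ k y = ρ n y := by
      simpa [C] using hk
    obtain ⟨n, hn, hkn⟩ := hk'
    have hinv : ρ n⁻¹ (ρ n y) = y := by
      rw [← mul_apply_eq_comp, ← map_mul]
      simp
    have h1 : Filter.Tendsto (fun a : G => a * (k⁻¹ * n)) (𝓝 k) (𝓝 n) := by
      simpa using (continuous_mul_const (k⁻¹ * n)).tendsto k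
    filter_upwards [h1.eventually (hVo.mem_nhds hn)] with a ha hac
    refine hac _ ha ?_
    have hinvk : ρ k⁻¹ (ρ k y) = y := by
      rw [← mul_apply_eq_comp, ← map_mul]
      simp
    rw [map_mul, map_mul, mul_apply_eq_comp, mul_apply_eq_comp, ← hkn, hinvk]
  have hcl : IsClosed ((fun k => ρ k y) '' C) :=
    (hC.isCompact.image (hρ.clm_apply continuous_const)).isClosed
  have hy : y ∉ (fun k => ρ k y) '' C := by
    rintro ⟨k, hk, hky⟩
    exact hk 1 hV1 (by simpa using hky)
  filter_upwards [hcl.isOpen_compl.mem_nhds hy] with w hw ⟨k, hk⟩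
  have hkC : k ∉ C := fun hkC => hw ⟨k, hkC, hk.symm⟩
  have hk' : ∃ n ∈ V, ρ k y = ρ n y := by
    simpa [C] using hkC
  obtain ⟨n, hn, hkn⟩ := hk'
  obtain ⟨u, hu, rfl⟩ := hVN hn
  exact ⟨u, hu, by rw [hk, hkn]⟩

/-- Take a preimage `u` of `w` of least norm. It cannot be shortened, so `‖D u‖ > ε ‖u‖`; since `w -
y` differs from `D u` by at most `(ε/2) ‖u‖`, it follows that `‖u‖ ≤ (2/ε) ‖w - y‖`. -/
theorem exists_lipschitz_section [FiniteDimensional ℝ L] [IsTopologicalGroup G] [CompactSpace G]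
    (h : IsSmoothParam loc m) (ρ : G →* (W →L[ℝ] W)) (hρ : Continuous ρ) (y : W)
    (hφ : ContDiffAt ℝ ∞ (fun u => ρ (loc u) y) 0) :
    ∃ C : ℝ, ∀ᶠ w in 𝓝 y, (∃ k, w = ρ k y) → ∃ u, ρ (loc u) y = w ∧ ‖u‖ ≤ C * ‖w - y‖ := by
  have : ProperSpace L := FiniteDimensional.proper ℝ L
  set φ : L → W := fun u => ρ (loc u) y with hφdef
  have hR : ∀ᶠ p in 𝓝 (0 : L × L), φ (m p) = ρ (loc p.1) (φ p.2) := by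
    filter_upwards [h.mul] with p hp
    simp only [hφdef, hp, map_mul, mul_apply_eq_comp]
  have hφ0 : φ 0 = y := by simp [hφdef, h.zero]
  obtain ⟨ε, hε, hsh⟩ := exists_shorter (R := fun u => ρ (loc u)) h hφ hR
  have hlin : ∀ᶠ u in 𝓝 (0 : L), ‖φ u - y - fderiv ℝ φ 0 u‖ ≤ ε / 2 * ‖u‖ := by
    have h1 := (hφ.differentiableAt (by simp)).hasFDerivAt.isLittleO.bound
      (c := ε / 2) (by positivity)
    simpa [hφ0] using h1
  have hct : ∀ᶠ u in 𝓝 (0 : L), ContinuousAt φ u := by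
    have h2 : ContDiffAt ℝ 1 φ 0 := hφ.of_le (by simp)
    exact (h2.eventually (by simp)).mono fun p hp => hp.continuousAt
  obtain ⟨r, hr, hball⟩ := Metric.nhds_basis_closedBall.eventually_iff.1 (hsh.and (hlin.and hct))
  refine ⟨2 / ε, ?_⟩
  filter_upwards [eventually_exists_loc_mem h ρ hρ y (Metric.closedBall_mem_nhds 0 hr)]
    with w hw hk
  have hcont : ContinuousOn φ (Metric.closedBall 0 r) := fun u hu =>
    (hball hu).2.2.continuousWithinAt
  have hcpt : IsCompact (Metric.closedBall (0 : L) r ∩ φ ⁻¹' {w}) :=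
    (isCompact_closedBall (0 : L) r).of_isClosed_subset
      (hcont.preimage_isClosed_of_isClosed Metric.isClosed_closedBall isClosed_singleton)
      Set.inter_subset_left
  obtain ⟨u₀, hu₀, hφu₀⟩ := hw hk
  obtain ⟨u, ⟨hu, hφu⟩, hmin⟩ := hcpt.exists_isMinOn ⟨u₀, hu₀, hφu₀⟩ continuous_norm.continuousOn
  have hφu' : φ u = w := hφu
  refine ⟨u, hφu', ?_⟩
  by_cases hu0 : u = 0
  · rw [hu0, norm_zero]
    positivity
  obtain ⟨h1, h2, -⟩ := hball hu
  have h3 : ε * ‖u‖ < ‖fderiv ℝ φ 0 u‖ := by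
    by_contra hle
    obtain ⟨u', hlt, hu'⟩ := h1 hu0 (not_lt.1 hle)
    have h4 : ‖u‖ ≤ ‖u'‖ := hmin ⟨by
      rw [mem_closedBall_zero_iff] at hu ⊢
      linarith, hu'.trans hφu'⟩
    linarith
  rw [hφu'] at h2
  have h5 := norm_sub_norm_le (fderiv ℝ φ 0 u) (w - y)
  rw [norm_sub_rev (fderiv ℝ φ 0 u)] at h5
  have h6 : ε / 2 * ‖u‖ ≤ ‖w - y‖ := by linarith
  rw [div_mul_eq_mul_div, le_div_iff₀ hε]
  linarith

/-- The velocity of a differentiable curve contained in an orbit of a compact Lie group belongs to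
the tangent space of the orbit. -/
theorem velocity_mem_range_of_mem_orbit [FiniteDimensional ℝ L] [IsTopologicalGroup G]
    [CompactSpace G] [FiniteDimensional ℝ W] (h : IsSmoothParam loc m) (ρ : G →* (W →L[ℝ] W))
    (hρ : Continuous ρ) {y v : W} (hφ : ContDiffAt ℝ ∞ (fun u => ρ (loc u) y) 0) {s : ℝ → W}
    (hs : HasDerivAt s v 0) (hs0 : s 0 = y) (hmem : ∀ᶠ t in 𝓝 (0 : ℝ), ∃ k, s t = ρ k y) :
    v ∈ LinearMap.range (fderiv ℝ (fun u => ρ (loc u) y) 0).toLinearMap := by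
  set φ : L → W := fun u => ρ (loc u) y with hφdef
  have hφ0 : φ 0 = y := by simp [hφdef, h.zero]
  obtain ⟨C, hC⟩ := exists_lipschitz_section h ρ hρ y hφ
  have hst : Filter.Tendsto s (𝓝 0) (𝓝 y) := hs0 ▸ hs.continuousAt.tendsto
  have h1 : ∀ᶠ t in 𝓝 (0 : ℝ), ∃ u, φ u = s t ∧ ‖u‖ ≤ C * ‖s t - y‖ := by
    filter_upwards [hst.eventually hC, hmem] with t ht hk using ht hk
  obtain ⟨u, hu⟩ := h1.choice
  have hsO : (fun t => s t - y) =O[𝓝 0] fun t : ℝ => t := by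
    simpa [hs0] using hs.isBigO_sub
  have huO : u =O[𝓝 0] fun t : ℝ => t := by
    refine Asymptotics.IsBigO.trans ?_ hsO
    exact Asymptotics.IsBigO.of_bound C (hu.mono fun t ht => ht.2)
  have hut : Filter.Tendsto u (𝓝 0) (𝓝 0) := huO.trans_tendsto Filter.tendsto_id
  set D := fderiv ℝ φ 0
  have hDo : (fun t => s t - y - D (u t)) =o[𝓝 0] fun t : ℝ => t := by
    have h2 := (hφ.differentiableAt (by simp)).hasFDerivAt.isLittleO.comp_tendsto hut
    simp only [Function.comp_def, sub_zero, hφ0] at h2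
    refine (h2.trans_isBigO huO).congr' ?_ Filter.EventuallyEq.rfl
    filter_upwards [hu] with t ht
    rw [ht.1]
  have hvo : (fun t => D (u t) - t • v) =o[𝓝 0] fun t : ℝ => t := by
    have h2 := hasDerivAt_iff_isLittleO.1 hs
    simp only [sub_zero, hs0] at h2
    refine (h2.sub hDo).congr_left fun t => ?_
    abel
  -- The quotients `u(t)/t` need not converge, but their images under `D` do, and the range of `D`
  -- is closed.
  have hlim : Filter.Tendsto (fun t : ℝ => D (t⁻¹ • u t)) (𝓝[≠] 0) (𝓝 v) := by
    have h2 := (hvo.mono (nhdsWithin_le_nhds (s := {0}ᶜ))).tendsto_inv_smul_nhds_zero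
    have h3 := h2.add_const v
    rw [zero_add] at h3
    refine h3.congr' ?_
    filter_upwards [self_mem_nhdsWithin] with t ht
    have ht' : t ≠ 0 := ht
    rw [map_smul, smul_sub, smul_smul, inv_mul_cancel₀ ht', one_smul, sub_add_cancel]
  exact (Submodule.closed_of_finiteDimensional (LinearMap.range D.toLinearMap)).mem_of_tendsto hlim
    (Filter.Eventually.of_forall fun t => ⟨_, rfl⟩)

end TangentCone
end AdjointComplexity

namespace AdjointComplexity

/-! ### Dual families and smooth sections of kernels -/

section DualFamilies

variable {E : Type*} [NormedAddCommGroup E] [NormedSpace ℝ E]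

theorem exists_dual_family {r : ℕ} {l : Fin r → E →L[ℝ] ℝ} (hl : LinearIndependent ℝ l) :
    ∃ ξ : Fin r → E, ∀ i j, l i (ξ j) = if i = j then 1 else 0 := by
  let T : E →ₗ[ℝ] Fin r → ℝ := LinearMap.pi fun i => (l i).toLinearMap
  have hT : LinearMap.range T = ⊤ := by
    by_contra hne
    obtain ⟨g, hg, hle⟩ := Submodule.exists_le_ker_of_lt_top _ (lt_top_iff_ne_top.2 hne)
    apply hg
    have h0 : ∑ i, g (Pi.single i 1) • l i = 0 := by
      ext z
      have h1 : g (T z) = 0 := hle ⟨z, rfl⟩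
      rw [LinearMap.pi_apply_eq_sum_univ] at h1
      simp only [_root_.sum_apply, _root_.smul_apply, smul_eq_mul,
        _root_.zero_apply]
      rw [← h1]
      refine Finset.sum_congr rfl fun i _ => ?_
      have h2 : (fun j => if i = j then (1 : ℝ) else 0) = Pi.single i 1 := by
        funext j
        simp [Pi.single_apply, eq_comm]
      rw [h2, smul_eq_mul, mul_comm]
      rfl
    have h3 := Fintype.linearIndependent_iff.1 hl _ h0
    refine LinearMap.pi_ext' fun i => LinearMap.ext_ring ?_
    simpa using h3 i
  choose ξ hξ using fun j : Fin r => LinearMap.range_eq_top.1 hT (Pi.single j 1)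
  refine ⟨ξ, fun i j => ?_⟩
  have := congrFun (hξ j) i
  rw [Pi.single_apply] at this
  exact this

theorem linearIndependent_of_det_ne_zero {r : ℕ} {l : Fin r → E →L[ℝ] ℝ} {ξ : Fin r → E}
    (h : (Matrix.of fun i j => l i (ξ j)).det ≠ 0) : LinearIndependent ℝ l := by
  rw [Fintype.linearIndependent_iff]
  intro g hg
  have h1 : Matrix.vecMul g (Matrix.of fun i j => l i (ξ j)) = 0 := by
    funext j
    have h2 := congrArg (fun T : E →L[ℝ] ℝ => T (ξ j)) hg
    simpa [Matrix.vecMul, dotProduct, _root_.sum_apply] using h2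
  exact congrFun (Matrix.eq_zero_of_vecMul_eq_zero h h1)

/-- A right inverse `s` of `T 0` keeps `T u ∘ s` invertible for small `u`; subtracting `s (T u ∘
s)⁻¹ (T u ξ)` from `ξ` pushes it into the kernel of `T u`. -/
theorem exists_smooth_kernel_section {L : Type*} [NormedAddCommGroup L] [NormedSpace ℝ L]
    {r : ℕ} {T : L → E →L[ℝ] (Fin r → ℝ)} (hT : ContDiffAt ℝ 1 T 0)
    (hli : LinearIndependent ℝ fun i => (ContinuousLinearMap.proj i : (Fin r → ℝ) →L[ℝ] ℝ) ∘L T 0)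
    {ξ : E} (hξ : T 0 ξ = 0) :
    ∃ b : L → E, ContDiffAt ℝ 1 b 0 ∧ b 0 = ξ ∧ ∀ᶠ u in 𝓝 (0 : L), T u (b u) = 0 ∧
      LinearIndependent ℝ fun i => (ContinuousLinearMap.proj i : (Fin r → ℝ) →L[ℝ] ℝ) ∘L T u := by
  obtain ⟨η, hη⟩ := exists_dual_family hli
  let s : (Fin r → ℝ) →L[ℝ] E := ∑ j, (ContinuousLinearMap.proj j).smulRight (η j)
  have hs : ∀ t, s t = ∑ j, t j • η j := fun t => by simp [s]
  have hs0 : (T 0).comp s = 1 := by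
    ext t i
    simp only [ContinuousLinearMap.comp_apply, hs, map_sum, map_smul, Finset.sum_apply,
      Pi.smul_apply, smul_eq_mul]
    have h1 : ∀ j, T 0 (η j) i = if i = j then 1 else 0 := fun j => hη i j
    simp [h1]
  have hQ : ContDiffAt ℝ 1 (fun u => (T u).comp s) 0 := hT.clm_comp contDiffAt_const
  have hinv : ContDiffAt ℝ 1 (fun u => Ring.inverse ((T u).comp s)) 0 := by
    have h1 : ContDiffAt ℝ 1 Ring.inverse ((T 0).comp s) := by
      rw [hs0]
      exact contDiffAt_ringInverse ℝ (1 : ((Fin r → ℝ) →L[ℝ] (Fin r → ℝ))ˣ)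
    exact h1.comp (0 : L) (f := fun u => (T u).comp s) hQ
  have hunit : ∀ᶠ u in 𝓝 (0 : L), IsUnit ((T u).comp s) := by
    refine hQ.continuousAt.eventually (Units.isOpen.mem_nhds ?_)
    change IsUnit ((T 0).comp s)
    rw [hs0]
    exact isUnit_one
  refine ⟨fun u => ξ - s (Ring.inverse ((T u).comp s) (T u ξ)),
    contDiffAt_const.sub (s.contDiff.contDiffAt.comp (0 : L)
      (hinv.clm_apply (hT.clm_apply contDiffAt_const))), by simp [hξ], ?_⟩
  filter_upwards [hunit] with u hu
  refine ⟨?_, ?_⟩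
  · have h1 := congrArg (fun S : (Fin r → ℝ) →L[ℝ] (Fin r → ℝ) => S (T u ξ))
      (Ring.mul_inverse_cancel _ hu)
    have h2 : T u (s (Ring.inverse ((T u).comp s) (T u ξ))) = T u ξ := h1
    rw [map_sub, h2, sub_self]
  · rw [Fintype.linearIndependent_iff]
    intro g hg i
    have h1 := congrArg (fun S : (Fin r → ℝ) →L[ℝ] (Fin r → ℝ) => S (Pi.single i 1))
      (Ring.mul_inverse_cancel _ hu)
    have h2 : T u (s (Ring.inverse ((T u).comp s) (Pi.single i 1))) = Pi.single i 1 := h1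
    have h3 := congrArg (fun S : E →L[ℝ] ℝ => S (s (Ring.inverse ((T u).comp s) (Pi.single i 1)))) hg
    simpa [_root_.sum_apply, h2, Pi.single_apply] using h3

end DualFamilies

/-! ### Vectors annihilated by invariant polynomials -/

section InvariantDifferentials

variable {E : Type*} [NormedAddCommGroup E] [NormedSpace ℝ E] [FiniteDimensional ℝ E]
  {G : Type*} [TopologicalSpace G] [ChartedSpace E G] [Group G] [LieGroup 𝓘(ℝ, E) ∞ G]
  {E' : Type*} [NormedAddCommGroup E'] [NormedSpace ℝ E'] [FiniteDimensional ℝ E']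
  {K : Type*} [TopologicalSpace K] [ChartedSpace E' K] [Group K] [LieGroup 𝓘(ℝ, E') ∞ K]

variable (E G) in
/-- The derivative of `p` along the fundamental vector fields `z ↦ [ξ, z]`. -/
noncomputable def orbitDifferential (p : E → ℝ) (z : E) : E →L[ℝ] ℝ :=
  (fderiv ℝ p z).comp ((brE E G).flip z)

variable (E G) in
theorem fderiv_adE_loc_apply (y : E) :
    fderiv ℝ (fun u => adHom E G (loc E G u) y) 0 = (brE E G).flip y :=
  (hasFDerivAt_adE_loc_apply y).fderiv

theorem contDiffAt_adE_loc_apply (y : E) :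
    ContDiffAt ℝ ∞ (fun u => adHom E G (loc E G u) y) 0 :=
  contDiffAt_adE_loc.clm_apply contDiffAt_const

theorem continuous_adHom_comp {ι : K →* G} (hι : IsLieSubgroup (E := E) (E' := E') ι) :
    Continuous ((adHom E G).comp ι) :=
  (continuous_adE (E := E) (G := G)).comp hι.smooth.continuous

variable [CompactSpace K]

/-- A tangent vector of the orbit of `G` that is annihilated by the `K`-invariant polynomial
functions is tangent to the orbit of `K`, provided that the span of the differentials of the
invariant polynomial functions has locally constant dimension. -/
theorem brE_mem_range_of_orbitDifferential_eq_zero {ι : K →* G}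
    (hι : IsLieSubgroup (E := E) (E' := E') ι) {y : E} {r : ℕ} {p : Fin r → E → ℝ}
    (hp : ∀ i, p i ∈ invPolyAlg ((adHom E G).comp ι))
    (hli : LinearIndependent ℝ fun i => orbitDifferential E G (p i) y)
    (hspan : ∀ g : G, LinearIndependent ℝ (fun i => orbitDifferential E G (p i) (adE E g y)) →
      ∀ q ∈ invPolyAlg ((adHom E G).comp ι), orbitDifferential E G q (adE E g y) ∈
        Submodule.span ℝ (Set.range fun i => orbitDifferential E G (p i) (adE E g y)))
    {ξ : E} (hξ : ∀ i, orbitDifferential E G (p i) y ξ = 0) :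
    ∃ κ : E', brE E G (diffE E E' ι κ) y = brE E G ξ y := by
  have hK := topologicalGroup_of_lieGroup (I := 𝓘(ℝ, E')) (n := ∞) (G := K)
  set φ : E → E := fun u => adHom E G (loc E G u) y with hφdef
  have hφ : ContDiffAt ℝ ∞ φ 0 := contDiffAt_adE_loc_apply y
  have hφ0 : φ 0 = y := by simp [hφdef]
  have hparam := isSmoothParam_loc (E := E) (G := G)
  set m : E × E → E := fun p => colog E (loc E G p.1 * loc E G p.2)
  have hR : ∀ᶠ p in 𝓝 (0 : E × E), φ (m p) = adE E (loc E G p.1) (φ p.2) := by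
    filter_upwards [hparam.mul] with p hp
    simp only [hφdef, hp, map_mul, mul_apply_eq_comp]
    rfl
  -- The differentials of the `p i` at `φ u`, on tangent vectors transported from `y` by `Ad`. A
  -- kernel section `b` of `T` through `ξ` gives a field on the group along which all `p i ∘ φ` are
  -- constant.
  let T : E → E →L[ℝ] (Fin r → ℝ) := fun u => ContinuousLinearMap.pi fun i =>
    ((fderiv ℝ (p i) (φ u)).comp (adE E (loc E G u))).comp ((brE E G).flip y)
  have hTapp : ∀ u b i, T u b i =
      orbitDifferential E G (p i) (φ u) (adE E (loc E G u) b) := by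
    intro u b i
    change fderiv ℝ (p i) (φ u) (adE E (loc E G u) (brE E G b y)) = _
    rw [adE_brE]
    rfl
  have hT : ContDiffAt ℝ 1 T 0 := by
    have h1 : T = fun u => ∑ i, (ContinuousLinearMap.single ℝ (fun _ : Fin r => ℝ) i).comp
        (((fderiv ℝ (p i) (φ u)).comp (adE E (loc E G u))).comp ((brE E G).flip y)) := by
      funext u
      ext b j
      simp [T, _root_.sum_apply, Pi.single_apply]
    rw [h1]
    refine ContDiffAt.sum fun i _ => contDiffAt_const.clm_comp ((ContDiffAt.clm_comp ?_
      (contDiffAt_adE_loc.of_le (by simp))).clm_comp contDiffAt_const)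
    have h2 : ContDiff ℝ 1 (fderiv ℝ (p i)) :=
      (contDiff_of_mem_polyAlg (hp i).1).fderiv_right (by simp)
    exact h2.contDiffAt.comp (0 : E) (f := φ) (hφ.of_le (by simp))
  have hT0 : ∀ i, (ContinuousLinearMap.proj i : (Fin r → ℝ) →L[ℝ] ℝ) ∘L T 0 =
      orbitDifferential E G (p i) y := by
    intro i
    ext b
    have := hTapp 0 b i
    rw [hφ0, loc_zero, adE_one] at this
    exact this
  obtain ⟨b, hb, hb0, hbT⟩ := exists_smooth_kernel_section hT (by simpa only [hT0] using hli)
    (ξ := ξ) (by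
      funext i
      have h1 := congrArg (fun S : E →L[ℝ] ℝ => S ξ) (hT0 i)
      exact h1.trans (hξ i))
  have hX : ContDiffAt ℝ 1 (fun u => rightTranslation m u (b u)) 0 :=
    ((contDiffAt_rightTranslation hparam).of_le (by simp)).clm_apply hb
  obtain ⟨c, hc0, hc, hlev⟩ := exists_integralCurve (W := ℝ) hX
  simp only [rightTranslation_zero hparam, hb0, ContinuousLinearMap.id_apply] at hc
  -- By `hspan` the differential of any invariant `q` is a combination of those of the `p i`, so `q`
  -- too is constant along the integral curve. Separation of orbits then puts the curve in the
  -- `K`-orbit of `y`.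
  have hconst : ∀ᶠ t in 𝓝 (0 : ℝ), ∀ q ∈ invPolyAlg ((adHom E G).comp ι), q (φ (c t)) = q y := by
    have h1 := hlev _ (hbT.and (eventually_fderiv_comp_rightTranslation
      (R := fun u => adE E (loc E G u)) hparam hφ hR))
    filter_upwards [h1] with t ht q hq
    rw [ht (fun u => q (φ u)), hφ0]
    rintro u ⟨⟨hTu, hliu⟩, hdu, hcu⟩
    have hqd := differentiable_of_mem_polyAlg hq.1 (φ u)
    refine ⟨hqd.comp u hdu, ?_⟩
    have h2 := (hqd.hasFDerivAt.comp u hdu.hasFDerivAt).fderiv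
    have h3 : fderiv ℝ φ u (rightTranslation m u (b u)) =
        adE E (loc E G u) (brE E G (b u) y) := by
      have h4 := congrArg (fun S : E →L[ℝ] E => S (b u)) hcu
      have h5 : fderiv ℝ φ 0 = (brE E G).flip y := fderiv_adE_loc_apply E G y
      rw [h5] at h4
      exact h4
    change fderiv ℝ (q ∘ φ) u _ = 0
    rw [h2, ContinuousLinearMap.comp_apply, h3, adE_brE]
    change orbitDifferential E G q (φ u) (adE E (loc E G u) (b u)) = 0
    have h6 : LinearIndependent ℝ fun i => orbitDifferential E G (p i) (φ u) := by
      rw [Fintype.linearIndependent_iff] at hliu ⊢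
      intro g hg
      refine hliu g ?_
      ext v
      have h7 := congrArg (fun S : E →L[ℝ] ℝ => S (adE E (loc E G u) v)) hg
      simp only [_root_.sum_apply, _root_.smul_apply,
        _root_.zero_apply] at h7 ⊢
      rw [← h7]
      exact Finset.sum_congr rfl fun i _ => congrArg _ (hTapp u v i)
    have h8 := hspan _ h6 q hq
    refine Submodule.span_induction (p := fun l _ => l (adE E (loc E G u) (b u)) = 0)
      ?_ rfl (fun l l' _ _ hl hl' => by simp [hl, hl']) (fun a l _ hl => by simp [hl]) h8
    rintro _ ⟨i, rfl⟩
    exact (hTapp u (b u) i).symm.trans (congrFun hTu i)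
  have hs : HasDerivAt (fun t => φ (c t)) (brE E G ξ y) 0 := by
    have h1 : HasFDerivAt φ ((brE E G).flip y) (c 0) := by
      rw [hc0]
      exact hasFDerivAt_adE_loc_apply y
    exact h1.comp_hasDerivAt (0 : ℝ) hc
  have hKφ : ContDiffAt ℝ ∞ (fun u => ((adHom E G).comp ι) (loc E' K u) y) 0 :=
    (contDiffAt_adE_hom_loc hι).clm_apply contDiffAt_const
  have hKd : HasFDerivAt (fun u => ((adHom E G).comp ι) (loc E' K u) y)
      (((brE E G).flip y).comp (diffE E E' ι)) 0 := by
    refine ((hasFDerivAt_adE_hom_loc hι).clm_apply (hasFDerivAt_const y (0 : E'))).congr_fderiv ?_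
    ext v
    simp [diffE]
    rfl
  have hv := velocity_mem_range_of_mem_orbit (isSmoothParam_loc (E := E') (G := K))
    ((adHom E G).comp ι) (continuous_adHom_comp hι) hKφ hs (by simp [hc0, hφ0]) (by
      filter_upwards [hconst] with t ht
      exact exists_eq_of_invPolyAlg _ (continuous_adHom_comp hι) fun q hq => (ht q hq).symm)
  rw [hKd.fderiv] at hv
  exact hv

/-- On an open dense part of the orbit, described by the non-vanishing of a polynomial function,
the tangent vectors that are annihilated by the `K`-invariant polynomial functions are tangent to
the orbits of `K`. -/
theorem exists_polyAlg_forall_brE_mem_range {ι : K →* G}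
    (hι : IsLieSubgroup (E := E) (E' := E') ι) (x : E) :
    ∃ f ∈ polyAlg E, (∃ g : G, f (adE E g x) ≠ 0) ∧ ∀ g : G, f (adE E g x) ≠ 0 → ∀ ξ : E,
      (∀ q ∈ invPolyAlg ((adHom E G).comp ι), fderiv ℝ q (adE E g x) (brE E G ξ (adE E g x)) = 0) →
      ∃ κ : E', brE E G (diffE E E' ι κ) (adE E g x) = brE E G ξ (adE E g x) := by
  let V : G → Submodule ℝ (E →L[ℝ] ℝ) := fun g => Submodule.span ℝ
    ((fun q => orbitDifferential E G q (adE E g x)) '' invPolyAlg ((adHom E G).comp ι))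
  obtain ⟨g₀, hg₀⟩ : ∃ g₀, ∀ g, finrank ℝ (V g) ≤ finrank ℝ (V g₀) := by
    have hb : BddAbove (Set.range fun g => finrank ℝ (V g)) := ⟨finrank ℝ (E →L[ℝ] ℝ), by
      rintro _ ⟨g, rfl⟩
      exact Submodule.finrank_le _⟩
    obtain ⟨g₀, h⟩ := Nat.sSup_mem (Set.range_nonempty fun g => finrank ℝ (V g)) hb
    exact ⟨g₀, fun g => (le_csSup hb ⟨g, rfl⟩).trans h.ge⟩
  obtain ⟨l, hl, -, hli⟩ := Submodule.exists_fun_fin_finrank_span_eq ℝ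
    ((fun q => orbitDifferential E G q (adE E g₀ x)) '' invPolyAlg ((adHom E G).comp ι))
  change Fin (finrank ℝ (V g₀)) → _ at l
  choose p hp hpl using hl
  obtain ⟨ξ, hξ⟩ := exists_dual_family hli
  -- The `p i` are chosen where the span of the differentials has maximal dimension. Wherever this
  -- minor is nonzero they stay independent, and by maximality they still span.
  refine ⟨fun z => (Matrix.of fun i j => orbitDifferential E G (p i) z (ξ j)).det,
    det_mem_polyAlg (M := fun i j z => orbitDifferential E G (p i) z (ξ j)) fun i j =>
      fderiv_mem_polyAlg (hp i).1 (brE E G (ξ j)), ⟨g₀, ?_⟩, fun g hg η hη => ?_⟩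
  · have h1 : (Matrix.of fun i j => orbitDifferential E G (p i) (adE E g₀ x) (ξ j)) = 1 := by
      ext i j
      rw [Matrix.of_apply, Matrix.one_apply, ← hξ i j, ← hpl]
    change (Matrix.of fun i j => orbitDifferential E G (p i) (adE E g₀ x) (ξ j)).det ≠ 0
    rw [h1, Matrix.det_one]
    exact one_ne_zero
  · have hli := linearIndependent_of_det_ne_zero hg
    refine brE_mem_range_of_orbitDifferential_eq_zero hι hp hli (fun h hh q hq => ?_)
      (fun i => hη _ (hp i))
    have h2 : adE E h (adE E g x) = adE E (h * g) x := by
      rw [adE_mul]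
      rfl
    rw [h2] at hh ⊢
    have h3 : Submodule.span ℝ (Set.range fun i =>
        orbitDifferential E G (p i) (adE E (h * g) x)) = V (h * g) := by
      apply Submodule.eq_of_le_of_finrank_le
      · refine Submodule.span_mono ?_
        rintro _ ⟨i, rfl⟩
        exact ⟨p i, hp i, rfl⟩
      · rw [finrank_span_eq_card hh, Fintype.card_fin]
        exact hg₀ _
    rw [h3]
    exact Submodule.subset_span ⟨q, hq, rfl⟩

end InvariantDifferentials
end AdjointComplexity

namespace AdjointComplexity

/-! ### Identification of `F_y` with a normal space -/

section Differentials

variable {E : Type*} [NormedAddCommGroup E] [NormedSpace ℝ E] [FiniteDimensional ℝ E]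
  {G : Type*} [TopologicalSpace G] [ChartedSpace E G] [Group G] [LieGroup 𝓘(ℝ, E) ∞ G]
  {E' : Type*} [NormedAddCommGroup E'] [NormedSpace ℝ E'] [FiniteDimensional ℝ E']
  {K : Type*} [TopologicalSpace K] [ChartedSpace E' K] [Group K] [LieGroup 𝓘(ℝ, E') ∞ K]

theorem brE_mem_orbitTangent (ξ y : E) :
    (show Alg E G from brE E G ξ y) ∈ orbitTangent (G := G) y := by
  refine ⟨(-ξ : E), ?_⟩
  refine (brE_eq (E := E) (G := G) y (-ξ)).symm.trans ?_
  rw [map_neg, brE_skew, neg_neg]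

theorem exists_eq_brE_of_mem_orbitTangent {y v : Alg E G} (hv : v ∈ orbitTangent y) :
    ∃ ξ : E, v = brE E G ξ y := by
  obtain ⟨ξ, rfl⟩ := hv
  refine ⟨(-ξ : Alg E G), ?_⟩
  have h : ∀ a b : E, brE E G a b = brE E G (-b) a := fun a b => by
    rw [map_neg, _root_.neg_apply, ← brE_skew]
  exact (brE_eq (E := E) (G := G) y ξ).symm.trans (h y ξ)

/-- The tangent vector `[κ, y]` of the orbit of `y`. -/
noncomputable def tangentVector (ξ y : E) : orbitTangent (G := G) y :=
  ⟨brE E G ξ y, brE_mem_orbitTangent ξ y⟩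

/-- The restriction of a covector to the tangent space of the orbit. -/
noncomputable def restrictCovector (y : Alg E G) (l : E →L[ℝ] ℝ) : OrbitCotangent y :=
  (show Alg E G →ₗ[ℝ] ℝ from l.toLinearMap).comp (orbitTangent y).subtype

theorem adE_mem_adjointOrbit {x y : Alg E G} (hy : y ∈ adjointOrbit E G x) (g : G) :
    Ad E G g y ∈ adjointOrbit E G x := by
  obtain ⟨h, rfl⟩ := hy
  exact ⟨g * h, Ad_mul_apply g h x⟩

/-- An invariant function is constant along the curve `t ↦ Ad_{ι(loc (tκ))} y`, whose velocity at
`0` is `[κ, y]`. -/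
theorem eq_zero_of_mem_invariantDifferentials {ι : K →* G}
    (hι : IsLieSubgroup (E := E) (E' := E') ι) {x : Alg E G} {y : adjointOrbit E G x}
    {α : OrbitCotangent (y : Alg E G)} (hα : α ∈ invariantDifferentials ι y) (κ : E') :
    α (tangentVector (diffE E E' ι κ) (y : Alg E G)) = 0 := by
  obtain ⟨f, hf, V, F, hyV, hF, hαF⟩ := hα
  refine (hαF _).trans ?_
  let y₀ : E := (y : Alg E G)
  have hdF : HasFDerivAt F (fderiv ℝ F y₀) y₀ :=
    ((hF.smooth.contDiffAt (hF.isOpen.mem_nhds hyV)).differentiableAt (by simp)).hasFDerivAt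
  let c : ℝ → E := fun t => adE E (ι (loc E' K (t • κ))) y₀
  have hc0 : c 0 = y₀ := by simp [c, adE_one]
  have hc : HasDerivAt c (brE E G (diffE E E' ι κ) y₀) 0 := by
    have h1 : HasDerivAt (fun t : ℝ => t • κ) κ 0 := by
      simpa using (hasDerivAt_id (0 : ℝ)).smul_const κ
    have h2 : HasFDerivAt (fun u : E' => adE E (ι (loc E' K u)) y₀)
        (((brE E G).flip y₀).comp (diffE E E' ι)) ((0 : ℝ) • κ) := by
      rw [zero_smul]
      refine ((hasFDerivAt_adE_hom_loc hι).clm_apply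
        (hasFDerivAt_const y₀ (0 : E'))).congr_fderiv ?_
      ext v
      simp [diffE]
      rfl
    exact HasFDerivAt.comp_hasDerivAt (f := fun t : ℝ => t • κ)
      (l := fun u : E' => adE E (ι (loc E' K u)) y₀) (0 : ℝ) h2 h1
  have hFc : HasDerivAt (fun t => F (c t)) (fderiv ℝ F y₀ (brE E G (diffE E E' ι κ) y₀)) 0 := by
    rw [← hc0] at hdF
    have := hdF.comp_hasDerivAt (0 : ℝ) hc
    rwa [hc0] at this
  have hconst : (fun t => F (c t)) =ᶠ[𝓝 0] fun _ => f y := by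
    have h1 : ∀ᶠ t in 𝓝 (0 : ℝ), c t ∈ V := by
      have h2 := hc.continuousAt.tendsto
      rw [hc0] at h2
      exact h2.eventually (hF.isOpen.mem_nhds hyV)
    filter_upwards [h1] with t ht
    let z : adjointOrbit E G x := ⟨c t, adE_mem_adjointOrbit y.2 _⟩
    exact (hF.agrees z ht).symm.trans (hf.invariant (loc E' K (t • κ)) y z rfl)
  exact hFc.unique ((hasDerivAt_const (0 : ℝ) (f y)).congr_of_eventuallyEq hconst)

theorem restrictCovector_mem_invariantDifferentials {ι : K →* G} {x : Alg E G}
    (y : adjointOrbit E G x) {q : E → ℝ} (hq : q ∈ invPolyAlg ((adHom E G).comp ι)) :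
    restrictCovector (y : Alg E G) (fderiv ℝ q (y : Alg E G)) ∈ invariantDifferentials ι y := by
  have hext : IsSmoothExtension (fun z : adjointOrbit E G x => q (coord E G z)) Set.univ q :=
    ⟨isOpen_univ, ((contDiff_of_mem_polyAlg hq.1).of_le le_top).contDiffOn, fun _ _ => rfl⟩
  refine ⟨fun z => q (coord E G z), ⟨fun z => ⟨Set.univ, q, trivial, hext⟩, ?_⟩,
    Set.univ, q, trivial, hext, fun v => rfl⟩
  intro k z w hzw
  have h1 := hq.2 k (coord E G z)
  refine Eq.trans ?_ h1
  exact congrArg q hzw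

/-- Where the invariant polynomial functions only annihilate the tangent vectors of the orbits of
`K`, the space `F_y` is the conormal space of the orbit of `K`. -/
theorem mem_invariantDifferentials_iff {ι : K →* G}
    (hι : IsLieSubgroup (E := E) (E' := E') ι) {x : Alg E G} (y : adjointOrbit E G x)
    (hy : ∀ ξ : E, (∀ q ∈ invPolyAlg ((adHom E G).comp ι),
      fderiv ℝ q (y : Alg E G) (brE E G ξ (y : Alg E G)) = 0) →
      ∃ κ : E', brE E G (diffE E E' ι κ) (y : Alg E G) = brE E G ξ (y : Alg E G))
    (α : OrbitCotangent (y : Alg E G)) :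
    α ∈ invariantDifferentials ι y ↔
      ∀ κ : E', α (tangentVector (diffE E E' ι κ) (y : Alg E G)) = 0 := by
  refine ⟨fun h κ => eq_zero_of_mem_invariantDifferentials hι h κ, fun h => ?_⟩
  -- By double annihilation it is enough to test `α` on vectors killed by all of `F_y`; invariant
  -- polynomials kill them in particular, so they have the form `[κ, y]`.
  rw [← Subspace.dualCoannihilator_dualAnnihilator_eq (W := invariantDifferentials ι y),
    Submodule.mem_dualAnnihilator]
  intro v hv
  rw [Submodule.mem_dualCoannihilator] at hv
  obtain ⟨ξ, hξ⟩ := exists_eq_brE_of_mem_orbitTangent v.2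
  obtain ⟨κ, hκ⟩ := hy ξ fun q hq => by
    have h1 := hv _ (restrictCovector_mem_invariantDifferentials y hq)
    refine Eq.trans ?_ h1
    exact congrArg (fderiv ℝ q (y : Alg E G)) hξ.symm
  have h2 : v = tangentVector (diffE E E' ι κ) (y : Alg E G) :=
    Subtype.ext (hξ.trans hκ.symm)
  rw [h2]
  exact h κ

theorem form_grad (P : InvariantScalarProduct E G) (y : Alg E G) (α : OrbitCotangent y)
    (v : orbitTangent y) : P.form (grad P y α : Alg E G) v = α v :=
  LinearMap.BilinForm.apply_toDual_symm_apply (B := P.form.restrict (orbitTangent y))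
    (hB := P.restrict_nondegenerate _) α v

theorem grad_mem_normalSpace_iff (P : InvariantScalarProduct E G) {ι : K →* G} (y : Alg E G)
    (α : OrbitCotangent y) :
    (grad P y α : Alg E G) ∈ normalSpace P.form (subalg (E' := E') ι) y ↔
      ∀ κ : E', α (tangentVector (diffE E E' ι κ) y) = 0 := by
  have key : ∀ κ : E', ⁅y, differentialAtOne (E := E) (E' := E') ι κ⁆ =
      -(tangentVector (diffE E E' ι κ) y : orbitTangent y).1 := fun κ =>
    (brE_eq (E := E) (G := G) y (diffE E E' ι κ)).symm.trans (brE_skew (E := E) _ _)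
  have key2 : ∀ κ : E', P.form ⁅y, differentialAtOne (E := E) (E' := E') ι κ⁆ (grad P y α) =
      - α (tangentVector (diffE E E' ι κ) y) := fun κ => by
    rw [key, ← form_grad P y α, map_neg, LinearMap.neg_apply, P.symm]
  constructor
  · rintro ⟨-, h⟩ κ
    have h1 := h _ ⟨_, ⟨κ, rfl⟩, rfl⟩
    have h2 := (key2 κ).symm.trans h1
    linarith
  · intro h
    refine ⟨(grad P y α).2, ?_⟩
    rintro _ ⟨_, ⟨κ, rfl⟩, rfl⟩
    exact (key2 κ).trans (neg_eq_zero.2 (h κ))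

theorem finrank_invariantDifferentials {ι : K →* G}
    (P : InvariantScalarProduct E G) {x : Alg E G} (y : adjointOrbit E G x)
    (hy : ∀ α, α ∈ invariantDifferentials ι y ↔
      ∀ κ : E', α (tangentVector (diffE E E' ι κ) (y : Alg E G)) = 0) :
    finrank ℝ (invariantDifferentials ι y) =
      finrank ℝ (normalSpace P.form (subalg (E' := E') ι) (y : Alg E G)) ∧
    finrank ℝ (invariantKernel P ι y) =
      finrank ℝ (normalKernel P.form (subalg (E' := E') ι) (y : Alg E G)) := by
  let T : OrbitCotangent (y : Alg E G) →ₗ[ℝ] Alg E G :=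
    (orbitTangent (y : Alg E G)).subtype.comp (grad P (y : Alg E G)).toLinearMap
  have hT : Function.Injective T :=
    (Submodule.injective_subtype _).comp (grad P (y : Alg E G)).injective
  have hmem : ∀ α, α ∈ invariantDifferentials ι y ↔
      T α ∈ normalSpace P.form (subalg (E' := E') ι) (y : Alg E G) := fun α =>
    (hy α).trans (grad_mem_normalSpace_iff P (y : Alg E G) α).symm
  have hsurj : ∀ v ∈ normalSpace P.form (subalg (E' := E') ι) (y : Alg E G), ∃ α, T α = v := by
    intro v hv
    refine ⟨(grad P (y : Alg E G)).symm ⟨v, hv.1⟩, ?_⟩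
    simp [T]
  have h1 : (invariantDifferentials ι y).map T =
      normalSpace P.form (subalg (E' := E') ι) (y : Alg E G) := by
    ext v
    constructor
    · rintro ⟨α, hα, rfl⟩
      exact (hmem α).1 hα
    · intro hv
      obtain ⟨α, rfl⟩ := hsurj v hv
      exact ⟨α, (hmem α).2 hv, rfl⟩
  have h2 : (invariantKernel P ι y).map T =
      normalKernel P.form (subalg (E' := E') ι) (y : Alg E G) := by
    ext v
    constructor
    · rintro ⟨α, ⟨hα, hα'⟩, rfl⟩
      refine ⟨(hmem α).1 hα, fun w hw => ?_⟩
      obtain ⟨β, rfl⟩ := hsurj w hw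
      exact neg_eq_zero.1 (hα' β ((hmem β).2 hw))
    · rintro ⟨hv, hv'⟩
      obtain ⟨α, rfl⟩ := hsurj v hv
      exact ⟨α, ⟨(hmem α).2 hv, fun β hβ => neg_eq_zero.2 (hv' _ ((hmem β).1 hβ))⟩, rfl⟩
  constructor
  · rw [← h1]
    exact (Submodule.equivMapOfInjective T hT _).finrank_eq
  · rw [← h2]
    exact (Submodule.equivMapOfInjective T hT _).finrank_eq

end Differentials
end AdjointComplexity

namespace AdjointComplexity

/-! ### Minors and semicontinuity of the rank -/

section Rank

variable {E : Type*} [NormedAddCommGroup E] [NormedSpace ℝ E] [FiniteDimensional ℝ E]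

/-- The kernel of a linearly parametrized map has the dimension it has at a given point, or a
smaller one, wherever a suitable minor does not vanish. -/
theorem exists_minor {V W : Type*} [NormedAddCommGroup V] [NormedSpace ℝ V]
    [FiniteDimensional ℝ V] [NormedAddCommGroup W] [NormedSpace ℝ W] [FiniteDimensional ℝ W]
    (T : E →L[ℝ] V →L[ℝ] W) (z₀ : E) :
    ∃ q ∈ polyAlg E, q z₀ ≠ 0 ∧ ∀ z, q z ≠ 0 →
      finrank ℝ (LinearMap.ker (T z).toLinearMap) ≤
        finrank ℝ (LinearMap.ker (T z₀).toLinearMap) := by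
  let R := LinearMap.range (T z₀).toLinearMap
  let b := finBasis ℝ R
  choose v hv using fun j => (b j).2
  obtain ⟨π, hπ⟩ := R.subtype.exists_leftInverse_of_injective
    (LinearMap.ker_eq_bot.2 R.injective_subtype)
  -- Functionals dual to the basis `T z₀ (v j)` of the range, so that the chosen minor is the
  -- identity matrix at `z₀`.
  let l : Fin (finrank ℝ R) → W →L[ℝ] ℝ := fun i =>
    LinearMap.toContinuousLinearMap ((b.coord i).comp π)
  have hl : ∀ i j, l i (T z₀ (v j)) = if i = j then 1 else 0 := by
    intro i j
    have h1 : T z₀ (v j) = R.subtype (b j) := hv j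
    have h2 : π (R.subtype (b j)) = b j := congrArg (fun S : R →ₗ[ℝ] R => S (b j)) hπ
    rw [h1]
    change b.coord i (π (R.subtype (b j))) = _
    rw [h2, Basis.coord_apply, Basis.repr_self, Finsupp.single_apply]
    simp [eq_comm]
  refine ⟨fun z => (Matrix.of fun i j => l i (T z (v j))).det,
    det_mem_polyAlg (M := fun i j z => l i (T z (v j))) fun i j =>
      linear_mem_polyAlg ((l i).comp (T.flip (v j))), ?_, fun z hz => ?_⟩
  · have h1 : (Matrix.of fun i j => l i (T z₀ (v j))) = 1 := by
      ext i j
      rw [Matrix.of_apply, hl, Matrix.one_apply]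
    change (Matrix.of fun i j => l i (T z₀ (v j))).det ≠ 0
    rw [h1, Matrix.det_one]
    exact one_ne_zero
  · have hli : LinearIndependent ℝ fun j => T z (v j) := by
      rw [Fintype.linearIndependent_iff]
      intro g hg
      have h1 : Matrix.mulVec (Matrix.of fun i j => l i (T z (v j))) g = 0 := by
        funext i
        have h2 := congrArg (l i) hg
        simp only [map_sum, map_smul, smul_eq_mul, map_zero] at h2
        rw [Matrix.mulVec, dotProduct, Pi.zero_apply, ← h2]
        exact Finset.sum_congr rfl fun j _ => mul_comm _ _
      exact congrFun (Matrix.eq_zero_of_mulVec_eq_zero hz h1)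
    have h1 := finrank_span_eq_card hli
    rw [Fintype.card_fin] at h1
    have h2 : Submodule.span ℝ (Set.range fun j => T z (v j)) ≤
        LinearMap.range (T z).toLinearMap := by
      rw [Submodule.span_le]
      rintro _ ⟨j, rfl⟩
      exact ⟨v j, rfl⟩
    have h3 := Submodule.finrank_mono h2
    have h4 := finrank_range_add_finrank_ker_clm (T z)
    have h5 := finrank_range_add_finrank_ker_clm (T z₀)
    have h6 : finrank ℝ R = finrank ℝ (LinearMap.range (T z₀).toLinearMap) := rfl
    omega

/-- If `q` vanished wherever `p` does not, it would vanish near `a`, hence everywhere by the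
identity theorem. -/
theorem exists_ne_zero_of_mem_polyAlg {p q : E → ℝ} (hp : p ∈ polyAlg E) (hq : q ∈ polyAlg E)
    {a b : E} (ha : p a ≠ 0) (hb : q b ≠ 0) : ∃ z, p z ≠ 0 ∧ q z ≠ 0 := by
  by_contra! h
  have h1 : ∀ᶠ z in 𝓝 a, q z = 0 := by
    filter_upwards [(differentiable_of_mem_polyAlg hp).continuous.continuousAt.eventually_ne ha]
      with z hz using h z hz
  have h2 : AnalyticOnNhd ℝ q Set.univ := fun z _ =>
    (contDiff_of_mem_polyAlg hq).contDiffAt.analyticAt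
  exact hb (h2.eqOn_zero_of_preconnected_of_eventuallyEq_zero isPreconnected_univ
    (Set.mem_univ a) h1 (Set.mem_univ b))

end Rank

/-! ### Generic elements and the good open dense subset -/

section Generic

variable {E : Type*} [NormedAddCommGroup E] [NormedSpace ℝ E] [FiniteDimensional ℝ E]
  {G : Type*} [TopologicalSpace G] [ChartedSpace E G] [Group G] [LieGroup 𝓘(ℝ, E) ∞ G]
  {E' : Type*} [NormedAddCommGroup E'] [NormedSpace ℝ E'] [FiniteDimensional ℝ E']
  {K : Type*} [TopologicalSpace K] [ChartedSpace E' K] [Group K] [LieGroup 𝓘(ℝ, E') ∞ K]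
  {ι : K →* G}

theorem exists_forall_finrank_le {X V : Type*} [Nonempty X] [AddCommGroup V] [Module ℝ V]
    (S : X → Submodule ℝ V) : ∃ a, ∀ b, finrank ℝ (S a) ≤ finrank ℝ (S b) :=
  ⟨Function.argmin fun a => finrank ℝ (S a), fun b => Function.argmin_le (fun a => finrank ℝ (S a)) b⟩

theorem finrank_isotropy_eq_ker (y : E) : finrank ℝ (isotropy (G := G) y) =
    finrank ℝ (LinearMap.ker (brE E G y).toLinearMap) := by
  have h : isotropy (G := G) y = (show Submodule ℝ (Alg E G) from
      LinearMap.ker (brE E G y).toLinearMap) := by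
    ext v
    have e := brE_eq (E := E) (G := G) y v
    exact ⟨fun h => e.trans h, fun h => e.symm.trans h⟩
  rw [h]
  rfl

variable (E G E') in
/-- Generic elements exist. -/
theorem exists_isGeneric (hι : IsLieSubgroup (E := E) (E' := E') ι) :
    ∃ x : Alg E G, IsGeneric E' ι x := by
  obtain ⟨a, ha⟩ := exists_forall_finrank_le fun z : Alg E G => isotropy z
  obtain ⟨b, hb⟩ := exists_forall_finrank_le fun z : Alg E G =>
    (subalg (E' := E') ι ⊓ isotropy z : Submodule ℝ (Alg E G))
  obtain ⟨p, hp, hpa, hp'⟩ := exists_minor (brE E G) a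
  obtain ⟨q, hq, hqb, hq'⟩ := exists_minor
    ((ContinuousLinearMap.precomp E (diffE E E' ι)).comp (brE E G).flip) b
  -- Each minimum is attained off the zeros of a polynomial function; two such sets meet, so both
  -- minima are attained together.
  obtain ⟨x, hpx, hqx⟩ := exists_ne_zero_of_mem_polyAlg hp hq hpa hqb
  refine ⟨(x : E), fun z => ?_, fun z => ?_⟩
  · refine le_trans (le_of_eq_of_le (finrank_isotropy_eq_ker x) ((hp' x hpx).trans
      (finrank_isotropy_eq_ker (G := G) (E := E) a).symm.le)) (ha z)
  · refine le_trans (le_of_eq_of_le (finrank_subalg_inf_isotropy hι x) ((hq' x hqx).trans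
      (finrank_subalg_inf_isotropy (E := E) hι b).symm.le)) (hb z)

/-- The maximum of the dimension of `F_y` and the minimal dimensions of the isotropy algebras are
attained on an open dense subset of the orbit. -/
theorem exists_dense_good [CompactSpace K] [ConnectedSpace G]
    (hι : IsLieSubgroup (E := E) (E' := E') ι) (P : InvariantScalarProduct E G) {x : Alg E G}
    (hx : IsGeneric E' ι x) :
    ∃ U : Set (adjointOrbit E G x), IsOpen U ∧ Dense U ∧ ∀ y ∈ U,
      finrank ℝ (invariantDifferentials ι y) =
        finrank ℝ (normalSpace P.form (subalg (E' := E') ι) (y : Alg E G)) ∧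
      finrank ℝ (invariantKernel P ι y) =
        finrank ℝ (normalKernel P.form (subalg (E' := E') ι) (y : Alg E G)) ∧
      finrank ℝ (subalg (E' := E') ι ⊓ isotropy (y : Alg E G) : Submodule ℝ (Alg E G)) =
        finrank ℝ (subalg (E' := E') ι ⊓ isotropy x : Submodule ℝ (Alg E G)) ∧
      finrank ℝ (isotropy (projK hι P y)) = LieAlgebra.rank ℝ (Alg E' K) := by
  have hG := topologicalGroup_of_lieGroup (I := 𝓘(ℝ, E)) (n := ∞) (G := G)
  let x₀ : E := x
  obtain ⟨f, hf, ⟨g₁, hg₁⟩, hf'⟩ := exists_polyAlg_forall_brE_mem_range hι x₀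
  obtain ⟨q, hq, hqx, hq'⟩ := exists_minor
    ((ContinuousLinearMap.precomp E (diffE E E' ι)).comp (brE E G).flip) x₀
  -- Minimality is asked only along the orbit of `x`, which is all `finrank_isotropy_projK_eq_rank`
  -- needs. The polynomials `f`, `q`, `r` control respectively `F_y`, the dimension of `𝔨(y)` and
  -- the centralizer of the projection.
  obtain ⟨g₂, hg₂⟩ := exists_forall_finrank_le fun g : G => isotropy (projK hι P (Ad E G g x))
  let S : E →L[ℝ] E' →L[ℝ] E' →L[ℝ] ℝ :=
    ((ContinuousLinearMap.compL ℝ E' (E' →L[ℝ] E') (E' →L[ℝ] ℝ)).flip (brE E' K)) ∘L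
      (ContinuousLinearMap.compL ℝ E' E' ℝ) ∘L
        ((ContinuousLinearMap.compL ℝ E' E ℝ).flip (diffE E E' ι)) ∘L P.formE
  have hS : ∀ z : E, finrank ℝ (isotropy (projK hι P z)) =
      finrank ℝ (LinearMap.ker (S z).toLinearMap) := finrank_isotropy_projK_eq_ker hι P
  obtain ⟨r, hr, hrx, hr'⟩ := exists_minor S (adE E g₂ x₀)
  let co : adjointOrbit E G x → E := fun y => (y : Alg E G)
  have hco : Continuous co := continuous_subtype_val
  let orb : G → adjointOrbit E G x := fun g => ⟨Ad E G g x, g, rfl⟩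
  have horb : Continuous orb := by
    have h1 : Continuous fun g : G => adE E g x₀ :=
      (continuous_adE (E := E) (G := G)).clm_apply continuous_const
    exact Continuous.subtype_mk h1 _
  have hsurj : Function.Surjective orb := fun ⟨_, g, hg⟩ => ⟨g, Subtype.ext hg⟩
  have hopen : ∀ {p : E → ℝ}, p ∈ polyAlg E → IsOpen {y : adjointOrbit E G x | p (co y) ≠ 0} :=
    fun hp => isOpen_ne_fun ((differentiable_of_mem_polyAlg hp).continuous.comp hco)
      continuous_const
  have hdense : ∀ {p : E → ℝ}, p ∈ polyAlg E → (∃ g : G, p (adE E g x₀) ≠ 0) →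
      Dense {y : adjointOrbit E G x | p (co y) ≠ 0} := by
    rintro p hp ⟨g, hg⟩
    refine (hsurj.denseRange.dense_image horb
      (dense_ne_zero_of_mem_polyAlg (adHom E G) hp hg)).mono ?_
    rintro _ ⟨h, hh, rfl⟩
    exact hh
  refine ⟨{y | f (co y) ≠ 0} ∩ ({y | q (co y) ≠ 0} ∩ {y | r (co y) ≠ 0}),
    (hopen hf).inter ((hopen hq).inter (hopen hr)),
    (hdense hf ⟨g₁, hg₁⟩).inter_of_isOpen_left
      ((hdense hq ⟨1, by rw [adE_one]; exact hqx⟩).inter_of_isOpen_left (hdense hr ⟨g₂, hrx⟩)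
        (hopen hq)) (hopen hf), ?_⟩
  rintro y ⟨hfy, hqy, hry⟩
  have h1 : ∀ α, α ∈ invariantDifferentials ι y ↔
      ∀ κ : E', α (tangentVector (diffE E E' ι κ) (y : Alg E G)) = 0 := by
    refine mem_invariantDifferentials_iff hι y fun ξ hξ => ?_
    obtain ⟨g, rfl⟩ := hsurj y
    exact hf' g hfy ξ hξ
  have h2 := finrank_invariantDifferentials P y h1
  have h3 : finrank ℝ (subalg (E' := E') ι ⊓ isotropy (y : Alg E G) : Submodule ℝ (Alg E G)) ≤
      finrank ℝ (subalg (E' := E') ι ⊓ isotropy x : Submodule ℝ (Alg E G)) :=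
    le_of_eq_of_le (finrank_subalg_inf_isotropy hι (co y)) ((hq' (co y) hqy).trans
      (finrank_subalg_inf_isotropy (E := E) hι x₀).symm.le)
  refine ⟨h2.1, h2.2, le_antisymm h3 (hx.2 _), ?_⟩
  refine finrank_isotropy_projK_eq_rank hι P (fun z => h3.trans (hx.2 z)) fun g => ?_
  obtain ⟨h, rfl⟩ := hsurj y
  have h4 : finrank ℝ (isotropy (projK hι P (Ad E G h x))) ≤
      finrank ℝ (isotropy (projK hι P (Ad E G g₂ x))) :=
    le_of_eq_of_le (hS (adE E h x₀)) ((hr' _ hry).trans (hS (adE E g₂ x₀)).symm.le)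
  have h5 := h4.trans (hg₂ (g * h))
  rwa [Ad_mul_apply] at h5

end Generic
end AdjointComplexity

namespace AdjointComplexity

/-! ### The complexity formula and multiplicity freeness -/

section Complexity

variable {E : Type*} [NormedAddCommGroup E] [NormedSpace ℝ E] [FiniteDimensional ℝ E]
  {G : Type*} [TopologicalSpace G] [ChartedSpace E G] [Group G] [LieGroup 𝓘(ℝ, E) ∞ G]
  {E' : Type*} [NormedAddCommGroup E'] [NormedSpace ℝ E'] [FiniteDimensional ℝ E']
  {K : Type*} [TopologicalSpace K] [ChartedSpace E' K] [Group K] [LieGroup 𝓘(ℝ, E') ∞ K]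
  {ι : K →* G}

theorem IsGeneric.finrank_isotropy (P : InvariantScalarProduct E G) {x : Alg E G}
    (hx : IsGeneric E' ι x) : finrank ℝ (isotropy x) = LieAlgebra.rank ℝ (Alg E G) := by
  obtain ⟨z, hz⟩ := P.isInvariantInner.exists_rank_eq
  exact le_antisymm ((hx.1 z).trans hz.le) (P.isInvariantInner.rank_le x)

theorem finrank_map_prP (P : InvariantScalarProduct E G) (ι : K →* G) (S : Submodule ℝ (Alg E G)) :
    finrank ℝ (S.map (prP E' P ι)) +
      finrank ℝ (subalg (E' := E') ι ⊓ S : Submodule ℝ (Alg E G)) = finrank ℝ S := by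
  have h1 := finrank_map_add_finrank_inf_ker (prP E' P ι) S
  have h2 : LinearMap.ker (prP E' P ι) = subalg (E' := E') ι := Submodule.ker_projection _
  rwa [h2, inf_comm] at h1

theorem finrank_complementP (P : InvariantScalarProduct E G) (ι : K →* G) :
    finrank ℝ (complementP E' P ι) + finrank ℝ (subalg (E := E) (E' := E') ι) =
      finrank ℝ (Alg E G) :=
  Submodule.finrank_add_eq_of_isCompl (P.isCompl _)

section

variable [CompactSpace K] [ConnectedSpace G]

theorem exists_dense_finrank_eq (hι : IsLieSubgroup (E := E) (E' := E') ι)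
    (P : InvariantScalarProduct E G) {x : Alg E G} (hx : IsGeneric E' ι x) :
    ∃ U : Set (adjointOrbit E G x), IsOpen U ∧ Dense U ∧ ∀ y ∈ U,
      finrank ℝ (invariantDifferentials ι y) + finrank ℝ (subalg (E := E) (E' := E') ι) +
          finrank ℝ (isotropy x) = finrank ℝ (Alg E G) +
          finrank ℝ (subalg (E' := E') ι ⊓ isotropy x : Submodule ℝ (Alg E G)) ∧
      finrank ℝ (invariantKernel P ι y) +
          finrank ℝ (subalg (E' := E') ι ⊓ isotropy x : Submodule ℝ (Alg E G)) =
        LieAlgebra.rank ℝ (Alg E' K) ∧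
      ∃ c : ℕ, finrank ℝ (invariantDifferentials ι y) = 2 * c +
        finrank ℝ (invariantKernel P ι y) := by
  obtain ⟨U, hU, hd, h⟩ := exists_dense_good hι P hx
  refine ⟨U, hU, hd, fun y hy => ?_⟩
  obtain ⟨h1, h2, h3, h4⟩ := h y hy
  obtain ⟨c, hc⟩ := exists_finrank_normalSpace_eq (B := P.form) (subalg (E' := E') ι) (y : Alg E G)
  have h5 := P.isInvariantInner.finrank_normalSpace (subalg (E' := E') ι) (y : Alg E G)
  have h6 := P.isInvariantInner.finrank_normalKernel (subalg (E' := E') ι) (y : Alg E G)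
  change _ + finrank ℝ (isotropy (y : Alg E G)) = _ + finrank ℝ
    (subalg (E' := E') ι ⊓ isotropy (y : Alg E G) : Submodule ℝ (Alg E G)) at h5
  change _ + finrank ℝ
    (subalg (E' := E') ι ⊓ isotropy (y : Alg E G) : Submodule ℝ (Alg E G)) = _ at h6
  rw [finrank_isotropy_projK hι P] at h4
  have h7 : finrank ℝ (isotropy (y : Alg E G)) = finrank ℝ (isotropy x) := by
    obtain ⟨g, hg⟩ := y.2
    rw [← hg]
    exact finrank_isotropy_Ad g x
  rw [h1, h2]
  refine ⟨by omega, by omega, c, hc⟩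

theorem exists_complexity_eq (hι : IsLieSubgroup (E := E) (E' := E') ι)
    (P : InvariantScalarProduct E G) {x : Alg E G} (hx : IsGeneric E' ι x) :
    ∃ c : ℕ, (c : ℚ) =
      bNumber E' P ι - (finrank ℝ ((isotropy x).map (prP E' P ι)) : ℚ) := by
  obtain ⟨U, -, hd, h⟩ := exists_dense_finrank_eq hι P hx
  have : Nonempty (adjointOrbit E G x) := ⟨⟨_, 1, rfl⟩⟩
  obtain ⟨y, hy⟩ := hd.nonempty
  obtain ⟨h1, h2, c, hc⟩ := h y hy
  have h3 := finrank_map_prP (E' := E') P ι (isotropy x)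
  have h4 := finrank_complementP (E' := E') P ι
  have h5 := hx.finrank_isotropy P
  refine ⟨c, ?_⟩
  unfold bNumber
  rify at *
  linarith

/-- Any dense set witnessing a complexity meets the open dense set where the dimensions were
computed, so the value does not depend on the witness. -/
theorem hasComplexity_iff (hι : IsLieSubgroup (E := E) (E' := E') ι)
    (P : InvariantScalarProduct E G) {x : Alg E G} (hx : IsGeneric E' ι x) (c : ℕ) :
    HasComplexity P ι x c ↔ (c : ℚ) =
      bNumber E' P ι - (finrank ℝ ((isotropy x).map (prP E' P ι)) : ℚ) := by
  obtain ⟨U, hU, hd, h⟩ := exists_dense_finrank_eq hι P hx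
  have : Nonempty (adjointOrbit E G x) := ⟨⟨_, 1, rfl⟩⟩
  have h3 := finrank_map_prP (E' := E') P ι (isotropy x)
  have h4 := finrank_complementP (E' := E') P ι
  have h5 := hx.finrank_isotropy P
  constructor
  · rintro ⟨U', hU', hd', d, i, hdi, hc⟩
    obtain ⟨y, hy, hy'⟩ := (hd.inter_of_isOpen_left hd' hU).nonempty
    obtain ⟨h1, h2, -⟩ := h y hy
    obtain ⟨h6, h7⟩ := hdi y hy'
    unfold bNumber
    rw [h6] at h1
    rw [h7] at h2
    have hc' : (2 * c : ℚ) = d - i := by exact_mod_cast hc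
    rify at *
    linarith
  · intro hc
    obtain ⟨y, hy⟩ := hd.nonempty
    obtain ⟨h1, h2, -⟩ := h y hy
    refine ⟨U, hU, hd, finrank ℝ (invariantDifferentials ι y), finrank ℝ (invariantKernel P ι y),
      fun z hz => ?_, ?_⟩
    · obtain ⟨h6, h7, -⟩ := h z hz
      constructor <;> omega
    · unfold bNumber at hc
      have hc' : (2 * c : ℚ) = finrank ℝ (invariantDifferentials ι y) -
          finrank ℝ (invariantKernel P ι y) := by
        rify at *
        linarith
      exact_mod_cast hc'

end

/-- The vector that represents a covector through the scalar product. -/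
noncomputable def InvariantScalarProduct.sharp (P : InvariantScalarProduct E G) :
    (E →L[ℝ] ℝ) →L[ℝ] E :=
  LinearMap.toContinuousLinearMap
    ((show E ≃ₗ[ℝ] Dual ℝ E from P.form.toDual P.isInvariantInner.nondegenerate).symm.toLinearMap
      ∘ₗ ContinuousLinearMap.coeLM ℝ)

theorem InvariantScalarProduct.form_sharp (P : InvariantScalarProduct E G) (l : E →L[ℝ] ℝ)
    (v : Alg E G) : P.form (P.sharp l) v = l v :=
  LinearMap.BilinForm.apply_toDual_symm_apply (B := P.form)
    (hB := P.isInvariantInner.nondegenerate) (show Dual ℝ (Alg E G) from l.toLinearMap) v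

/-- `⟨y, [a, b]⟩ = ⟨[y, a], b⟩`, and `ad y` kills the orthogonal complement of the tangent space. So
the bracket can be computed with full gradients of local extensions, which vary continuously with
the point. -/
theorem form_lie_eq_of_forall_form_eq (P : InvariantScalarProduct E G) {y a a' b b' : Alg E G}
    (ha : ∀ v ∈ orbitTangent y, P.form a v = P.form a' v)
    (hb : ∀ v ∈ orbitTangent y, P.form b v = P.form b' v) :
    P.form y ⁅a, b⁆ = P.form y ⁅a', b'⁆ := by
  have hP := P.isInvariantInner
  have key : ∀ {a a' : Alg E G}, (∀ v ∈ orbitTangent y, P.form a v = P.form a' v) →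
      ⁅y, a⁆ = ⁅y, a'⁆ := by
    intro a a' ha
    have h1 : a - a' ∈ P.form.orthogonal (LinearMap.range (LieAlgebra.ad ℝ (Alg E G) y)) := by
      intro v hv
      change P.form v (a - a') = 0
      rw [map_sub, P.symm v a, P.symm v a', ha v hv, sub_self]
    rw [hP.orthogonal_range_ad] at h1
    have h2 : ⁅y, a - a'⁆ = 0 := h1
    rwa [lie_sub, sub_eq_zero] at h2
  rw [← hP.inv, key ha, hP.inv, ← lie_skew, ← lie_skew a' b', map_neg, map_neg, ← hP.inv,
    key hb, hP.inv]

theorem poisson_eq (P : InvariantScalarProduct E G) (y : Alg E G) {α β : OrbitCotangent y}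
    {l l' : E →L[ℝ] ℝ} (hα : ∀ v : orbitTangent y, α v = l (v : Alg E G))
    (hβ : ∀ v : orbitTangent y, β v = l' (v : Alg E G)) :
    poisson P y α β = - P.formE y (brE E G (P.sharp l) (P.sharp l')) := by
  have h1 : P.form y ⁅(grad P y α : Alg E G), (grad P y β : Alg E G)⁆ =
      P.form y ⁅(show Alg E G from P.sharp l), (show Alg E G from P.sharp l')⁆ :=
    form_lie_eq_of_forall_form_eq P
      (fun v hv => (form_grad P y α ⟨v, hv⟩).trans ((hα ⟨v, hv⟩).trans (P.form_sharp l v).symm))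
      (fun v hv => (form_grad P y β ⟨v, hv⟩).trans ((hβ ⟨v, hv⟩).trans (P.form_sharp l' v).symm))
  have h2 : P.formE y (brE E G (P.sharp l) (P.sharp l')) =
      P.form y ⁅(show Alg E G from P.sharp l), (show Alg E G from P.sharp l')⁆ :=
    congrArg (P.formE y) (brE_eq (E := E) (G := G) _ _)
  exact congrArg (fun t : ℝ => -t) (h1.trans h2.symm)

/-- In terms of local extensions the bracket is, up to sign, the restriction of a continuous
function `Φ`; were it nonzero at `y`, it would be nonzero at a nearby point of `U`. -/
theorem isMultiplicityFreeAction_of_dense (P : InvariantScalarProduct E G) {x : Alg E G}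
    {U : Set (adjointOrbit E G x)} (hU : Dense U)
    (h : ∀ y ∈ U, ∀ α ∈ invariantDifferentials ι y, ∀ β ∈ invariantDifferentials ι y,
      poisson P y α β = 0) : IsMultiplicityFreeAction P ι x := by
  rintro f₁ f₂ hf₁ hf₂ y α β ⟨V₁, F₁, hy₁, hF₁, hα⟩ ⟨V₂, F₂, hy₂, hF₂, hβ⟩
  let co : adjointOrbit E G x → E := fun y => (y : Alg E G)
  have hco : Continuous co := continuous_subtype_val
  let Φ : E → ℝ := fun z => P.formE z (brE E G (P.sharp (fderiv ℝ F₁ z)) (P.sharp (fderiv ℝ F₂ z)))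
  have hΦ : ContinuousAt Φ (co y) := by
    have h1 : ContinuousAt (fderiv ℝ F₁) (co y) :=
      ((hF₁.smooth.contDiffAt (hF₁.isOpen.mem_nhds hy₁)).fderiv_right (m := 0)
        (by simp)).continuousAt
    have h2 : ContinuousAt (fderiv ℝ F₂) (co y) :=
      ((hF₂.smooth.contDiffAt (hF₂.isOpen.mem_nhds hy₂)).fderiv_right (m := 0)
        (by simp)).continuousAt
    have h3 := P.sharp.continuous.continuousAt.comp (f := fderiv ℝ F₁) h1
    have h4 := P.sharp.continuous.continuousAt.comp (f := fderiv ℝ F₂) h2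
    exact P.formE.continuous.continuousAt.clm_apply
      (((brE E G).continuous.continuousAt.comp h3).clm_apply h4)
  have hpois : ∀ (z : adjointOrbit E G x) {α β : OrbitCotangent (z : Alg E G)},
      (∀ v : orbitTangent (z : Alg E G), α v = fderiv ℝ F₁ (co z) (v : Alg E G)) →
      (∀ v : orbitTangent (z : Alg E G), β v = fderiv ℝ F₂ (co z) (v : Alg E G)) →
      poisson P (z : Alg E G) α β = - Φ (co z) := fun z _ _ h1 h2 => poisson_eq P _ h1 h2
  rw [hpois y hα hβ, neg_eq_zero]
  by_contra hne
  have h1 : ∀ᶠ z in 𝓝 y, Φ (co z) ≠ 0 ∧ co z ∈ V₁ ∧ co z ∈ V₂ :=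
    (hco.continuousAt.eventually (hΦ.eventually_ne hne)).and
      ((hco.continuousAt.eventually (hF₁.isOpen.mem_nhds hy₁)).and
        (hco.continuousAt.eventually (hF₂.isOpen.mem_nhds hy₂)))
  obtain ⟨z, ⟨hz, hz₁, hz₂⟩, hzU⟩ := mem_closure_iff_nhds.1 (hU y) _ h1
  have h2 := h z hzU (restrictCovector (z : Alg E G) (fderiv ℝ F₁ (co z)))
    ⟨f₁, hf₁, V₁, F₁, hz₁, hF₁, fun v => rfl⟩
    (restrictCovector (z : Alg E G) (fderiv ℝ F₂ (co z)))
    ⟨f₂, hf₂, V₂, F₂, hz₂, hF₂, fun v => rfl⟩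
  rw [hpois z (fun v => rfl) (fun v => rfl), neg_eq_zero] at h2
  exact hz h2

theorem isMultiplicityFreeAction_iff [CompactSpace K] [ConnectedSpace G]
    (hι : IsLieSubgroup (E := E) (E' := E') ι)
    (P : InvariantScalarProduct E G) {x : Alg E G} (hx : IsGeneric E' ι x) :
    IsMultiplicityFreeAction P ι x ↔ HasComplexity P ι x 0 := by
  have hle : ∀ y : adjointOrbit E G x, invariantKernel P ι y ≤ invariantDifferentials ι y :=
    fun y α hα => hα.1
  constructor
  · intro h
    obtain ⟨U, hU, hd, hfin⟩ := exists_dense_finrank_eq hι P hx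
    have : Nonempty (adjointOrbit E G x) := ⟨⟨_, 1, rfl⟩⟩
    obtain ⟨y₀, hy₀⟩ := hd.nonempty
    -- Commutativity says that the Poisson tensor vanishes on `F_y`, so the differential index
    -- equals the differential dimension. Conversely, complexity `0` forces this equality on a dense
    -- set.
    have heq : ∀ y : adjointOrbit E G x, invariantKernel P ι y = invariantDifferentials ι y :=
      fun y => le_antisymm (hle y) fun α hα => ⟨hα, fun β hβ => by
        obtain ⟨f₁, hf₁, h₁⟩ := hα
        obtain ⟨f₂, hf₂, h₂⟩ := hβ
        exact h f₁ f₂ hf₁ hf₂ y α β h₁ h₂⟩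
    refine ⟨U, hU, hd, finrank ℝ (invariantDifferentials ι y₀),
      finrank ℝ (invariantDifferentials ι y₀), fun y hy => ?_, by simp⟩
    have h1 := (hfin y hy).1
    have h2 := (hfin y₀ hy₀).1
    rw [heq]
    constructor <;> omega
  · rintro ⟨U, -, hd, d, i, hdi, hc⟩
    refine isMultiplicityFreeAction_of_dense P hd fun y hy α hα β hβ => ?_
    obtain ⟨h1, h2⟩ := hdi y hy
    have h3 : invariantKernel P ι y = invariantDifferentials ι y := by
      refine Submodule.eq_of_le_of_finrank_eq (hle y) ?_
      rw [h1, h2]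
      simp only [Nat.cast_zero, mul_zero] at hc
      omega
    rw [← h3] at hα
    exact hα.2 β hβ

theorem IsGeneric.finrank_map_prP_eq {x x' : Alg E G} (P : InvariantScalarProduct E G)
    (hx : IsGeneric E' ι x) (hx' : IsGeneric E' ι x') :
    finrank ℝ ((isotropy x).map (prP E' P ι)) = finrank ℝ ((isotropy x').map (prP E' P ι)) := by
  have h1 := finrank_map_prP (E' := E') P ι (isotropy x)
  have h2 := finrank_map_prP (E' := E') P ι (isotropy x')
  have h3 := le_antisymm (hx.1 x') (hx'.1 x)
  have h4 := le_antisymm (hx.2 x') (hx'.2 x)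
  omega

end Complexity
end AdjointComplexity

open AdjointComplexity in
theorem proposition5p2
    {E : Type*} [NormedAddCommGroup E] [NormedSpace ℝ E] [FiniteDimensional ℝ E]
    {G : Type*} [TopologicalSpace G] [ChartedSpace E G] [Group G] [LieGroup 𝓘(ℝ, E) ∞ G]
    [T2Space G] [CompactSpace G] [ConnectedSpace G]
    {E' : Type*} [NormedAddCommGroup E'] [NormedSpace ℝ E'] [FiniteDimensional ℝ E']
    {K : Type*} [TopologicalSpace K] [ChartedSpace E' K] [Group K] [LieGroup 𝓘(ℝ, E') ∞ K]
    [T2Space K] [CompactSpace K] [ConnectedSpace K]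
    (ι : K →* G) (hι : IsLieSubgroup (E := E) (E' := E') ι)
    (P : InvariantScalarProduct E G) :
    (∃! c : ℕ, HasGenericComplexity E' P ι c) ∧
    ∀ x : Alg E G, IsGeneric E' ι x →
      (∀ c : ℕ, HasGenericComplexity E' P ι c →
        (c : ℚ) = bNumber E' P ι - (finrank ℝ ((isotropy x).map (prP E' P ι)) : ℚ)) ∧
      (IsMultiplicityFreeSubgroup E' P ι ↔
        (finrank ℝ ((isotropy x).map (prP E' P ι)) : ℚ) = bNumber E' P ι) ∧
      (IsAlmostMultiplicityFreeSubgroup E' P ι ↔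
        (finrank ℝ ((isotropy x).map (prP E' P ι)) : ℚ) = bNumber E' P ι - 1) := by
  -- The right-hand side takes the same value at all generic elements, so one of them decides the
  -- complexity on every generic orbit.
  have hgen : ∀ x : Alg E G, IsGeneric E' ι x → ∀ c : ℕ,
      HasGenericComplexity E' P ι c ↔
        (c : ℚ) = bNumber E' P ι - (finrank ℝ ((isotropy x).map (prP E' P ι)) : ℚ) := by
    refine fun x hx c => ⟨fun h => (hasComplexity_iff hι P hx c).1 (h x hx), fun h x' hx' => ?_⟩
    rw [hasComplexity_iff hι P hx' c, h, hx.finrank_map_prP_eq P hx']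
  refine ⟨?_, fun x hx => ⟨fun c => (hgen x hx c).1, ?_, ?_⟩⟩
  -- Without a generic element every `c` would qualify vacuously, so uniqueness depends on this
  -- existence.
  · obtain ⟨x, hx⟩ := exists_isGeneric E G E' hι
    obtain ⟨c, hc⟩ := exists_complexity_eq hι P hx
    refine ⟨c, (hgen x hx c).2 hc, fun c' hc' => ?_⟩
    have h := ((hgen x hx c').1 hc').trans hc.symm
    exact_mod_cast h
  · have h1 : IsMultiplicityFreeSubgroup E' P ι ↔ HasGenericComplexity E' P ι 0 :=
      forall₂_congr fun z hz => isMultiplicityFreeAction_iff hι P hz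
    rw [h1, hgen x hx 0, Nat.cast_zero, eq_comm, sub_eq_zero, eq_comm]
  · have h1 : IsAlmostMultiplicityFreeSubgroup E' P ι ↔ HasGenericComplexity E' P ι 1 := Iff.rfl
    rw [h1, hgen x hx 1, Nat.cast_one]
    constructor <;> intro h <;> linarith
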